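/- Let $\Gamma$ be a (discrete) group and let $\underline{E}\Gamma$ be a model for the classifying space for proper actions of $\Gamma$, that is, a $\Gamma$-CW complex with finite stabilisers whose fixed point set $(\underline{E}\Gamma)^H$ is contractible for every finite subgroup $H$ of $\Gamma$. Let $\underline{B}\Gamma = \Gamma\backslash\underline{E}\Gamma$ be the orbit space, and let $\underline{E}\Gamma^{\mathrm{sing}}$ be the subcomplex of the points of $\underline{E}\Gamma$ with non-trivial stabiliser. Let $\dim \underline{E}\Gamma^{\mathrm{sing}}$ denote the minimal dimension of a $\Gamma$-CW complex that is $\Gamma$-homotopy equivalent to $\underline{E}\Gamma^{\mathrm{sing}}$ (where the empty complex, which occurs for torsion-free $\Gamma$, is counted as $0$-dimensional). Let $H^{\mathfrak{Fin}}_q(\underline{E}\Gamma; R_{\mathbb C})$ be the Bredon homology of $\underline{E}\Gamma$ with coefficients in the complex representation ring, i.e. in the system $\Gamma/H \mapsto R_{\mathbb C}(H)$ for finite subgroups $H$, covariant by induction of representations. If $\dim \underline{E}\Gamma^{\mathrm{sing}} = 0$, then there are isomorphisms of abelian groups $$H^{\mathfrak{Fin}}_q(\underline{E}\Gamma; R_{\mathbb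 C}) \cong H_q(\underline{B}\Gamma; \mathbb Z) \quad\text{for all } q > 0, \qquad H^{\mathfrak{Fin}}_0(\underline{E}\Gamma; R_{\mathbb C}) \cong \mathbb Z[\mathrm{FC}(\Gamma)],$$ where $\mathbb Z[\mathrm{FC}(\Gamma)]$ is the free abelian group on the set $\mathrm{FC}(\Gamma)$ of conjugacy classes of elements of finite order in $\Gamma$. -/

import Mathlib

open CategoryTheory

universe u

namespace Bredon

/-! ## Complex representation rings and induction -/

section RepresentationRing

/-- `χ : H → ℂ` is the character of a finite-dimensional complex representation of `H`. -/
def IsCharacter (H : Type*) [Group H] (χ : H → ℂ) : Prop :=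
  ∃ (n : ℕ) (ρ : Representation ℂ H (Fin n → ℂ)), χ = ρ.character

/-- The additive group of the complex representation ring `R_ℂ(H)` of a finite group `H`, as the
group of virtual characters: the subgroup of the functions `H → ℂ` generated by the characters
of the finite-dimensional complex representations of `H`. -/
def RC (H : Type*) [Group H] : AddSubgroup (H → ℂ) :=
  AddSubgroup.closure {χ | IsCharacter H χ}

variable {H K L : Type*} [Group H] [Group K] [Group L]

open Classical in
/-- Frobenius' formula for the induction of class functions along a homomorphism `φ : H → K` of
finite groups:
`(Ind_φ f)(k) = |H|⁻¹ ∑_{x ∈ K} ∑_{h ∈ H, φ h = x⁻¹ k x} f h`.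
It is used for injective `φ` only, where it is the usual
`(Ind f)(k) = |H|⁻¹ ∑_{x ∈ K, x⁻¹ k x ∈ H} f (x⁻¹ k x)`. -/
noncomputable def indFun [Finite H] [Finite K] (φ : H →* K) : (H → ℂ) →+ (K → ℂ) where
  toFun f k := (Nat.card H : ℂ)⁻¹ *
    ∑ᶠ x : K, ∑ᶠ h : H, if φ h = x⁻¹ * k * x then f h else 0
  map_zero' := by
    funext k
    simp
  map_add' f g := by
    cases nonempty_fintype H
    cases nonempty_fintype K
    funext k
    simp only [finsum_eq_sum_of_fintype, Pi.add_apply, ← mul_add, ← Finset.sum_add_distrib]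
    congr 1
    refine Finset.sum_congr rfl fun x _ => Finset.sum_congr rfl fun h _ => ?_
    split_ifs <;> simp

open Classical in
theorem indFun_apply [Fintype H] [Fintype K] (φ : H →* K) (f : H → ℂ) (k : K) :
    indFun φ f k = (Fintype.card H : ℂ)⁻¹ *
      ∑ x : K, ∑ h : H, if φ h = x⁻¹ * k * x then f h else 0 := by
  simp [indFun, finsum_eq_sum_of_fintype]

theorem IsCharacter.of_representation {V : Type*} [AddCommGroup V] [Module ℂ V]
    [FiniteDimensional ℂ V] (ρ : Representation ℂ H V) : IsCharacter H ρ.character := by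
  let e : V ≃ₗ[ℂ] (Fin (Module.finrank ℂ V) → ℂ) := (Module.finBasis ℂ V).equivFun
  refine ⟨Module.finrank ℂ V,
    { toFun := fun g => e.conj (ρ g)
      map_one' := by ext; simp
      map_mul' := fun g h => by
        rw [map_mul]
        exact LinearEquiv.conj_comp e (ρ h) (ρ g) }, ?_⟩
  funext g
  exact (LinearMap.trace_conj' (ρ g) e).symm

theorem trace_pi {ι V : Type*} [Fintype ι] [DecidableEq ι] [AddCommGroup V] [Module ℂ V]
    [FiniteDimensional ℂ V] (T : (ι → V) →ₗ[ℂ] (ι → V)) :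
    LinearMap.trace ℂ (ι → V) T =
      ∑ i, LinearMap.trace ℂ V
        (LinearMap.proj i ∘ₗ T ∘ₗ LinearMap.single ℂ (fun _ => V) i) := by
  have hT : T = ∑ i, (T ∘ₗ LinearMap.single ℂ (fun _ => V) i) ∘ₗ LinearMap.proj i := by
    refine LinearMap.ext fun f => ?_
    conv_lhs => rw [← Finset.univ_sum_single f, map_sum]
    simp
  conv_lhs => rw [hT]
  rw [map_sum]
  exact Finset.sum_congr rfl fun i _ => LinearMap.trace_comp_comm' _ _

/-- The left translation representation of `K` on the functions `K → V`. -/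
def transl (K V : Type*) [Group K] [AddCommGroup V] [Module ℂ V] :
    Representation ℂ K (K → V) where
  toFun k := LinearMap.funLeft ℂ V (fun x => k⁻¹ * x)
  map_one' := by ext; simp [LinearMap.funLeft]
  map_mul' k l := by
    refine LinearMap.ext fun f => funext fun x => ?_
    simp [LinearMap.funLeft, mul_assoc]

/-- The representation of `H` on the functions `K → V` that combines `ρ` with right translation
along `φ`; it commutes with left translation, and its invariants carry the induced
representation of `K`. -/
def twist {V : Type*} [AddCommGroup V] [Module ℂ V] (φ : H →* K) (ρ : Representation ℂ H V) :
    Representation ℂ H (K → V) where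
  toFun h :=
    { toFun := fun f x => ρ h (f (x * φ h))
      map_add' := fun f g => by funext x; simp
      map_smul' := fun c f => by funext x; simp }
  map_one' := by
    refine LinearMap.ext fun f => funext fun x => ?_
    simp
  map_mul' k l := by
    refine LinearMap.ext fun f => funext fun x => ?_
    simp [mul_assoc]

open Classical in
theorem IsCharacter.ind [Finite H] [Finite K] (φ : H →* K) {χ : H → ℂ} (hχ : IsCharacter H χ) :
    IsCharacter K (indFun φ χ) := by
  cases nonempty_fintype H
  cases nonempty_fintype K
  obtain ⟨n, ρ, rfl⟩ := hχ
  let V := Fin n → ℂ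
  let τ := twist φ ρ
  let lam := transl K V
  have hcomm : ∀ k h f, lam k (τ h f) = τ h (lam k f) := fun k h f => by
    funext x
    simp [lam, τ, transl, twist, LinearMap.funLeft, mul_assoc]
  let U := τ.invariants
  have hinv : ∀ k, ∀ f ∈ U, lam k f ∈ U := fun k f hf h => by
    rw [← hcomm, hf h]
  let θ : Representation ℂ K U :=
    { toFun := fun k => (lam k).restrict (hinv k)
      map_one' := by ext; simp
      map_mul' := fun k l => by ext; simp }
  have hcard : (Fintype.card H : ℂ) ≠ 0 := by
    exact_mod_cast Fintype.card_ne_zero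
  let _ : Invertible (Fintype.card H : ℂ) := invertibleOfNonzero hcard
  have key : indFun φ ρ.character = θ.character := by
    funext k
    let p : (K → V) →ₗ[ℂ] U := (τ.averageMap).codRestrict U (τ.averageMap_invariant)
    have h1 : θ k = p ∘ₗ (lam k ∘ₗ U.subtype) := by
      refine LinearMap.ext fun f => Subtype.ext ?_
      exact (τ.averageMap_id _ (hinv k f f.2)).symm
    have h2 : θ.character k = LinearMap.trace ℂ (K → V) (lam k ∘ₗ τ.averageMap) := by
      show LinearMap.trace ℂ U (θ k) = _
      rw [h1, LinearMap.trace_comp_comm']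
      rfl
    have h3 : τ.averageMap = (Fintype.card H : ℂ)⁻¹ • ∑ h, τ h := by
      simp [Representation.averageMap, GroupAlgebra.average, map_sum]
    have h4 : lam k ∘ₗ ∑ h, τ h = ∑ h, lam k ∘ₗ τ h := by
      refine LinearMap.ext fun f => ?_
      simp
    rw [h2, h3, LinearMap.comp_smul, map_smul, h4, map_sum, indFun_apply,
      Finset.sum_comm, smul_eq_mul]
    congr 1
    refine Finset.sum_congr rfl fun h _ => ?_
    rw [trace_pi]
    refine Finset.sum_congr rfl fun x _ => ?_
    split_ifs with hx
    · show _ = _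
      have : LinearMap.proj x ∘ₗ (lam k ∘ₗ τ h) ∘ₗ LinearMap.single ℂ (fun _ => V) x = ρ h := by
        refine LinearMap.ext fun v => ?_
        have hx' : k⁻¹ * x * φ h = x := by rw [hx]; group
        simp [lam, τ, transl, twist, LinearMap.funLeft, hx']
      rw [this]; rfl
    · have : LinearMap.proj x ∘ₗ (lam k ∘ₗ τ h) ∘ₗ LinearMap.single ℂ (fun _ => V) x = 0 := by
        refine LinearMap.ext fun v => ?_
        have hx' : k⁻¹ * x * φ h ≠ x := fun h' => hx (by
          rw [mul_assoc] at h'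
          have h'' := congrArg (fun y => x⁻¹ * k * y) h'
          simpa [mul_assoc] using h'')
        simp [lam, τ, transl, twist, LinearMap.funLeft, hx']
      rw [this, map_zero]
  rw [key]
  exact IsCharacter.of_representation θ

theorem indFun_mem [Finite H] [Finite K] (φ : H →* K) {f : H → ℂ} (hf : f ∈ RC H) :
    indFun φ f ∈ RC K := by
  have h : RC H ≤ (RC K).comap (indFun φ) :=
    (AddSubgroup.closure_le _).2 fun _ hχ => AddSubgroup.subset_closure (IsCharacter.ind φ hχ)
  exact h hf

/-- The covariant functoriality of `R_ℂ` on finite groups, by induction of representations. -/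
noncomputable def RC.ind [Finite H] [Finite K] (φ : H →* K) : RC H →+ RC K :=
  ((indFun φ).comp (RC H).subtype).codRestrict (RC K) fun f => indFun_mem φ f.2

theorem RC.conj_invariant {f : H → ℂ} (hf : f ∈ RC H) (x k : H) : f (x⁻¹ * k * x) = f k := by
  induction hf using AddSubgroup.closure_induction with
  | mem χ hχ =>
    obtain ⟨n, ρ, rfl⟩ := hχ
    rw [mul_assoc, Representation.char_mul_comm, mul_assoc, mul_inv_cancel, mul_one]
  | zero => rfl
  | add f g _ _ hf hg => simp only [Pi.add_apply, hf, hg]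
  | neg f _ hf => simp only [Pi.neg_apply, hf]

theorem RC.ind_id [Finite H] (r : RC H) : RC.ind (MonoidHom.id H) r = r := by
  classical
  cases nonempty_fintype H
  refine Subtype.ext (funext fun k => ?_)
  have hcard : (Fintype.card H : ℂ) ≠ 0 := by exact_mod_cast Fintype.card_ne_zero
  show indFun (MonoidHom.id H) r.1 k = r.1 k
  rw [indFun_apply]
  simp [RC.conj_invariant r.2, hcard]

theorem RC.ind_comp [Finite H] [Finite K] [Finite L] (ψ : K →* L) (φ : H →* K) (r : RC H) :
    RC.ind ψ (RC.ind φ r) = RC.ind (ψ.comp φ) r := by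
  classical
  cases nonempty_fintype H
  cases nonempty_fintype K
  cases nonempty_fintype L
  refine Subtype.ext (funext fun l => ?_)
  have hK : (Fintype.card K : ℂ) ≠ 0 := by exact_mod_cast Fintype.card_ne_zero
  show indFun ψ (indFun φ r.1) l = indFun (ψ.comp φ) r.1 l
  generalize r.1 = f
  have e1 : ∀ (y : L) (k : K), (if ψ k = y⁻¹ * l * y then indFun φ f k else 0) =
      (Fintype.card H : ℂ)⁻¹ * ∑ h : H, ∑ x : K,
        if ψ k = y⁻¹ * l * y ∧ k = x * φ h * x⁻¹ then f h else 0 := by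
    intro y k
    rw [Finset.sum_comm]
    split_ifs with hk
    · rw [indFun_apply]
      congr 1
      refine Finset.sum_congr rfl fun x _ => Finset.sum_congr rfl fun h _ => ?_
      have : φ h = x⁻¹ * k * x ↔ k = x * φ h * x⁻¹ := by
        constructor
        · intro e; rw [e]; group
        · intro e; rw [e]; group
      simp [hk, this]
    · simp [hk]
  have e2 : ∀ (y : L) (h : H) (x : K),
      (∑ k : K, if ψ k = y⁻¹ * l * y ∧ k = x * φ h * x⁻¹ then f h else 0) =
        if ψ (φ h) = (y * ψ x)⁻¹ * l * (y * ψ x) then f h else 0 := by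
    intro y h x
    have : ∀ k : K, (ψ k = y⁻¹ * l * y ∧ k = x * φ h * x⁻¹) ↔
        (k = x * φ h * x⁻¹ ∧ ψ (φ h) = (y * ψ x)⁻¹ * l * (y * ψ x)) := by
      intro k
      rw [and_comm]
      refine and_congr_right fun e => ?_
      rw [e, map_mul, map_mul, map_inv]
      constructor
      · intro e'
        have := congrArg (fun z => (ψ x)⁻¹ * z * ψ x) e'
        simpa [mul_assoc] using this
      · intro e'
        rw [e']
        group
    simp only [this, ite_and]
    simp
  rw [indFun_apply, indFun_apply]
  simp only [e1, ← Finset.mul_sum, MonoidHom.comp_apply]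
  have e3 : (∑ y : L, ∑ k : K, ∑ h : H, ∑ x : K,
      if ψ k = y⁻¹ * l * y ∧ k = x * φ h * x⁻¹ then f h else 0) =
      (Fintype.card K : ℂ) *
        ∑ y : L, ∑ h : H, if ψ (φ h) = y⁻¹ * l * y then f h else 0 := by
    have s1 : ∀ y : L, (∑ k : K, ∑ h : H, ∑ x : K,
        if ψ k = y⁻¹ * l * y ∧ k = x * φ h * x⁻¹ then f h else 0) =
        ∑ x : K, ∑ h : H,
          if ψ (φ h) = (y * ψ x)⁻¹ * l * (y * ψ x) then f h else 0 := by
      intro y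
      rw [Finset.sum_comm]
      rw [Finset.sum_comm (s := (Finset.univ : Finset K)) (t := (Finset.univ : Finset H))]
      refine Finset.sum_congr rfl fun h _ => ?_
      rw [Finset.sum_comm]
      exact Finset.sum_congr rfl fun x _ => e2 y h x
    simp only [s1]
    rw [Finset.sum_comm]
    have s2 : ∀ x : K, (∑ y : L, ∑ h : H,
        if ψ (φ h) = (y * ψ x)⁻¹ * l * (y * ψ x) then f h else 0) =
        ∑ y : L, ∑ h : H, if ψ (φ h) = y⁻¹ * l * y then f h else 0 := fun x =>
      Equiv.sum_comp (Equiv.mulRight (ψ x))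
        (fun y => ∑ h : H, if ψ (φ h) = y⁻¹ * l * y then f h else 0)
    simp only [s2]
    simp
  rw [e3]
  field_simp

end RepresentationRing

/-! ## Bredon homology with coefficients in `R_ℂ` -/

section BredonHomology

/-- The action of `Γ` on `X` has finite stabilisers. -/
class FiniteStabilizers (Γ X : Type*) [Group Γ] [MulAction Γ X] : Prop where
  finite_stabilizer : ∀ x : X, Finite (MulAction.stabilizer Γ x)

/-- Singular `n`-simplices of `X`. -/
abbrev Sing (X : Type u) [TopologicalSpace X] (n : SimplexCategory) : Type u :=
  C(stdSimplex ℝ (Fin (n.len + 1)), X)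

variable (Γ : Type u) [Group Γ] (X : Type u) [TopologicalSpace X] [MulAction Γ X]
  [ContinuousConstSMul Γ X]

variable {X} in
/-- The simplicial structure maps of the singular complex: `f^* σ = σ ∘ |f|`. -/
noncomputable def Sing.pull {m n : SimplexCategory} (f : m ⟶ n) (σ : Sing X n) : Sing X m :=
  σ.comp ⟨stdSimplex.map f, stdSimplex.continuous_map f⟩

variable {X} in
theorem Sing.pull_id {n : SimplexCategory} (σ : Sing X n) : Sing.pull (𝟙 n) σ = σ := by
  ext x
  simp [Sing.pull]

variable {X} in
theorem Sing.pull_comp {k m n : SimplexCategory} (f : k ⟶ m) (g : m ⟶ n) (σ : Sing X n) :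
    Sing.pull (f ≫ g) σ = Sing.pull f (Sing.pull g σ) := by
  ext x
  simp only [Sing.pull, ContinuousMap.comp_apply, ContinuousMap.coe_mk, stdSimplex.map_comp_apply]
  rfl

variable {Γ X} in
theorem Sing.pull_smul {m n : SimplexCategory} (f : m ⟶ n) (g : Γ) (σ : Sing X n) :
    Sing.pull f (g • σ) = g • Sing.pull f σ := rfl

/-- The stabiliser `Γ_σ` of a singular simplex `σ`; it is the group of the elements of `Γ` that
fix the image of `σ` pointwise. -/
abbrev Sing.stab {n : SimplexCategory} (σ : Sing X n) : Subgroup Γ := MulAction.stabilizer Γ σ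

variable {Γ X} in
theorem Sing.mem_stab {n : SimplexCategory} (σ : Sing X n) (g : Γ) :
    g ∈ Sing.stab Γ X σ ↔ ∀ t, g • σ t = σ t := by
  rw [MulAction.mem_stabilizer_iff, ContinuousMap.ext_iff]
  rfl

instance Sing.finite_stab [FiniteStabilizers Γ X] {n : SimplexCategory} (σ : Sing X n) :
    Finite (Sing.stab Γ X σ) := by
  have t : stdSimplex ℝ (Fin (n.len + 1)) := stdSimplex.vertex 0
  have := FiniteStabilizers.finite_stabilizer (Γ := Γ) (σ t)
  have hle : Sing.stab Γ X σ ≤ MulAction.stabilizer Γ (σ t) :=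
    fun g hg => (Sing.mem_stab σ g).1 hg t
  exact Finite.of_injective _ (Subgroup.inclusion_injective hle)

variable {X} in
theorem Sing.stab_le_pull {m n : SimplexCategory} (f : m ⟶ n) (σ : Sing X n) :
    Sing.stab Γ X σ ≤ Sing.stab Γ X (Sing.pull f σ) := fun g hg => by
  rw [Sing.mem_stab] at hg ⊢
  exact fun t => hg _

variable {Γ X} in
/-- Conjugation `Γ_σ → Γ_{gσ}`, `h ↦ g h g⁻¹`. -/
def Sing.conj {n : SimplexCategory} (g : Γ) (σ : Sing X n) :
    Sing.stab Γ X σ →* Sing.stab Γ X (g • σ) :=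
  (MulAction.stabilizerEquivStabilizer (G := Γ) (a := σ) (b := g • σ) rfl).toMonoidHom

open DirectSum in
/-- The direct sum of the `R_ℂ(Γ_σ)` over all singular `n`-simplices `σ` of `X`. -/
abbrev PreChains (n : SimplexCategory) : Type u := ⨁ σ : Sing X n, RC (Sing.stab Γ X σ)

open Classical in
/-- The element `r ∈ R_ℂ(Γ_σ)` placed in the summand of `σ`. -/
noncomputable def PreChains.of {n : SimplexCategory} (σ : Sing X n) :
    RC (Sing.stab Γ X σ) →+ PreChains Γ X n :=
  DirectSum.of (fun σ : Sing X n => RC (Sing.stab Γ X σ)) σ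

theorem PreChains.hom_ext {n : SimplexCategory} {A : Type*} [AddCommGroup A]
    {F G : PreChains Γ X n →+ A}
    (h : ∀ σ r, F (PreChains.of Γ X σ r) = G (PreChains.of Γ X σ r)) : F = G := by
  classical
  exact DirectSum.addHom_ext h

variable [FiniteStabilizers Γ X]

/-- The relations `(gσ, g r g⁻¹) ∼ (σ, r)`, for `g ∈ Γ` and `r ∈ R_ℂ(Γ_σ)`. -/
def orbitRelations (n : SimplexCategory) : AddSubgroup (PreChains Γ X n) :=
  AddSubgroup.closure {c | ∃ (g : Γ) (σ : Sing X n) (r : RC (Sing.stab Γ X σ)),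
    c = PreChains.of Γ X (g • σ) (RC.ind (Sing.conj g σ) r) - PreChains.of Γ X σ r}

/-- The Bredon chains `C_n(X; R_ℂ) = ⨁_{σ ∈ Γ \ Sing_n X} R_ℂ(Γ_σ)`, written without choosing
representatives of the orbits.  This is the tensor product over the orbit category of the
contravariant functor `Γ/H ↦ ℤ[Sing_n (X^H)]` with the covariant functor `Γ/H ↦ R_ℂ(H)`. -/
abbrev Chains (n : SimplexCategory) : Type u := PreChains Γ X n ⧸ orbitRelations Γ X n

open Classical in
/-- The structure map `(σ, r) ↦ (f^* σ, Ind r)`, with induction along `Γ_σ ≤ Γ_{f^* σ}`. -/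
noncomputable def PreChains.map {m n : SimplexCategory} (f : m ⟶ n) :
    PreChains Γ X n →+ PreChains Γ X m :=
  DirectSum.toAddMonoid fun σ => (PreChains.of Γ X (Sing.pull f σ)).comp
    (RC.ind (Subgroup.inclusion (Sing.stab_le_pull Γ f σ)))

theorem PreChains.map_of {m n : SimplexCategory} (f : m ⟶ n) (σ : Sing X n)
    (r : RC (Sing.stab Γ X σ)) :
    PreChains.map Γ X f (PreChains.of Γ X σ r) = PreChains.of Γ X (Sing.pull f σ)
      (RC.ind (Subgroup.inclusion (Sing.stab_le_pull Γ f σ)) r) := by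
  classical
  simp only [PreChains.map, PreChains.of]
  exact DirectSum.toAddMonoid_of _ _ _

theorem PreChains.of_congr {n : SimplexCategory} {σ τ : Sing X n} (e : σ = τ)
    {H : Type u} [Group H] [Finite H] (φ : H →* Sing.stab Γ X σ) (ψ : H →* Sing.stab Γ X τ)
    (hφψ : ∀ h, (φ h : Γ) = ψ h) (r : RC H) :
    PreChains.of Γ X σ (RC.ind φ r) = PreChains.of Γ X τ (RC.ind ψ r) := by
  subst e
  have : φ = ψ := MonoidHom.ext fun h => Subtype.ext (hφψ h)
  rw [this]

theorem PreChains.map_id (n : SimplexCategory) :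
    PreChains.map Γ X (𝟙 n) = AddMonoidHom.id _ := by
  refine PreChains.hom_ext Γ X fun σ r => ?_
  rw [PreChains.map_of, AddMonoidHom.id_apply]
  conv_rhs => rw [← RC.ind_id r]
  exact PreChains.of_congr Γ X (Sing.pull_id σ) _ _ (fun h => rfl) r

theorem PreChains.map_comp {k m n : SimplexCategory} (f : k ⟶ m) (g : m ⟶ n) :
    PreChains.map Γ X (f ≫ g) = (PreChains.map Γ X f).comp (PreChains.map Γ X g) := by
  refine PreChains.hom_ext Γ X fun σ r => ?_
  refine (PreChains.map_of Γ X (f ≫ g) σ r).trans (Eq.trans ?_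
    (congrArg (PreChains.map Γ X f) (PreChains.map_of Γ X g σ r)).symm)
  refine Eq.trans ?_ (PreChains.map_of Γ X f (Sing.pull g σ) _).symm
  rw [RC.ind_comp]
  exact PreChains.of_congr Γ X (Sing.pull_comp f g σ)
    (Subgroup.inclusion (Sing.stab_le_pull Γ (f ≫ g) σ))
    ((Subgroup.inclusion (Sing.stab_le_pull Γ f (Sing.pull g σ))).comp
      (Subgroup.inclusion (Sing.stab_le_pull Γ g σ))) (fun h => rfl) r

theorem PreChains.map_orbitRelations {m n : SimplexCategory} (f : m ⟶ n) :
    orbitRelations Γ X n ≤ (orbitRelations Γ X m).comap (PreChains.map Γ X f) := by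
  refine (AddSubgroup.closure_le _).2 ?_
  rintro _ ⟨g, σ, r, rfl⟩
  refine AddSubgroup.subset_closure ⟨g, Sing.pull f σ,
    RC.ind (Subgroup.inclusion (Sing.stab_le_pull Γ f σ)) r, ?_⟩
  rw [map_sub, PreChains.map_of, PreChains.map_of, RC.ind_comp, RC.ind_comp]
  rfl

/-- The simplicial structure maps of the Bredon chains. -/
noncomputable def Chains.map {m n : SimplexCategory} (f : m ⟶ n) :
    Chains Γ X n →+ Chains Γ X m :=
  QuotientAddGroup.map _ _ (PreChains.map Γ X f) (PreChains.map_orbitRelations Γ X f)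

/-- The simplicial abelian group `[n] ↦ ⨁_{σ ∈ Γ \ Sing_n X} R_ℂ(Γ_σ)`. -/
noncomputable def simplicialChains : SimplicialObject (ModuleCat.{u} ℤ) where
  obj n := ModuleCat.of ℤ (Chains Γ X n.unop)
  map f := ModuleCat.ofHom (Chains.map Γ X f.unop).toIntLinearMap
  map_id n := by
    refine ModuleCat.hom_ext (LinearMap.ext fun c => ?_)
    induction c using QuotientAddGroup.induction_on with
    | H c =>
      exact congrArg _ (DFunLike.congr_fun (PreChains.map_id Γ X n.unop) c)
  map_comp f g := by
    refine ModuleCat.hom_ext (LinearMap.ext fun c => ?_)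
    induction c using QuotientAddGroup.induction_on with
    | H c =>
      exact congrArg _ (DFunLike.congr_fun (PreChains.map_comp Γ X g.unop f.unop) c)

/-- The Bredon chain complex of `X` with coefficients in `R_ℂ`: the group in degree `n` is
`⨁_{σ ∈ Γ \ Sing_n X} R_ℂ(Γ_σ)`, and the differential is
`(σ, r) ↦ ∑ i, (-1)^i (d_i σ, Ind r)`. -/
noncomputable def chainComplex : ChainComplex (ModuleCat.{u} ℤ) ℕ :=
  (AlgebraicTopology.alternatingFaceMapComplex (ModuleCat.{u} ℤ)).obj (simplicialChains Γ X)

/-- The Bredon homology `H_q^Fin(X; R_ℂ)` of a `Γ`-space `X` with finite stabilisers, in its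
singular form (equivariant singular homology with coefficients in the covariant coefficient
system `Γ/H ↦ R_ℂ(H)`), which is defined without reference to a cell structure; on `Γ`-CW
complexes it is the Bredon homology given by the cells of `X`. -/
noncomputable abbrev homology (q : ℕ) : ModuleCat.{u} ℤ := (chainComplex Γ X).homology q

end BredonHomology

/-- The singular homology `H_q(B; ℤ)` of a topological space `B`. -/
noncomputable abbrev singularHomology (B : Type u) [TopologicalSpace B] (q : ℕ) :
    ModuleCat.{u} ℤ :=
  ((AlgebraicTopology.singularHomologyFunctor (ModuleCat.{u} ℤ) q).obj
    (ModuleCat.of ℤ (ULift.{u} ℤ))).obj (TopCat.of B)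

/-! ## `Γ`-CW complexes, classifying spaces for proper actions, and their singular part -/

section ClassifyingSpace

variable (Γ : Type u) [Group Γ] (X : Type u) [TopologicalSpace X] [MulAction Γ X]

/-- A `Γ`-CW structure on the `Γ`-space `X`, for a discrete group `Γ`: a CW structure whose open
cells are permuted by `Γ`, such that an element of `Γ` that maps a cell to itself fixes this cell
pointwise. -/
class GammaCW extends Topology.CWComplex (Set.univ : Set X) where
  exists_image_openCell : ∀ (g : Γ) (n : ℕ)
    (e : Topology.RelCWComplex.cell (Set.univ : Set X) n),
    ∃ e' : Topology.RelCWComplex.cell (Set.univ : Set X) n,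
      (fun x => g • x) '' Topology.RelCWComplex.openCell n e =
        Topology.RelCWComplex.openCell n e'
  smul_eq_of_image_openCell_eq : ∀ (g : Γ) (n : ℕ)
    (e : Topology.RelCWComplex.cell (Set.univ : Set X) n),
    (fun x => g • x) '' Topology.RelCWComplex.openCell n e =
      Topology.RelCWComplex.openCell n e →
    ∀ x ∈ Topology.RelCWComplex.openCell n e, g • x = x

/-- The dimension of a `Γ`-CW complex: the supremum of the dimensions of its cells.  (The empty
complex has dimension `0` here.) -/
noncomputable def GammaCW.dim [GammaCW Γ X] : ℕ∞ :=
  ⨆ (n : ℕ) (_ : Nonempty (Topology.RelCWComplex.cell (Set.univ : Set X) n)), (n : ℕ∞)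

/-- `X` is a model for the classifying space for proper actions `E̲Γ`: it is a (Hausdorff) `Γ`-CW
complex with finite stabilisers, such that the fixed point set `X^H` is contractible for every
finite subgroup `H` of `Γ`. -/
class IsClassifyingSpaceForProperActions : Prop extends
    T2Space X, ContinuousConstSMul Γ X, FiniteStabilizers Γ X where
  exists_gammaCW : Nonempty (GammaCW Γ X)
  contractible_fixedPoints : ∀ H : Subgroup Γ, Finite H →
    ContractibleSpace (MulAction.fixedPoints H X)

/-- The singular part `X^sing`: the `Γ`-subspace of the points with non-trivial stabiliser. -/
def singularPart : SubMulAction Γ X where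
  carrier := {x | MulAction.stabilizer Γ x ≠ ⊥}
  smul_mem' g x hx := by
    refine fun h => hx (eq_bot_iff.2 fun a ha => ?_)
    have h1 : g * a * g⁻¹ ∈ MulAction.stabilizer Γ (g • x) := by
      rw [MulAction.mem_stabilizer_iff] at ha ⊢
      rw [mul_smul, inv_smul_smul, mul_smul, ha]
    rw [h, Subgroup.mem_bot] at h1
    rw [Subgroup.mem_bot]
    simpa using h1

variable {X} in
/-- `X` and `Y` are `Γ`-homotopy equivalent. -/
def GammaHomotopyEquivalent (Y : Type u) [TopologicalSpace Y] [MulAction Γ Y] : Prop :=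
  ∃ (f : C(X, Y)) (h : C(Y, X)),
    (∀ (g : Γ) (x : X), f (g • x) = g • f x) ∧ (∀ (g : Γ) (y : Y), h (g • y) = g • h y) ∧
    (∃ F : (h.comp f).Homotopy (ContinuousMap.id X),
      ∀ (g : Γ) (t : unitInterval) (x : X), F (t, g • x) = g • F (t, x)) ∧
    (∃ F : (f.comp h).Homotopy (ContinuousMap.id Y),
      ∀ (g : Γ) (t : unitInterval) (y : Y), F (t, g • y) = g • F (t, y))

/-- `dim E̲Γ^sing`, computed from a model `X` for `E̲Γ`: the minimal dimension of the `Γ`-CW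
complexes in the `Γ`-homotopy type of the singular part of `X`. -/
noncomputable def singularDim : ℕ∞ :=
  sInf {d | ∃ (S : Type u) (_ : TopologicalSpace S) (_ : MulAction Γ S) (_ : T2Space S)
    (_ : ContinuousConstSMul Γ S) (_ : GammaCW Γ S),
    GammaHomotopyEquivalent Γ (X := singularPart Γ X) S ∧ d = GammaCW.dim Γ S}

end ClassifyingSpace

/-- `FC(Γ)`: the set of conjugacy classes of elements of finite order in `Γ`. -/
def FC (Γ : Type u) [Group Γ] : Type u :=
  {c : ConjClasses Γ // ∃ g : Γ, IsOfFinOrder g ∧ ConjClasses.mk g = c}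

end Bredon

/-!
The Bredon chains `BC Γ X n` are generated by pairs `(σ, r)` of a singular simplex of `X` and a
virtual character `r` of its (finite) stabiliser, up to the action of `Γ`. The multiplicity of the
trivial representation in `r` is preserved by induction (`RC.aug_ind`), so that it defines a chain
map `eps` to the free abelian groups on the `Γ`-orbits of singular simplices of `X` (`orbSing`).
These map to the singular chains of the orbit space by projecting simplices (`orbMap`). The
homology of the first complex is compared with that of the last one in two steps.

*From orbits of simplices to the orbit space.* The map `orbMap` is a quasi-isomorphism for every
`Γ`-CW complex `X` (`acyclicOver_univ`). This is stated as acyclicity of the mapping cone, and proved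
by induction over the skeleta of the orbit space with the usual properties of singular chains, which
hold for both complexes since these are functorial for all continuous maps between standard
simplices (`SplxSet`). The `n`-skeleton is covered by the union of the open `n`-cells and the
complement of the inner halves of the `n`-cells. Barycentric subdivision gives a Mayer–Vietoris
argument (`AcyclicOver.of_cover`). Over the open cells, simplices have lifts that are unique up to
`Γ`, since an element of `Γ` that maps an open cell to itself fixes it (`AcyclicOver.of_lift`). The
complement of the inner halves is pushed radially to the lower skeleton by an equivariant homotopy,
which is allowed by a prism operator (`AcyclicOver.of_homotopy`). The passage to the colimit uses
that compact subsets of the orbit space lie in a skeleton (`exists_subset_image_sk`).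

*From Bredon chains to orbits of simplices.* The map `eps` is split in each degree by the trivial
representations, and its kernel is generated by the pairs `(σ, r)` in which the trivial
representation has multiplicity zero in `r` (`mem_redChains_of_eps_eq_zero`). Then `σ` has a
non-trivial stabiliser, so that it lies in the singular part. If the singular part has the
equivariant homotopy type of a zero-dimensional complex, hence of a discrete space, it can be
deformed to a discrete set of its points (`DiscreteDeformation`). The prism operator of this
deformation replaces the cycles of the kernel by chains of constant simplices, which have no homology
in positive degrees (`DiscreteDeformation.exists_bd_eq`).

*Degree zero.* The homology of the kernel in degree zero is generated by the reduced representation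
rings of the stabilisers of representatives of the orbits in the discrete set. A non-trivial element
of finite order has a connected fixed point set in `X`, and therefore it fixes exactly one point of
the discrete set. It follows that non-trivial conjugacy classes of the stabilisers of the
representatives are the same as non-trivial classes of elements of finite order in `Γ`
(`DiscreteDeformation.toFC_bijective`), and that the sum of the values of the coefficients over such
a class (`classSum`) is a homomorphism that vanishes on boundaries and detects the coefficients.
Thus the homology of the kernel in degree zero is the direct sum of the reduced representation
rings, and it injects into the homology of the Bredon chains; together with a path component of `X`,
which accounts for the identity class, this yields the degree zero part, because the representation
ring of a finite group is free of rank the number of conjugacy classes (`RC.free_and_finrank`).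
-/

namespace Bredon

/-! ### Ordered chains and cone operators -/

section OrderedChains

variable {S T S' T' : Type*} {m : ℕ}

/-- Ordered chains: the free abelian group on the `(m + 1)`-tuples of points of `T`. A tuple of
points of a convex space stands for the affine singular simplex with these vertices. -/
abbrev OrdChain (T : Type*) (m : ℕ) := (Fin (m + 1) → T) →₀ ℤ

namespace OrdChain

/-- The generator given by a tuple. -/
noncomputable def of (v : Fin (m + 1) → T) : OrdChain T m := Finsupp.single v 1

theorem hom_ext {M : Type*} [AddCommGroup M] {f g : OrdChain T m →ₗ[ℤ] M}
    (h : ∀ v, f (of v) = g (of v)) : f = g :=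
  Finsupp.lhom_ext' fun v => LinearMap.ext_ring (h v)

/-- The map on ordered chains induced by a map of points. -/
noncomputable def map (f : S → T) : OrdChain S m →ₗ[ℤ] OrdChain T m :=
  Finsupp.lmapDomain ℤ ℤ (fun v => f ∘ v)

@[simp] theorem map_of (f : S → T) (v : Fin (m + 1) → S) : map f (of v) = of (f ∘ v) := by
  simp [map, of]

/-- The alternating sum of the faces. -/
noncomputable def d : OrdChain T (m + 1) →ₗ[ℤ] OrdChain T m :=
  ∑ i : Fin (m + 2), (-1 : ℤ) ^ (i : ℕ) • Finsupp.lmapDomain ℤ ℤ (fun v => v ∘ i.succAbove)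

theorem d_of (v : Fin (m + 2) → T) :
    d (of v) = ∑ i : Fin (m + 2), (-1 : ℤ) ^ (i : ℕ) • of (v ∘ i.succAbove) := by
  simp [d, of]

theorem d_map (f : S → T) (c : OrdChain S (m + 1)) : d (map f c) = map f (d c) := by
  have : d ∘ₗ map f (m := m + 1) = map f ∘ₗ d := hom_ext fun v => by
    simp [d_of, Function.comp_assoc]
  exact LinearMap.congr_fun this c

/-- The sum of the coefficients. -/
noncomputable def aug : OrdChain T m →ₗ[ℤ] ℤ := Finsupp.linearCombination ℤ fun _ => (1 : ℤ)

@[simp] theorem aug_of (v : Fin (m + 1) → T) : aug (of v) = 1 := by simp [aug, of]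

/-- The cone with apex `b`. -/
noncomputable def cone (b : T) : OrdChain T m →ₗ[ℤ] OrdChain T (m + 1) :=
  Finsupp.lmapDomain ℤ ℤ (fun v => (Fin.cons b v : Fin (m + 2) → T))

@[simp] theorem cone_of (b : T) (v : Fin (m + 1) → T) :
    cone b (of v) = of (Fin.cons b v : Fin (m + 2) → T) := by
  simp [cone, of]

theorem map_cone (f : S → T) (b : S) (c : OrdChain S m) :
    map f (cone b c) = cone (f b) (map f c) := by
  have : map f ∘ₗ cone b (m := m) = cone (f b) ∘ₗ map f := hom_ext fun v => by
    simp only [LinearMap.comp_apply, cone_of, map_of]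
    congr 1
    ext i
    refine Fin.cases ?_ (fun j => ?_) i <;> simp
  exact LinearMap.congr_fun this c

theorem d_cone (b : T) (c : OrdChain T (m + 1)) : d (cone b c) = c - cone b (d c) := by
  have : d ∘ₗ cone b (m := m + 1) = LinearMap.id - cone b ∘ₗ d := hom_ext fun v => by
    simp only [LinearMap.comp_apply, LinearMap.sub_apply, LinearMap.id_apply, cone_of, d_of,
      map_sum, map_zsmul]
    rw [Fin.sum_univ_succ, sub_eq_add_neg, ← Finset.sum_neg_distrib]
    refine congrArg₂ (· + ·) ?_ (Finset.sum_congr rfl fun i _ => ?_)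
    · simp only [Fin.val_zero, pow_zero, one_smul]
      rfl
    · rw [Fin.val_succ, pow_succ, mul_neg_one, neg_smul]
      congr 3
      ext k
      refine Fin.cases ?_ (fun j => ?_) k <;> simp
  exact LinearMap.congr_fun this c

theorem d_cone_zero (b : T) (c : OrdChain T 0) :
    d (cone b c) = c - aug c • of (fun _ => b) := by
  have : d ∘ₗ cone b (m := 0) = LinearMap.id - (aug (T := T) (m := 0)).smulRight (of fun _ => b) :=
      hom_ext fun v => by
    rw [LinearMap.comp_apply, LinearMap.sub_apply, LinearMap.id_apply, cone_of, d_of,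
      Fin.sum_univ_two, LinearMap.smulRight_apply, aug_of, one_smul, sub_eq_add_neg]
    refine congrArg₂ (· + ·) ?_ ?_
    · rw [Fin.val_zero, pow_zero, one_smul]
      rfl
    · rw [Fin.val_one, pow_one, neg_smul, one_smul]
      congr 2
      ext k
      obtain rfl : k = 0 := Subsingleton.elim (α := Fin 1) k 0
      rfl
  exact LinearMap.congr_fun this c

theorem d_d (c : OrdChain T (m + 2)) : d (d c) = 0 := by
  induction m with
  | zero =>
    have : d ∘ₗ d (m := 1) (T := T) = 0 := hom_ext fun v => by
      rw [← Fin.cons_self_tail v, ← cone_of, LinearMap.comp_apply, d_cone, map_sub, d_cone_zero,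
        d_of]
      simp [Fin.sum_univ_two]
    exact LinearMap.congr_fun this c
  | succ m ih =>
    have : d ∘ₗ d (m := m + 2) (T := T) = 0 := hom_ext fun v => by
      rw [← Fin.cons_self_tail v, ← cone_of, LinearMap.comp_apply, d_cone, map_sub, d_cone, ih]
      simp
    exact LinearMap.congr_fun this c

/-- The chain homotopy between two chain maps `φ` and `ψ` that is constructed degree by degree
with the cones with apices `b v`. -/
noncomputable def htpy (φ ψ : ∀ m, OrdChain S m →ₗ[ℤ] OrdChain T m)
    (b : ∀ m, (Fin (m + 1) → S) → T) : ∀ m, OrdChain S m →ₗ[ℤ] OrdChain T (m + 1)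
  | 0 => Finsupp.linearCombination ℤ fun v => cone (b 0 v) (φ 0 (of v) - ψ 0 (of v))
  | m + 1 => Finsupp.linearCombination ℤ fun v => cone (b (m + 1) v)
      (φ (m + 1) (of v) - ψ (m + 1) (of v) - htpy φ ψ b m (d (of v)))

section htpy

variable (φ ψ : ∀ m, OrdChain S m →ₗ[ℤ] OrdChain T m) (b : ∀ m, (Fin (m + 1) → S) → T)

theorem htpy_zero_of (v : Fin 1 → S) :
    htpy φ ψ b 0 (of v) = cone (b 0 v) (φ 0 (of v) - ψ 0 (of v)) := by
  simp [htpy, of]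

theorem htpy_succ_of (v : Fin (m + 2) → S) :
    htpy φ ψ b (m + 1) (of v) = cone (b (m + 1) v)
      (φ (m + 1) (of v) - ψ (m + 1) (of v) - htpy φ ψ b m (d (of v))) := by
  simp [htpy, of]

variable (hφ : ∀ m c, d (φ (m + 1) c) = φ m (d c)) (hψ : ∀ m c, d (ψ (m + 1) c) = ψ m (d c))
  (h0 : ∀ c, aug (φ 0 c) = aug (ψ 0 c))

include h0 in
theorem d_htpy_zero (c : OrdChain S 0) : d (htpy φ ψ b 0 c) = φ 0 c - ψ 0 c := by
  have : d ∘ₗ htpy φ ψ b 0 = φ 0 - ψ 0 := hom_ext fun v => by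
    simp only [LinearMap.comp_apply, htpy_zero_of, d_cone_zero, map_sub, h0]
    simp
  exact LinearMap.congr_fun this c

include hφ hψ h0 in
theorem d_htpy_succ (c : OrdChain S (m + 1)) :
    d (htpy φ ψ b (m + 1) c) = φ (m + 1) c - ψ (m + 1) c - htpy φ ψ b m (d c) := by
  have key : ∀ (m : ℕ) (x : OrdChain S (m + 1)), d (htpy φ ψ b m (d x)) = φ m (d x) - ψ m (d x) →
      d (φ (m + 1) x - ψ (m + 1) x - htpy φ ψ b m (d x)) = 0 := fun m x hx => by
    rw [map_sub, map_sub, hφ, hψ, hx, sub_self]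
  have step : ∀ m : ℕ, (∀ v : Fin (m + 2) → S,
      d (htpy φ ψ b m (d (of v))) = φ m (d (of v)) - ψ m (d (of v))) → ∀ c : OrdChain S (m + 1),
      d (htpy φ ψ b (m + 1) c) = φ (m + 1) c - ψ (m + 1) c - htpy φ ψ b m (d c) := fun m hm => by
    have : d ∘ₗ htpy φ ψ b (m + 1) = φ (m + 1) - ψ (m + 1) - htpy φ ψ b m ∘ₗ d :=
        hom_ext fun v => by
      simp only [LinearMap.comp_apply, htpy_succ_of, LinearMap.sub_apply, d_cone]
      rw [key m _ (hm v), map_zero, sub_zero]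
    exact LinearMap.congr_fun this
  induction m with
  | zero => exact step 0 (fun v => d_htpy_zero φ ψ b h0 _) c
  | succ m ih => exact step (m + 1) (fun v => by rw [ih, d_d, map_zero, sub_zero]) c

end htpy

theorem map_htpy (f : S → S') (f' : T → T') {φ ψ : ∀ m, OrdChain S m →ₗ[ℤ] OrdChain T m}
    {φ' ψ' : ∀ m, OrdChain S' m →ₗ[ℤ] OrdChain T' m}
    {b : ∀ m, (Fin (m + 1) → S) → T} {b' : ∀ m, (Fin (m + 1) → S') → T'}
    (hφ : ∀ m c, map f' (φ m c) = φ' m (map f c)) (hψ : ∀ m c, map f' (ψ m c) = ψ' m (map f c))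
    (hb : ∀ m v, f' (b m v) = b' m (f ∘ v)) (c : OrdChain S m) :
    map f' (htpy φ ψ b m c) = htpy φ' ψ' b' m (map f c) := by
  induction m with
  | zero =>
    have : map f' ∘ₗ htpy φ ψ b 0 = htpy φ' ψ' b' 0 ∘ₗ map f := hom_ext fun v => by
      simp only [LinearMap.comp_apply, htpy_zero_of, map_cone, map_sub, hφ, hψ, hb, map_of]
    exact LinearMap.congr_fun this c
  | succ m ih =>
    have : map f' ∘ₗ htpy φ ψ b (m + 1) = htpy φ' ψ' b' (m + 1) ∘ₗ map f := hom_ext fun v => by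
      simp only [LinearMap.comp_apply, htpy_succ_of, map_cone, map_sub, hφ, hψ, hb, ih, ← d_map,
        map_of]
    exact LinearMap.congr_fun this c

end OrdChain

end OrderedChains

/-! ### Affine simplices in convex spaces and barycentric subdivision -/

section ConvexComb

/-- The standard topological `n`-simplex. -/
abbrev Splx (n : ℕ) := stdSimplex ℝ (Fin (n + 1))

/-- The vertices of the standard simplex. -/
noncomputable def vert (n : ℕ) : Fin (n + 1) → Splx n := fun i => stdSimplex.vertex i

namespace Splx

variable {k l n : ℕ}

/-- Convex combinations of points of a standard simplex. -/
noncomputable def comb (t : Splx k) (w : Fin (k + 1) → Splx n) : Splx n :=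
  ⟨∑ i, t i • (w i).1, (convex_stdSimplex ℝ _).sum_mem (fun i _ => t.2.1 i) t.2.2
    fun i _ => (w i).2⟩

theorem comb_val (t : Splx k) (w : Fin (k + 1) → Splx n) : (comb t w).1 = ∑ i, t i • (w i).1 := rfl

theorem comb_apply (t : Splx k) (w : Fin (k + 1) → Splx n) (j : Fin (n + 1)) :
    comb t w j = ∑ i, t i * w i j := by
  change (∑ i, t i • (w i).1) j = _
  simp [Finset.sum_apply]
  rfl

end Splx

open Splx in
/-- A topological space with convex combinations of tuples of points. -/
class ConvexComb (T : Type*) [TopologicalSpace T] where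
  /-- The convex combination of the points `w i` with the coefficients `t i`. -/
  cc {k : ℕ} (t : Splx k) (w : Fin (k + 1) → T) : T
  cc_vert {k : ℕ} (i : Fin (k + 1)) (w : Fin (k + 1) → T) : cc (vert k i) w = w i
  continuous_cc {k : ℕ} (w : Fin (k + 1) → T) : Continuous fun t => cc t w
  cc_cc {k l : ℕ} (t : Splx k) (u : Fin (k + 1) → Splx l) (w : Fin (l + 1) → T) :
    cc t (fun i => cc (u i) w) = cc (comb t u) w

open ConvexComb

noncomputable instance (n : ℕ) : ConvexComb (Splx n) where
  cc := Splx.comb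
  cc_vert i w := by
    ext j
    simp [Splx.comb_apply, vert, Pi.single_apply]
  continuous_cc w := by
    refine Continuous.subtype_mk (continuous_finsetSum _ fun i _ => ?_) _
    exact ((continuous_apply i).comp continuous_subtype_val).smul continuous_const
  cc_cc t u w := by
    ext j
    simp only [Splx.comb_apply, Finset.mul_sum, Finset.sum_mul]
    rw [Finset.sum_comm]
    simp only [mul_assoc]

theorem Splx.cc_eq {k n : ℕ} (t : Splx k) (w : Fin (k + 1) → Splx n) : cc t w = Splx.comb t w := rfl

noncomputable instance : ConvexComb unitInterval where
  cc t w := ⟨∑ i, t i • (w i : ℝ), (convex_Icc (0 : ℝ) 1).sum_mem (fun i _ => t.2.1 i) t.2.2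
    fun i _ => (w i).2⟩
  cc_vert i w := by
    ext
    simp [vert, Pi.single_apply]
  continuous_cc w := by
    refine Continuous.subtype_mk (continuous_finsetSum _ fun i _ => ?_) _
    exact ((continuous_apply i).comp continuous_subtype_val).smul continuous_const
  cc_cc t u w := by
    ext
    simp only [Splx.comb_apply, Finset.mul_sum, Finset.sum_mul, smul_eq_mul]
    rw [Finset.sum_comm]
    simp only [mul_assoc]

noncomputable instance {A B : Type*} [TopologicalSpace A] [TopologicalSpace B] [ConvexComb A]
    [ConvexComb B] : ConvexComb (A × B) where
  cc t w := (cc t fun i => (w i).1, cc t fun i => (w i).2)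
  cc_vert i w := by simp [cc_vert]
  continuous_cc w := (continuous_cc _).prodMk (continuous_cc _)
  cc_cc t u w := by simp [cc_cc]

variable {T T' : Type*} [TopologicalSpace T] [ConvexComb T] [TopologicalSpace T'] [ConvexComb T']
  {k l m n : ℕ}

/-- The affine singular simplex with the given vertices. -/
noncomputable def real (w : Fin (m + 1) → T) : C(Splx m, T) := ⟨fun t => cc t w, continuous_cc w⟩

theorem real_apply (w : Fin (m + 1) → T) (t : Splx m) : real w t = cc t w := rfl

/-- A map is affine if it commutes with convex combinations. -/
def IsAff (f : T → T') : Prop :=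
  ∀ {k : ℕ} (t : Splx k) (w : Fin (k + 1) → T), f (cc t w) = cc t (f ∘ w)

theorem isAff_real (w : Fin (m + 1) → T) : IsAff (real w) := fun t u => (cc_cc t u w).symm

theorem isAff_id : IsAff (id : T → T) := fun _ _ => rfl

theorem IsAff.prodMap {A A' : Type*} [TopologicalSpace A] [TopologicalSpace A'] [ConvexComb A]
    [ConvexComb A'] {f : T → T'} (hf : IsAff f) {g : A → A'} (hg : IsAff g) :
    IsAff (Prod.map f g) := fun t w => by
  ext1
  · exact hf t _
  · exact hg t _

@[simp] theorem real_vert (w : Fin (m + 1) → T) (i : Fin (m + 1)) : real w (vert m i) = w i :=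
  cc_vert i w

@[simp] theorem real_comp_vert (w : Fin (m + 1) → T) : real w ∘ vert m = w := funext (real_vert w)

theorem IsAff.real_comp {f : T → T'} (hf : IsAff f) (w : Fin (m + 1) → T) (t : Splx m) :
    real (f ∘ w) t = f (real w t) := (hf t w).symm

theorem comb_vert (t : Splx m) : Splx.comb t (vert m) = t := by
  ext j
  simp [Splx.comb_apply, vert, Pi.single_apply]

theorem map_eq_real (f : Fin (k + 1) → Fin (n + 1)) (t : Splx k) :
    stdSimplex.map f t = real (vert n ∘ f) t := by
  ext j
  rw [real_apply, Splx.cc_eq, Splx.comb_apply]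
  simp [FunOnFinite.linearMap_apply_apply, vert, Pi.single_apply, Finset.sum_filter, eq_comm]

theorem real_vert_self : real (vert n) = ContinuousMap.id (Splx n) := by
  ext1 t
  exact comb_vert t

/-- The inclusion of the `i`-th face of the standard simplex. -/
noncomputable def face (i : Fin (n + 2)) : C(Splx n, Splx (n + 1)) := real (vert (n + 1) ∘ i.succAbove)

theorem real_comp_face (w : Fin (n + 2) → T) (i : Fin (n + 2)) :
    (real w).comp (face i) = real (w ∘ i.succAbove) := by
  ext1 t
  rw [ContinuousMap.comp_apply, face, ← IsAff.real_comp (isAff_real w), ← Function.comp_assoc,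
    real_comp_vert]

/-- The barycentre of a tuple of points. -/
noncomputable def bary (w : Fin (m + 1) → T) : T := cc (stdSimplex.barycenter : Splx m) w

theorem IsAff.bary {f : T → T'} (hf : IsAff f) (w : Fin (m + 1) → T) :
    f (bary w) = Bredon.bary (f ∘ w) := hf _ w

namespace OrdChain

/-- Barycentric subdivision of ordered chains. -/
noncomputable def sd : ∀ m, OrdChain T m →ₗ[ℤ] OrdChain T m
  | 0 => LinearMap.id
  | m + 1 => Finsupp.linearCombination ℤ fun v => cone (bary v) (sd m (d (of v)))

theorem sd_succ_of (v : Fin (m + 2) → T) :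
    sd (m + 1) (of v) = cone (bary v) (sd m (d (of v))) := by
  simp [sd, of]

@[simp] theorem sd_zero (c : OrdChain T 0) : sd 0 c = c := rfl

theorem d_sd (m : ℕ) (c : OrdChain T (m + 1)) : d (sd (m + 1) c) = sd m (d c) := by
  induction m with
  | zero =>
    have : d ∘ₗ sd 1 = sd 0 ∘ₗ d (T := T) := hom_ext fun v => by
      rw [LinearMap.comp_apply, LinearMap.comp_apply, sd_succ_of, d_cone_zero, d_of]
      simp [Fin.sum_univ_two]
    exact LinearMap.congr_fun this c
  | succ m ih =>
    have : d ∘ₗ sd (m + 2) = sd (m + 1) ∘ₗ d (T := T) := hom_ext fun v => by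
      rw [LinearMap.comp_apply, LinearMap.comp_apply, sd_succ_of, d_cone, ih, d_d]
      simp
    exact LinearMap.congr_fun this c

theorem map_sd {f : T → T'} (hf : IsAff f) (c : OrdChain T m) :
    map f (sd m c) = sd m (map f c) := by
  induction m with
  | zero => rfl
  | succ m ih =>
    have : map f ∘ₗ sd (m + 1) = sd (m + 1) ∘ₗ map f := hom_ext fun v => by
      rw [LinearMap.comp_apply, LinearMap.comp_apply, map_of, sd_succ_of, map_cone, ih,
        sd_succ_of, ← d_map, hf.bary, map_of]
    exact LinearMap.congr_fun this c

/-- The chain homotopy from barycentric subdivision to the identity. -/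
noncomputable def sdHtpy (m : ℕ) : OrdChain T m →ₗ[ℤ] OrdChain T (m + 1) :=
  htpy (fun _ => LinearMap.id) sd (fun _ v => bary v) m

theorem d_sdHtpy_zero (c : OrdChain T 0) : d (sdHtpy 0 c) = 0 := by
  exact (d_htpy_zero (fun _ => LinearMap.id) sd _ (fun _ => rfl) c).trans (sub_self c)

theorem d_sdHtpy_succ (c : OrdChain T (m + 1)) :
    d (sdHtpy (m + 1) c) = c - sd (m + 1) c - sdHtpy m (d c) :=
  d_htpy_succ (fun _ => LinearMap.id) sd _ (fun _ _ => rfl) d_sd (fun _ => rfl) c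

theorem map_sdHtpy {f : T → T'} (hf : IsAff f) (c : OrdChain T m) :
    map f (sdHtpy m c) = sdHtpy m (map f c) :=
  map_htpy f f (fun _ _ => rfl) (fun _ c => map_sd hf c) (fun _ v => hf.bary v) c

/-- The prism operator: the chain homotopy from the bottom to the top of the cylinder. -/
noncomputable def prism (m : ℕ) : OrdChain T m →ₗ[ℤ] OrdChain (T × unitInterval) (m + 1) :=
  htpy (fun _ => map fun x => (x, 1)) (fun _ => map fun x => (x, 0)) (fun _ v => (bary v, 0)) m

theorem d_prism_zero (c : OrdChain T 0) :
    d (prism 0 c) = map (fun x => (x, 1)) c - map (fun x => (x, 0)) c := by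
  refine d_htpy_zero _ _ _ (fun c => LinearMap.congr_fun
    (f := aug ∘ₗ map fun x : T => (x, (1 : unitInterval)))
    (g := aug ∘ₗ map fun x : T => (x, (0 : unitInterval))) (hom_ext fun v => ?_) c) c
  simp

theorem d_prism_succ (c : OrdChain T (m + 1)) :
    d (prism (m + 1) c) = map (fun x => (x, 1)) c - map (fun x => (x, 0)) c - prism m (d c) := by
  refine d_htpy_succ _ _ _ (fun _ _ => d_map _ _) (fun _ _ => d_map _ _)
    (fun c => LinearMap.congr_fun
    (f := aug ∘ₗ map fun x : T => (x, (1 : unitInterval)))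
    (g := aug ∘ₗ map fun x : T => (x, (0 : unitInterval))) (hom_ext fun v => ?_) c) c
  simp

theorem map_map {A B C : Type*} (f : A → B) (g : B → C) (c : OrdChain A m) :
    map g (map f c) = map (g ∘ f) c :=
  LinearMap.congr_fun (f := map g ∘ₗ map f) (hom_ext fun v => by simp [Function.comp_assoc]) c

theorem map_prism {f : T → T'} (hf : IsAff f) (c : OrdChain T m) :
    map (Prod.map f id) (prism m c) = prism m (map f c) :=
  map_htpy f (Prod.map f id) (fun _ c => by rw [map_map, map_map]; rfl)
    (fun _ c => by rw [map_map, map_map]; rfl) (fun _ v => by rw [← hf.bary]; rfl) c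

end OrdChain

end ConvexComb

/-! ### Barycentric subdivision makes simplices small -/

section Small

open OrdChain ConvexComb

variable {m n k : ℕ}

theorem dist_cc_le (t : Splx k) (w : Fin (k + 1) → Splx n) (x : Splx n) {D : ℝ}
    (h : ∀ i, dist (w i) x ≤ D) : dist (cc t w) x ≤ D := by
  rw [Subtype.dist_eq, dist_eq_norm, Splx.cc_eq, Splx.comb_val]
  have : ∑ i, t i • (w i).1 - x.1 = ∑ i, t i • ((w i).1 - x.1) := by
    simp only [smul_sub, Finset.sum_sub_distrib, ← Finset.sum_smul, stdSimplex.sum_eq_one, one_smul]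
  rw [this]
  refine (norm_sum_le _ _).trans ?_
  calc ∑ i, ‖t i • ((w i).1 - x.1)‖ ≤ ∑ i, t i * D := Finset.sum_le_sum fun i _ => by
        rw [norm_smul, Real.norm_of_nonneg (stdSimplex.zero_le t i), ← dist_eq_norm]
        exact mul_le_mul_of_nonneg_left (h i) (stdSimplex.zero_le t i)
    _ = D := by rw [← Finset.sum_mul, stdSimplex.sum_eq_one, one_mul]

theorem dist_bary_le (w : Fin (m + 1) → Splx n) {D : ℝ} (h : ∀ i j, dist (w i) (w j) ≤ D)
    (j : Fin (m + 1)) : dist (bary w) (w j) ≤ m / (m + 1) * D := by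
  have hm : (0 : ℝ) < m + 1 := by positivity
  rw [Subtype.dist_eq, dist_eq_norm, bary, Splx.cc_eq, Splx.comb_val]
  set t : Splx m := stdSimplex.barycenter
  have ht : ∀ i, t i = ((m : ℝ) + 1)⁻¹ := fun i => by
    change (Fintype.card (Fin (m + 1)) : ℝ)⁻¹ = _
    simp
  have : ∑ i, t i • (w i).1 - (w j).1 = ∑ i, t i • ((w i).1 - (w j).1) := by
    simp only [smul_sub, Finset.sum_sub_distrib, ← Finset.sum_smul, stdSimplex.sum_eq_one, one_smul]
  rw [this, Fin.sum_univ_succAbove _ j, sub_self, smul_zero, zero_add]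
  refine (norm_sum_le _ _).trans ?_
  calc ∑ i, ‖t (j.succAbove i) • ((w (j.succAbove i)).1 - (w j).1)‖
      ≤ ∑ i : Fin m, ((m : ℝ) + 1)⁻¹ * D := Finset.sum_le_sum fun i _ => by
        rw [norm_smul, Real.norm_of_nonneg (stdSimplex.zero_le t _), ← dist_eq_norm, ht]
        exact mul_le_mul_of_nonneg_left (h _ _) (by positivity)
    _ = m / (m + 1) * D := by
        rw [Finset.sum_const, Finset.card_univ, Fintype.card_fin, nsmul_eq_mul]
        ring

theorem supported_induction {α M : Type*} [AddCommGroup M] {s : Set α} {N : Submodule ℤ M}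
    (f : (α →₀ ℤ) →ₗ[ℤ] M) (h : ∀ x ∈ s, f (Finsupp.single x 1) ∈ N) {c : α →₀ ℤ}
    (hc : c ∈ Finsupp.supported ℤ ℤ s) : f c ∈ N := by
  rw [Finsupp.supported_eq_span_single] at hc
  have : Submodule.span ℤ ((fun i => Finsupp.single i (1 : ℤ)) '' s) ≤ N.comap f :=
    Submodule.span_le.2 (by rintro _ ⟨x, hx, rfl⟩; exact h x hx)
  exact this hc

/-- The simplices of the barycentric subdivision of an affine `m`-simplex have diameter at most
`m / (m + 1)` times that of the simplex. The vertices are recorded to be in the convex hull,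
which the induction over the faces needs. -/
theorem sd_mem_supported (v : Fin (m + 1) → Splx n) {D : ℝ} (h : ∀ i j, dist (v i) (v j) ≤ D) :
    sd m (of v) ∈ Finsupp.supported ℤ ℤ {w : Fin (m + 1) → Splx n |
      (∀ i j, dist (w i) (w j) ≤ m / (m + 1) * D) ∧ ∀ i, ∃ t : Splx m, w i = cc t v} := by
  have hD : 0 ≤ D := dist_nonneg.trans (h 0 0)
  induction m with
  | zero =>
    refine Finsupp.single_mem_supported ℤ _ ⟨fun i j => ?_, fun i => ⟨vert 0 i, (cc_vert i v).symm⟩⟩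
    rw [Subsingleton.elim (α := Fin 1) i j, dist_self]
    simp
  | succ m ih =>
    -- a simplex of the subdivision is a cone, with the barycentre as apex, over a simplex of the
    -- subdivision of a face
    rw [sd_succ_of, d_of, map_sum, map_sum]
    refine Submodule.sum_mem _ fun i _ => ?_
    rw [map_zsmul, map_zsmul]
    refine Submodule.smul_mem _ _ (supported_induction (cone (bary v)) (fun w hw => ?_)
      (ih (v ∘ i.succAbove) fun _ _ => h _ _))
    obtain ⟨hw1, hw2⟩ := hw
    change cone (bary v) (of w) ∈ _
    rw [cone_of]
    have hb : ∀ j, dist (w j) (bary v) ≤ (m + 1 : ℕ) / ((m + 1 : ℕ) + 1) * D := fun j => by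
      obtain ⟨t, ht⟩ := hw2 j
      rw [ht]
      exact dist_cc_le _ _ _ fun l => by rw [dist_comm]; exact dist_bary_le v h _
    have hle : (m : ℝ) / (m + 1) * D ≤ (m + 1 : ℕ) / ((m + 1 : ℕ) + 1) * D := by
      refine mul_le_mul_of_nonneg_right ?_ hD
      push_cast
      rw [div_le_div_iff₀ (by positivity) (by positivity)]
      nlinarith
    refine Finsupp.single_mem_supported ℤ _ ⟨fun j l => ?_, fun j => ?_⟩
    · refine Fin.cases ?_ (fun j => ?_) j <;> refine Fin.cases ?_ (fun l => ?_) l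
      · simp only [Fin.cons_zero, dist_self]
        positivity
      · simp only [Fin.cons_zero, Fin.cons_succ]
        rw [dist_comm]
        exact hb l
      · exact hb j
      · exact (hw1 j l).trans hle
    · refine Fin.cases ⟨_, rfl⟩ (fun j => ?_) j
      obtain ⟨t, ht⟩ := hw2 j
      refine ⟨face i t, ?_⟩
      rw [Fin.cons_succ, ht, ← real_apply, ← real_comp_face]
      rfl

theorem sd_pow_mem_supported (v : Fin (m + 1) → Splx n) {D : ℝ} (h : ∀ i j, dist (v i) (v j) ≤ D)
    (N : ℕ) : ((sd m) ^ N) (of v) ∈ Finsupp.supported ℤ ℤ {w : Fin (m + 1) → Splx n |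
      ∀ i j, dist (w i) (w j) ≤ (m / (m + 1)) ^ N * D} := by
  induction N with
  | zero => exact Finsupp.single_mem_supported ℤ _ (by simpa using h)
  | succ N ih =>
    rw [pow_succ' (sd m), Module.End.mul_apply]
    refine supported_induction (sd m) (fun w hw => ?_) ih
    refine Finsupp.supported_mono (fun w' hw' i j => ?_) (sd_mem_supported w hw)
    refine (hw'.1 i j).trans (le_of_eq ?_)
    rw [pow_succ']
    ring

/-- For an open cover of the standard simplex by two sets, all simplices of a sufficiently fine
iterated barycentric subdivision are contained in one of the two sets. -/
theorem exists_sd_pow_mem_supported {O₁ O₂ : Set (Splx n)} (h₁ : IsOpen O₁) (h₂ : IsOpen O₂)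
    (hO : O₁ ∪ O₂ = Set.univ) : ∃ N : ℕ, ∀ j ≥ N, ((sd n) ^ j) (of (vert n)) ∈
      Finsupp.supported ℤ ℤ {w : Fin (n + 1) → Splx n |
        Set.range (real w) ⊆ O₁ ∨ Set.range (real w) ⊆ O₂} := by
  obtain ⟨δ, hδ, H⟩ := lebesgue_number_lemma_of_metric (s := (Set.univ : Set (Splx n)))
    (c := fun b : Bool => cond b O₁ O₂) isCompact_univ
    (by rintro (_ | _) <;> assumption) (by
      rw [← hO, Set.union_eq_iUnion])
  obtain ⟨D, hD⟩ : ∃ D, ∀ i j, dist (vert n i) (vert n j) ≤ D :=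
    ⟨∑ i, ∑ j, dist (vert n i) (vert n j), fun i j =>
      (Finset.single_le_sum (f := fun j => dist (vert n i) (vert n j))
        (fun _ _ => dist_nonneg) (Finset.mem_univ j)).trans
      (Finset.single_le_sum (f := fun i => ∑ j, dist (vert n i) (vert n j))
        (fun _ _ => Finset.sum_nonneg fun _ _ => dist_nonneg) (Finset.mem_univ i))⟩
  have hlim : Filter.Tendsto (fun N : ℕ => ((n : ℝ) / (n + 1)) ^ N * D) Filter.atTop (nhds 0) := by
    rw [← zero_mul D]
    refine (tendsto_pow_atTop_nhds_zero_of_lt_one (by positivity) ?_).mul_const D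
    rw [div_lt_one (by positivity)]
    linarith
  obtain ⟨N, hN⟩ := Filter.eventually_atTop.1 (hlim.eventually (gt_mem_nhds hδ))
  refine ⟨N, fun j hj => Finsupp.supported_mono (fun w hw => ?_) (sd_pow_mem_supported _ hD j)⟩
  obtain ⟨b, hb⟩ := H (w 0) (Set.mem_univ _)
  have : Set.range (real w) ⊆ Metric.ball (w 0) δ := by
    rintro _ ⟨t, rfl⟩
    exact (dist_cc_le t w (w 0) fun i => hw i 0).trans_lt (hN j hj)
  cases b
  · exact Or.inr (this.trans hb)
  · exact Or.inl (this.trans hb)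

end Small

/-! ### Chains on presheaves on the topological simplices -/

/-- A presheaf of sets on the category of the standard simplices and all continuous maps between
them. The examples are the singular simplices of a space and the orbits of singular simplices
of a space with a group action. -/
structure SplxSet where
  /-- The set of `n`-simplices. -/
  S : ℕ → Type u
  /-- The action of the continuous maps between standard simplices. -/
  act {m n : ℕ} : C(Splx m, Splx n) → S n → S m
  act_id {n : ℕ} (q : S n) : act (ContinuousMap.id _) q = q
  act_comp {k m n : ℕ} (α : C(Splx k, Splx m)) (β : C(Splx m, Splx n)) (q : S n) :
    act (β.comp α) q = act α (act β q)

namespace SplxSet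

open OrdChain

variable (Q : SplxSet.{u}) {m n k : ℕ}

/-- The `n`-chains. -/
abbrev Ch (n : ℕ) := Q.S n →₀ ℤ

variable {Q} in
/-- The generator given by a simplex. -/
noncomputable def of (q : Q.S n) : Q.Ch n := Finsupp.single q 1

variable {Q} in
theorem hom_ext {M : Type*} [AddCommGroup M] {f g : Q.Ch n →ₗ[ℤ] M}
    (h : ∀ q, f (of q) = g (of q)) : f = g :=
  Finsupp.lhom_ext' fun v => LinearMap.ext_ring (h v)

/-- The differential: the alternating sum of the faces. -/
noncomputable def d : Q.Ch (n + 1) →ₗ[ℤ] Q.Ch n :=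
  ∑ i : Fin (n + 2), (-1 : ℤ) ^ (i : ℕ) • Finsupp.lmapDomain ℤ ℤ (Q.act (face i))

theorem d_of (q : Q.S (n + 1)) :
    Q.d (of q) = ∑ i : Fin (n + 2), (-1 : ℤ) ^ (i : ℕ) • of (Q.act (face i) q) := by
  simp [d, of]

variable {Q} in
/-- The chain `∑ cᵢ • q ∘ |wᵢ|` for an ordered chain `c = ∑ cᵢ wᵢ` in the simplex that
parametrizes `q`. -/
noncomputable def ev (q : Q.S n) : OrdChain (Splx n) m →ₗ[ℤ] Q.Ch m :=
  Finsupp.lmapDomain ℤ ℤ fun w => Q.act (real w) q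

@[simp] theorem ev_of (q : Q.S n) (w : Fin (m + 1) → Splx n) :
    ev q (OrdChain.of w) = of (Q.act (real w) q) := by
  simp [ev, of, OrdChain.of]

theorem ev_vert (q : Q.S n) : ev q (OrdChain.of (vert n)) = of q := by
  rw [ev_of, real_vert_self, Q.act_id]

theorem d_ev (q : Q.S n) (c : OrdChain (Splx n) (m + 1)) : Q.d (ev q c) = ev q (OrdChain.d c) := by
  have : Q.d ∘ₗ ev q = ev q ∘ₗ OrdChain.d (m := m) := OrdChain.hom_ext fun w => by
    simp only [LinearMap.comp_apply, ev_of, d_of, OrdChain.d_of, map_sum, map_zsmul]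
    refine Finset.sum_congr rfl fun i _ => ?_
    rw [← Q.act_comp, real_comp_face]
  exact LinearMap.congr_fun this c

theorem ev_act (q : Q.S n) (w : Fin (k + 1) → Splx n) (c : OrdChain (Splx k) m) :
    ev (Q.act (real w) q) c = ev q (OrdChain.map (real w) c) := by
  have : ev (Q.act (real w) q) = ev q ∘ₗ OrdChain.map (m := m) (real w) := OrdChain.hom_ext fun v => by
    rw [LinearMap.comp_apply, OrdChain.map_of, ev_of, ev_of, ← Q.act_comp]
    congr 2
    ext1 t
    exact (IsAff.real_comp (isAff_real w) v t).symm
  exact LinearMap.congr_fun this c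

theorem d_d (c : Q.Ch (n + 2)) : Q.d (Q.d c) = 0 := by
  have : Q.d ∘ₗ Q.d (n := n + 1) = 0 := hom_ext fun q => by
    rw [LinearMap.comp_apply, ← ev_vert, d_ev, d_ev, OrdChain.d_d, map_zero, LinearMap.zero_apply]
  exact LinearMap.congr_fun this c

/-- Barycentric subdivision. -/
noncomputable def sd (n : ℕ) : Q.Ch n →ₗ[ℤ] Q.Ch n :=
  Finsupp.linearCombination ℤ fun q => ev q (OrdChain.sd n (OrdChain.of (vert n)))

/-- The chain homotopy from barycentric subdivision to the identity. -/
noncomputable def sdHtpy (n : ℕ) : Q.Ch n →ₗ[ℤ] Q.Ch (n + 1) :=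
  Finsupp.linearCombination ℤ fun q => ev q (OrdChain.sdHtpy n (OrdChain.of (vert n)))

theorem sd_of (q : Q.S n) : Q.sd n (of q) = ev q (OrdChain.sd n (OrdChain.of (vert n))) := by
  simp [sd, of]

theorem sdHtpy_of (q : Q.S n) :
    Q.sdHtpy n (of q) = ev q (OrdChain.sdHtpy n (OrdChain.of (vert n))) := by
  simp [sdHtpy, of]

theorem sd_ev (q : Q.S n) (c : OrdChain (Splx n) m) : Q.sd m (ev q c) = ev q (OrdChain.sd m c) := by
  have : Q.sd m ∘ₗ ev q = ev q ∘ₗ OrdChain.sd m := OrdChain.hom_ext fun w => by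
    rw [LinearMap.comp_apply, LinearMap.comp_apply, ev_of, sd_of, ev_act,
      map_sd (isAff_real w), OrdChain.map_of, real_comp_vert]
  exact LinearMap.congr_fun this c

theorem sdHtpy_ev (q : Q.S n) (c : OrdChain (Splx n) m) :
    Q.sdHtpy m (ev q c) = ev q (OrdChain.sdHtpy m c) := by
  have : Q.sdHtpy m ∘ₗ ev q = ev q ∘ₗ OrdChain.sdHtpy m := OrdChain.hom_ext fun w => by
    rw [LinearMap.comp_apply, LinearMap.comp_apply, ev_of, sdHtpy_of, ev_act,
      map_sdHtpy (isAff_real w), OrdChain.map_of, real_comp_vert]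
  exact LinearMap.congr_fun this c

theorem d_sd (c : Q.Ch (n + 1)) : Q.d (Q.sd (n + 1) c) = Q.sd n (Q.d c) := by
  have : Q.d ∘ₗ Q.sd (n + 1) = Q.sd n ∘ₗ Q.d := hom_ext fun q => by
    rw [LinearMap.comp_apply, LinearMap.comp_apply, ← ev_vert, sd_ev, d_ev, d_ev, sd_ev,
      OrdChain.d_sd]
  exact LinearMap.congr_fun this c

/-- The cycles in degree `n`; all `0`-chains are cycles. -/
def IsCycle : ∀ {n : ℕ}, Q.Ch n → Prop
  | 0, _ => True
  | _ + 1, c => Q.d c = 0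

theorem IsCycle.of_d (c : Q.Ch (n + 1)) : Q.IsCycle (Q.d c) := by
  cases n with
  | zero => trivial
  | succ n => exact Q.d_d c

theorem d_sdHtpy (c : Q.Ch (n + 1)) :
    Q.d (Q.sdHtpy (n + 1) c) = c - Q.sd (n + 1) c - Q.sdHtpy n (Q.d c) := by
  have : Q.d ∘ₗ Q.sdHtpy (n + 1) = LinearMap.id - Q.sd (n + 1) - Q.sdHtpy n ∘ₗ Q.d :=
      hom_ext fun q => by
    simp only [LinearMap.comp_apply, LinearMap.sub_apply, LinearMap.id_apply]
    rw [← ev_vert, sdHtpy_ev, d_ev, d_sdHtpy_succ, sd_ev, d_ev, sdHtpy_ev, map_sub, map_sub]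
  exact LinearMap.congr_fun this c

variable {Q} in
theorem IsCycle.d_sdHtpy {c : Q.Ch n} (hc : Q.IsCycle c) :
    Q.d (Q.sdHtpy n c) = c - Q.sd n c := by
  cases n with
  | zero =>
    have : Q.d ∘ₗ Q.sdHtpy 0 = LinearMap.id - Q.sd 0 := hom_ext fun q => by
      simp only [LinearMap.comp_apply, LinearMap.sub_apply, LinearMap.id_apply]
      rw [← ev_vert, sdHtpy_ev, d_ev, d_sdHtpy_zero, sd_ev, map_zero, sd_zero, sub_self]
    exact LinearMap.congr_fun this c
  | succ n =>
    have h : Q.d c = 0 := hc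
    rw [SplxSet.d_sdHtpy, h, map_zero, sub_zero]

variable {Q} in
theorem IsCycle.sd {c : Q.Ch n} (hc : Q.IsCycle c) : Q.IsCycle (Q.sd n c) := by
  cases n with
  | zero => trivial
  | succ n =>
    have h : Q.d c = 0 := hc
    change Q.d _ = 0
    rw [d_sd, h, map_zero]

/-- A subpresheaf. -/
structure Sub where
  /-- The `n`-simplices of the subpresheaf. -/
  carrier (n : ℕ) : Set (Q.S n)
  act_mem {m n : ℕ} (α : C(Splx m, Splx n)) {q : Q.S n} : q ∈ carrier n → Q.act α q ∈ carrier m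

variable {Q}

namespace Sub

/-- The chains of a subpresheaf. -/
def ch (A : Q.Sub) (n : ℕ) : Submodule ℤ (Q.Ch n) := Finsupp.supported ℤ ℤ (A.carrier n)

variable (A : Q.Sub)

theorem of_mem {q : Q.S n} (hq : q ∈ A.carrier n) : of q ∈ A.ch n :=
  Finsupp.single_mem_supported ℤ _ hq

theorem ev_mem {q : Q.S n} (hq : q ∈ A.carrier n) (c : OrdChain (Splx n) m) : ev q c ∈ A.ch m := by
  refine supported_induction (s := Set.univ) (ev q) (fun w _ => ?_) (by simp)
  change ev q (OrdChain.of w) ∈ _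
  rw [ev_of]
  exact A.of_mem (A.act_mem _ hq)

theorem d_mem {c : Q.Ch (n + 1)} (hc : c ∈ A.ch (n + 1)) : Q.d c ∈ A.ch n :=
  supported_induction Q.d (fun q hq => by
    change Q.d (of q) ∈ _
    rw [← ev_vert, d_ev]
    exact A.ev_mem hq _) hc

theorem sd_mem {c : Q.Ch n} (hc : c ∈ A.ch n) : Q.sd n c ∈ A.ch n :=
  supported_induction (Q.sd n) (fun q hq => by
    change Q.sd n (of q) ∈ _
    rw [sd_of]
    exact A.ev_mem hq _) hc

theorem sdHtpy_mem {c : Q.Ch n} (hc : c ∈ A.ch n) : Q.sdHtpy n c ∈ A.ch (n + 1) :=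
  supported_induction (Q.sdHtpy n) (fun q hq => by
    change Q.sdHtpy n (of q) ∈ _
    rw [sdHtpy_of]
    exact A.ev_mem hq _) hc

/-- The intersection of two subpresheaves. -/
def inter (A B : Q.Sub) : Q.Sub where
  carrier n := A.carrier n ∩ B.carrier n
  act_mem α _ h := ⟨A.act_mem α h.1, B.act_mem α h.2⟩

theorem mem_inter_ch {A B : Q.Sub} {c : Q.Ch n} : c ∈ (A.inter B).ch n ↔ c ∈ A.ch n ∧ c ∈ B.ch n := by
  rw [ch, ch, ch, inter, Finsupp.supported_inter, Submodule.mem_inf]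

end Sub

variable (Q) in
theorem sd_pow_of (q : Q.S n) (j : ℕ) :
    ((Q.sd n) ^ j) (of q) = ev q (((OrdChain.sd n) ^ j) (OrdChain.of (vert n))) := by
  induction j with
  | zero => exact (ev_vert Q q).symm
  | succ j ih => rw [pow_succ', pow_succ', Module.End.mul_apply, Module.End.mul_apply, ih, sd_ev]

/-- A morphism of presheaves. -/
structure Hom (Q Q' : SplxSet.{u}) where
  /-- The map on `n`-simplices. -/
  app {n : ℕ} : Q.S n → Q'.S n
  app_act {m n : ℕ} (α : C(Splx m, Splx n)) (q : Q.S n) : app (Q.act α q) = Q'.act α (app q)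

namespace Hom

variable {Q' : SplxSet.{u}} (p : Hom Q Q')

/-- The induced map on chains. -/
noncomputable def ch (n : ℕ) : Q.Ch n →ₗ[ℤ] Q'.Ch n := Finsupp.lmapDomain ℤ ℤ p.app

@[simp] theorem ch_of (q : Q.S n) : p.ch n (of q) = of (p.app q) := by simp [ch, of]

theorem ch_ev (q : Q.S n) (c : OrdChain (Splx n) m) : p.ch m (ev q c) = ev (p.app q) c := by
  have : p.ch m ∘ₗ ev q = ev (p.app q) := OrdChain.hom_ext fun w => by
    rw [LinearMap.comp_apply, ev_of, ev_of, ch_of, app_act]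
  exact LinearMap.congr_fun this c

theorem ch_d (c : Q.Ch (n + 1)) : p.ch n (Q.d c) = Q'.d (p.ch (n + 1) c) := by
  have : p.ch n ∘ₗ Q.d = Q'.d ∘ₗ p.ch (n + 1) := hom_ext fun q => by
    rw [LinearMap.comp_apply, LinearMap.comp_apply, ← ev_vert, d_ev, ch_ev, ch_ev, d_ev]
  exact LinearMap.congr_fun this c

theorem ch_sd (c : Q.Ch n) : p.ch n (Q.sd n c) = Q'.sd n (p.ch n c) := by
  have : p.ch n ∘ₗ Q.sd n = Q'.sd n ∘ₗ p.ch n := hom_ext fun q => by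
    rw [LinearMap.comp_apply, LinearMap.comp_apply, sd_of, ch_of, sd_of, ch_ev]
  exact LinearMap.congr_fun this c

theorem ch_sdHtpy (c : Q.Ch n) : p.ch (n + 1) (Q.sdHtpy n c) = Q'.sdHtpy n (p.ch n c) := by
  have : p.ch (n + 1) ∘ₗ Q.sdHtpy n = Q'.sdHtpy n ∘ₗ p.ch n := hom_ext fun q => by
    rw [LinearMap.comp_apply, LinearMap.comp_apply, sdHtpy_of, ch_of, sdHtpy_of, ch_ev]
  exact LinearMap.congr_fun this c

/-- A cycle of the mapping cone of `p`, with components in `A` and `A'`. -/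
structure ConeCycle (A : Q.Sub) (A' : Q'.Sub) (a : Q.Ch n) (b : Q'.Ch (n + 1)) : Prop where
  fst_mem : a ∈ A.ch n
  snd_mem : b ∈ A'.ch (n + 1)
  isCycle : Q.IsCycle a
  map_eq : p.ch n a = Q'.d b

/-- The pair `(a, b)` is a boundary in the mapping cone of `p`, restricted to `A` and `A'`. -/
def ConeBoundary (A : Q.Sub) (A' : Q'.Sub) (a : Q.Ch n) (b : Q'.Ch (n + 1)) : Prop :=
  ∃ a' ∈ A.ch (n + 1), ∃ b' ∈ A'.ch (n + 2), Q.d a' = a ∧ Q'.d b' = b - p.ch (n + 1) a'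

/-- The mapping cone of the restriction `A → A'` of `p` on chains is acyclic, so that this
restriction is a quasi-isomorphism. (The degree `0` part, surjectivity on `0`-chains up to
boundaries, is not included.) -/
def Acyclic (A : Q.Sub) (A' : Q'.Sub) : Prop :=
  ∀ ⦃n : ℕ⦄ (a : Q.Ch n) (b : Q'.Ch (n + 1)), p.ConeCycle A A' a b → p.ConeBoundary A A' a b

variable {p} {A A₁ A₂ : Q.Sub} {A' A₁' A₂' : Q'.Sub}

theorem ConeCycle.sd {a : Q.Ch n} {b : Q'.Ch (n + 1)} (h : p.ConeCycle A A' a b) :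
    p.ConeCycle A A' (Q.sd n a) (Q'.sd (n + 1) b) :=
  ⟨A.sd_mem h.fst_mem, A'.sd_mem h.snd_mem, h.isCycle.sd, by rw [ch_sd, h.map_eq, d_sd]⟩

/-- A cycle of the mapping cone is homologous to its subdivision. -/
theorem ConeCycle.boundary_of_sd {a : Q.Ch n} {b : Q'.Ch (n + 1)} (h : p.ConeCycle A A' a b)
    (hsd : p.ConeBoundary A A' (Q.sd n a) (Q'.sd (n + 1) b)) : p.ConeBoundary A A' a b := by
  obtain ⟨a', ha', b', hb', h1, h2⟩ := hsd
  refine ⟨a' + Q.sdHtpy n a, add_mem ha' (A.sdHtpy_mem h.fst_mem), b' + Q'.sdHtpy (n + 1) b,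
    add_mem hb' (A'.sdHtpy_mem h.snd_mem), ?_, ?_⟩
  · rw [map_add, h1, h.isCycle.d_sdHtpy]
    abel
  · rw [map_add, h2, SplxSet.d_sdHtpy, ← h.map_eq, ← ch_sdHtpy, map_add]
    abel

theorem ConeCycle.boundary_of_sd_pow {a : Q.Ch n} {b : Q'.Ch (n + 1)} (h : p.ConeCycle A A' a b)
    (j : ℕ) (hsd : p.ConeCycle A A' (((Q.sd n) ^ j) a) (((Q'.sd (n + 1)) ^ j) b) →
      p.ConeBoundary A A' (((Q.sd n) ^ j) a) (((Q'.sd (n + 1)) ^ j) b)) :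
    p.ConeBoundary A A' a b := by
  induction j generalizing a b with
  | zero => exact hsd h
  | succ j ih =>
    refine h.boundary_of_sd (ih h.sd ?_)
    simpa only [pow_succ, Module.End.mul_apply] using hsd

/-- Excision: if the simplices of `A` and `A'` become simplices of `A₁` or `A₂`, resp. of `A₁'` or
`A₂'`, after subdivision, then acyclicity for the two pieces and for their intersection implies
acyclicity for `A`. -/
theorem Acyclic.of_cover (hA₁ : ∀ n, A₁.carrier n ⊆ A.carrier n)
    (hA₂ : ∀ n, A₂.carrier n ⊆ A.carrier n) (hA₁' : ∀ n, A₁'.carrier n ⊆ A'.carrier n)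
    (hA₂' : ∀ n, A₂'.carrier n ⊆ A'.carrier n)
    (hsd : ∀ n, ∀ q ∈ A.carrier n, ∃ N, ∀ j ≥ N, ((Q.sd n) ^ j) (of q) ∈ A₁.ch n ⊔ A₂.ch n)
    (hsd' : ∀ n, ∀ q ∈ A'.carrier n, ∃ N, ∀ j ≥ N, ((Q'.sd n) ^ j) (of q) ∈ A₁'.ch n ⊔ A₂'.ch n)
    (hp₁ : ∀ n, ∀ q ∈ A₁.carrier n, p.app q ∈ A₁'.carrier n)
    (hp₂ : ∀ n, ∀ q ∈ A₂.carrier n, p.app q ∈ A₂'.carrier n)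
    (h0 : ∀ q' ∈ (A₁'.inter A₂').carrier 0, ∃ q ∈ (A₁.inter A₂).carrier 0, p.app q = q')
    (h₁ : p.Acyclic A₁ A₁') (h₂ : p.Acyclic A₂ A₂')
    (h₁₂ : p.Acyclic (A₁.inter A₂) (A₁'.inter A₂')) : p.Acyclic A A' := by
  have hsmall : ∀ {R : SplxSet.{u}} (B B₁ B₂ : R.Sub) (n : ℕ),
      (∀ q ∈ B.carrier n, ∃ N, ∀ j ≥ N, ((R.sd n) ^ j) (of q) ∈ B₁.ch n ⊔ B₂.ch n) →
      ∀ c ∈ B.ch n, ∃ N, ∀ j ≥ N, ((R.sd n) ^ j) c ∈ B₁.ch n ⊔ B₂.ch n := by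
    intro R B B₁ B₂ n h c hc
    rw [Sub.ch, Finsupp.supported_eq_span_single] at hc
    induction hc using Submodule.span_induction with
    | mem x hx =>
      obtain ⟨q, hq, rfl⟩ := hx
      exact h q hq
    | zero => exact ⟨0, fun j _ => by rw [map_zero]; exact zero_mem _⟩
    | add x y _ _ hx hy =>
      obtain ⟨N, hN⟩ := hx
      obtain ⟨M, hM⟩ := hy
      refine ⟨max N M, fun j hj => ?_⟩
      rw [map_add]
      exact add_mem (hN j (le_of_max_le_left hj)) (hM j (le_of_max_le_right hj))
    | smul r x _ hx =>
      obtain ⟨N, hN⟩ := hx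
      exact ⟨N, fun j hj => by rw [map_smul]; exact Submodule.smul_mem _ _ (hN j hj)⟩
  have hle : ∀ {R : SplxSet.{u}} {B B₁ : R.Sub}, (∀ n, B₁.carrier n ⊆ B.carrier n) → ∀ {n : ℕ},
      B₁.ch n ≤ B.ch n := fun h n => Finsupp.supported_mono (h n)
  have hpch : ∀ {B : Q.Sub} {B' : Q'.Sub}, (∀ n, ∀ q ∈ B.carrier n, p.app q ∈ B'.carrier n) →
      ∀ {n : ℕ} {c : Q.Ch n}, c ∈ B.ch n → p.ch n c ∈ B'.ch n := fun {B B'} h n c hc =>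
    supported_induction (p.ch n) (fun q hq => by
      change p.ch n (of q) ∈ _
      rw [ch_of]
      exact B'.of_mem (h n q hq)) hc
  intro n a b hab
  obtain ⟨N, hN⟩ := hsmall A A₁ A₂ n (hsd n) a hab.fst_mem
  obtain ⟨M, hM⟩ := hsmall A' A₁' A₂' (n + 1) (hsd' (n + 1)) b hab.snd_mem
  refine hab.boundary_of_sd_pow (max N M) fun hc => ?_
  obtain ⟨a₁, ha₁, a₂, ha₂, ha⟩ := Submodule.mem_sup.1 (hN (max N M) (le_max_left _ _))
  obtain ⟨b₁, hb₁, b₂, hb₂, hb⟩ := Submodule.mem_sup.1 (hM (max N M) (le_max_right _ _))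
  rw [← ha, ← hb] at hc ⊢
  -- The boundary of the part in `A₁` is a cycle in the intersection, and it is filled there.
  have hw : Q'.d b₁ - p.ch n a₁ ∈ (A₁'.inter A₂').ch n := by
    refine Sub.mem_inter_ch.2 ⟨sub_mem (A₁'.d_mem hb₁) (hpch hp₁ ha₁), ?_⟩
    have : Q'.d b₁ - p.ch n a₁ = p.ch n a₂ - Q'.d b₂ := by
      have := hc.map_eq
      rw [map_add, map_add] at this
      rw [sub_eq_sub_iff_add_eq_add, ← this, add_comm]
    rw [this]
    exact sub_mem (hpch hp₂ ha₂) (A₂'.d_mem hb₂)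
  obtain ⟨a', ha', b', hb', hcyc, hbd⟩ : ∃ a' ∈ (A₁.inter A₂).ch n,
      ∃ b' ∈ (A₁'.inter A₂').ch (n + 1), Q.IsCycle (a₁ - a') ∧
        p.ch n (a₁ - a') = Q'.d (b₁ + b') := by
    cases n with
    | zero =>
      have hsurj : ∀ c ∈ (A₁'.inter A₂').ch 0, ∃ c' ∈ (A₁.inter A₂).ch 0, p.ch 0 c' = c := by
        intro c hc'
        have : (A₁'.inter A₂').ch 0 ≤ ((A₁.inter A₂).ch 0).map (p.ch 0) := by
          rw [Sub.ch, Finsupp.supported_eq_span_single, Submodule.span_le]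
          rintro _ ⟨q, hq, rfl⟩
          obtain ⟨q', hq', rfl⟩ := h0 q hq
          exact ⟨of q', Sub.of_mem _ hq', ch_of _ _⟩
        exact this hc'
      -- in degree zero the filling is provided by the surjectivity on points
      obtain ⟨c, hcm, hc'⟩ := hsurj _ hw
      refine ⟨-c, neg_mem hcm, 0, zero_mem _, trivial, ?_⟩
      rw [sub_neg_eq_add, map_add, hc', add_zero]
      abel
    | succ n =>
      have hda : Q.d a₁ = - Q.d a₂ := by
        have : Q.d (a₁ + a₂) = 0 := hc.isCycle
        rw [map_add] at this
        exact eq_neg_of_add_eq_zero_left this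
      have hdm : Q.d a₁ ∈ (A₁.inter A₂).ch n := by
        refine Sub.mem_inter_ch.2 ⟨A₁.d_mem ha₁, ?_⟩
        rw [hda]
        exact neg_mem (A₂.d_mem ha₂)
      obtain ⟨a', ha', b', hb', e1, e2⟩ := h₁₂ (Q.d a₁) (-(Q'.d b₁ - p.ch _ a₁))
        ⟨hdm, neg_mem hw, IsCycle.of_d Q a₁, by
          rw [map_neg, map_sub, Q'.d_d, zero_sub, neg_neg, ch_d]⟩
      refine ⟨a', ha', b', hb', ?_, ?_⟩
      · change Q.d _ = 0
        rw [map_sub, e1, sub_self]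
      · rw [map_sub, map_add, e2]
        abel
  rw [Sub.mem_inter_ch] at ha' hb'
  -- after this correction both parts are cycles of their mapping cones
  obtain ⟨x, hx, y, hy, e1, e2⟩ := h₁ (a₁ - a') (b₁ + b')
    ⟨sub_mem ha₁ ha'.1, add_mem hb₁ hb'.1, hcyc, hbd⟩
  obtain ⟨z, hz, w, hw', e3, e4⟩ := h₂ (a₂ + a') (b₂ - b')
    ⟨add_mem ha₂ ha'.2, sub_mem hb₂ hb'.2, by
      cases n with
      | zero => trivial
      | succ n =>
        have e : Q.d (a₁ + a₂) = 0 := hc.isCycle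
        have e' : Q.d (a₁ - a') = 0 := hcyc
        change Q.d _ = 0
        have : a₂ + a' = (a₁ + a₂) - (a₁ - a') := by abel
        rw [this, map_sub, e, e', sub_zero], by
      have : a₂ + a' = (a₁ + a₂) - (a₁ - a') := by abel
      rw [this, map_sub, hc.map_eq, hbd, ← map_sub]
      congr 1
      abel⟩
  refine ⟨x + z, add_mem (hle hA₁ hx) (hle hA₂ hz), y + w, add_mem (hle hA₁' hy) (hle hA₂' hw'),
    ?_, ?_⟩
  · rw [map_add, e1, e3]
    abel
  · rw [map_add, e2, e4, map_add]
    abel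

end Hom

end SplxSet

/-! ### The prism operator -/

section Prism

open OrdChain

variable {A A' : ℕ → Type*} [∀ n, AddCommGroup (A n)] [∀ n, AddCommGroup (A' n)] {n m : ℕ}

/-- The inclusion of the level `s` into the cylinder over the standard simplex. -/
def cylIncl (n : ℕ) (s : unitInterval) : C(Splx n, Splx n × unitInterval) :=
  ⟨fun x => (x, s), by fun_prop⟩

/-- The linear extension of a function of maps `Splx m → Splx n × I` to ordered chains. -/
noncomputable def cylEv {B : Type*} [AddCommGroup B] (h : C(Splx m, Splx n × unitInterval) → B) :
    OrdChain (Splx n × unitInterval) m →ₗ[ℤ] B :=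
  Finsupp.linearCombination ℤ fun w => h (real w)

theorem cylEv_of {B : Type*} [AddCommGroup B] (h : C(Splx m, Splx n × unitInterval) → B)
    (w : Fin (m + 1) → Splx n × unitInterval) : cylEv h (OrdChain.of w) = h (real w) := by
  simp [cylEv, OrdChain.of]

/-- The prism operator of a family of maps `h α : A n → A' m`, indexed by the continuous maps
`α : Splx m → Splx n × I`. -/
noncomputable def prismOp (h : ∀ {n m : ℕ}, C(Splx m, Splx n × unitInterval) → A n →+ A' m)
    (n : ℕ) : A n →+ A' (n + 1) where
  toFun a := cylEv (fun α => h α a) (prism n (OrdChain.of (vert n)))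
  map_zero' := by simp [cylEv, Finsupp.linearCombination_apply]
  map_add' a b := by
    simp [cylEv, Finsupp.linearCombination_apply, Finsupp.sum_add]

theorem prismOp_apply (h : ∀ {n m : ℕ}, C(Splx m, Splx n × unitInterval) → A n →+ A' m) (a : A n) :
    prismOp h n a = cylEv (fun α => h α a) (prism n (OrdChain.of (vert n))) := rfl

variable (δ : ∀ n, Fin (n + 2) → A (n + 1) →+ A n) (δ' : ∀ n, Fin (n + 2) → A' (n + 1) →+ A' n)
  (h : ∀ {n m : ℕ}, C(Splx m, Splx n × unitInterval) → A n →+ A' m)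

theorem real_prod_const (s : unitInterval) (v : Fin (n + 1) → Splx n) :
    real (fun i => (v i, s)) = (cylIncl n s).comp (real v) := by
  ext1 t
  refine Prod.ext rfl (Subtype.ext ?_)
  change ∑ i, t i • (s : ℝ) = s
  rw [← Finset.sum_smul, stdSimplex.sum_eq_one, one_smul]

theorem cylEv_map_const {B : Type*} [AddCommGroup B] (h : C(Splx n, Splx n × unitInterval) → B)
    (s : unitInterval) :
    cylEv h (OrdChain.map (fun x => (x, s)) (OrdChain.of (vert n))) = h (cylIncl n s) := by
  rw [OrdChain.map_of, cylEv_of]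
  congr 1
  exact (real_prod_const s (vert n)).trans (by rw [real_vert_self]; rfl)

theorem alternatingSum_cylEv (a : A n)
    (h₁ : ∀ (m : ℕ) (i : Fin (m + 2)) (α : C(Splx (m + 1), Splx n × unitInterval)),
      δ' m i (h α a) = h (α.comp (face i)) a) (c : OrdChain (Splx n × unitInterval) (m + 1)) :
    ∑ i : Fin (m + 2), (-1 : ℤ) ^ (i : ℕ) • δ' m i (cylEv (fun α => h α a) c) =
      cylEv (fun α => h α a) (OrdChain.d c) := by
  have : (∑ i : Fin (m + 2), (-1 : ℤ) ^ (i : ℕ) • (δ' m i).toIntLinearMap) ∘ₗ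
      cylEv (fun α => h α a) = cylEv (fun α => h α a) ∘ₗ OrdChain.d := OrdChain.hom_ext fun w => by
    simp [cylEv_of, OrdChain.d_of, h₁, real_comp_face]
  simpa using LinearMap.congr_fun this c

/-- The prism operator is a chain homotopy between the maps at the two ends of the cylinder. -/
theorem alternatingSum_prismOp_succ (a : A (n + 1))
    (h₁ : ∀ (m : ℕ) (i : Fin (m + 2)) (α : C(Splx (m + 1), Splx (n + 1) × unitInterval)),
      δ' m i (h α a) = h (α.comp (face i)) a)
    (h₂ : ∀ (m : ℕ) (i : Fin (n + 2)) (α : C(Splx m, Splx n × unitInterval)),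
      h α (δ n i a) = h (((face i).prodMap (ContinuousMap.id _)).comp α) a) :
    ∑ i : Fin (n + 3), (-1 : ℤ) ^ (i : ℕ) • δ' (n + 1) i (prismOp h (n + 1) a) =
      h (cylIncl (n + 1) 1) a - h (cylIncl (n + 1) 0) a -
        prismOp h n (∑ i : Fin (n + 2), (-1 : ℤ) ^ (i : ℕ) • δ n i a) := by
  rw [prismOp_apply, alternatingSum_cylEv δ' h a h₁, d_prism_succ, map_sub, map_sub,
    cylEv_map_const, cylEv_map_const, OrdChain.d_of, map_sum, map_sum, map_sum]
  congr 1
  refine Finset.sum_congr rfl fun i _ => ?_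
  rw [map_zsmul, map_zsmul, map_zsmul, prismOp_apply]
  congr 1
  have key : ∀ c : OrdChain (Splx n × unitInterval) (n + 1),
      cylEv (fun α => h α (δ n i a)) c =
        cylEv (fun α => h α a) (OrdChain.map (Prod.map (face i) id) c) := fun c =>
    LinearMap.congr_fun (f := cylEv (fun α => h α (δ n i a)))
      (g := cylEv (fun α => h α a) ∘ₗ OrdChain.map (Prod.map (face i) id))
      (OrdChain.hom_ext fun w => by
        rw [LinearMap.comp_apply, OrdChain.map_of, cylEv_of, cylEv_of, h₂]
        congr 2
        ext1 t
        exact (IsAff.real_comp (IsAff.prodMap (isAff_real _) isAff_id) w t).symm) c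
  rw [key, map_prism (f := face i) (isAff_real _), OrdChain.map_of]
  congr 3
  exact (real_comp_vert _).symm

theorem alternatingSum_prismOp_zero (a : A 0)
    (h₁ : ∀ (m : ℕ) (i : Fin (m + 2)) (α : C(Splx (m + 1), Splx 0 × unitInterval)),
      δ' m i (h α a) = h (α.comp (face i)) a) :
    ∑ i : Fin 2, (-1 : ℤ) ^ (i : ℕ) • δ' 0 i (prismOp h 0 a) =
      h (cylIncl 0 1) a - h (cylIncl 0 0) a := by
  rw [prismOp_apply, alternatingSum_cylEv δ' h a h₁, d_prism_zero, map_sub,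
    cylEv_map_const, cylEv_map_const]

end Prism

/-! ### Homotopy invariance of the mapping cone -/

namespace SplxSet

variable {Q Q' : SplxSet.{u}} {n m : ℕ}

/-- A partial homotopy on the subpresheaf `A` of `Q`: for each map `α` from a simplex to the
cylinder over the standard simplex, the value on a simplex of `A` of the homotopy composed with `α`.
Outside of `A` the value `0` is allowed. -/
structure CylHtpy (A : Q.Sub) where
  /-- The composition of the homotopy on the simplex `q` with `α`. -/
  app {n m : ℕ} (α : C(Splx m, Splx n × unitInterval)) (q : Q.S n) : Q.Ch m
  app_mem {n m : ℕ} (α : C(Splx m, Splx n × unitInterval)) {q : Q.S n} :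
    q ∈ A.carrier n → app α q ∈ A.ch m
  act_app {n m : ℕ} (i : Fin (m + 2)) (α : C(Splx (m + 1), Splx n × unitInterval)) {q : Q.S n} :
    q ∈ A.carrier n → Finsupp.lmapDomain ℤ ℤ (Q.act (face i)) (app α q) = app (α.comp (face i)) q
  app_act {n m : ℕ} (i : Fin (n + 2)) (α : C(Splx m, Splx n × unitInterval)) {q : Q.S (n + 1)} :
    q ∈ A.carrier (n + 1) →
      app α (Q.act (face i) q) = app (((face i).prodMap (ContinuousMap.id _)).comp α) q
  app_zero {n : ℕ} {q : Q.S n} : q ∈ A.carrier n → app (cylIncl n 0) q = of q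

namespace CylHtpy

variable {A : Q.Sub} (H : CylHtpy A)

/-- The linear extension of `CylHtpy.app`. -/
noncomputable def lin {n m : ℕ} (α : C(Splx m, Splx n × unitInterval)) : Q.Ch n →+ Q.Ch m :=
  (Finsupp.linearCombination ℤ (H.app α)).toAddMonoidHom

theorem lin_of (α : C(Splx m, Splx n × unitInterval)) (q : Q.S n) : H.lin α (of q) = H.app α q := by
  simp [lin, of]

theorem eqOn_ch {M : Type*} [AddCommGroup M] {f g : Q.Ch n →+ M}
    (h : ∀ q ∈ A.carrier n, f (of q) = g (of q)) {a : Q.Ch n} (ha : a ∈ A.ch n) : f a = g a := by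
  have := supported_induction (N := ⊥) (f - g).toIntLinearMap (fun q hq => by
    change f (of q) - g (of q) ∈ _
    rw [h q hq, sub_self]
    exact zero_mem _) ha
  exact sub_eq_zero.1 this

theorem lin_mem (α : C(Splx m, Splx n × unitInterval)) {a : Q.Ch n} (ha : a ∈ A.ch n) :
    H.lin α a ∈ A.ch m :=
  supported_induction (H.lin α).toIntLinearMap (fun q hq => by
    change H.lin α (of q) ∈ _
    rw [lin_of]
    exact H.app_mem α hq) ha

/-- The map at the end of the homotopy. -/
noncomputable def last (n : ℕ) : Q.Ch n →+ Q.Ch n := H.lin (cylIncl n 1)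

theorem lin_zero {a : Q.Ch n} (ha : a ∈ A.ch n) : H.lin (cylIncl n 0) a = a :=
  eqOn_ch (g := AddMonoidHom.id _) (fun q hq => by
    rw [lin_of, H.app_zero hq, AddMonoidHom.id_apply]) ha

/-- The prism operator of a homotopy. -/
noncomputable def prism (n : ℕ) : Q.Ch n →+ Q.Ch (n + 1) :=
  prismOp (A := Q.Ch) (A' := Q.Ch) H.lin n

theorem cylEv_mem {N : Submodule ℤ (Q.Ch m)} {h : C(Splx m, Splx n × unitInterval) → Q.Ch m}
    (hN : ∀ α, h α ∈ N) (c : OrdChain (Splx n × unitInterval) m) : cylEv h c ∈ N :=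
  supported_induction (s := Set.univ) (cylEv h) (fun w _ => by
    change cylEv h (OrdChain.of w) ∈ _
    rw [cylEv_of]
    exact hN _) (by simp)

theorem prism_mem {a : Q.Ch n} (ha : a ∈ A.ch n) : H.prism n a ∈ A.ch (n + 1) :=
  cylEv_mem (fun α => H.lin_mem α ha) _

theorem lin_face (m : ℕ) (i : Fin (m + 2)) (α : C(Splx (m + 1), Splx n × unitInterval)) {a : Q.Ch n}
    (ha : a ∈ A.ch n) :
    (Finsupp.lmapDomain ℤ ℤ (Q.act (face i))).toAddMonoidHom (H.lin α a) =
      H.lin (α.comp (face i)) a :=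
  eqOn_ch (f := (Finsupp.lmapDomain ℤ ℤ (Q.act (face i))).toAddMonoidHom.comp (H.lin α))
    (fun q hq => by
      rw [AddMonoidHom.comp_apply, lin_of, lin_of]
      exact H.act_app i α hq) ha

theorem d_eq (c : Q.Ch (n + 1)) : Q.d c = ∑ i : Fin (n + 2), (-1 : ℤ) ^ (i : ℕ) •
    (Finsupp.lmapDomain ℤ ℤ (Q.act (face i))).toAddMonoidHom c := by
  simp [d]

/-- The faces as additive maps on chains. -/
noncomputable def faceHom (n : ℕ) (i : Fin (n + 2)) : Q.Ch (n + 1) →+ Q.Ch n :=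
  (Finsupp.lmapDomain ℤ ℤ (Q.act (face i))).toAddMonoidHom

theorem d_prism {a : Q.Ch (n + 1)} (ha : a ∈ A.ch (n + 1)) :
    Q.d (H.prism (n + 1) a) = H.last (n + 1) a - a - H.prism n (Q.d a) := by
  have key := alternatingSum_prismOp_succ (A := Q.Ch) (A' := Q.Ch) faceHom faceHom
    (fun {n m} α => H.lin α) a (fun m i α => H.lin_face m i α ha)
    (fun m i α => eqOn_ch (f := (H.lin α).comp (faceHom n i)) (fun q hq => by
        have e : faceHom n i (of q) = of (Q.act (face i) q) := by
          simp [of, faceHom]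
        rw [AddMonoidHom.comp_apply, e, lin_of, lin_of]
        exact H.app_act i α hq) ha)
  rw [H.lin_zero ha] at key
  rw [d_eq, d_eq]
  exact key

theorem IsCycle.d_prism {a : Q.Ch n} (ha : a ∈ A.ch n) (hc : Q.IsCycle a) :
    Q.d (H.prism n a) = H.last n a - a := by
  cases n with
  | zero =>
    have key := alternatingSum_prismOp_zero (A := Q.Ch) (A' := Q.Ch) faceHom
      (fun {n m} α => H.lin α) a (fun m i α => H.lin_face m i α ha)
    rw [H.lin_zero ha] at key
    rw [d_eq]
    exact key
  | succ n =>
    have h : Q.d a = 0 := hc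
    rw [H.d_prism ha, h, map_zero, sub_zero]

variable {A' : Q'.Sub} (H' : CylHtpy A') (p : Hom Q Q')

/-- If homotopies on `A` and `A'` are compatible with `p` and deform them into `A₀` and `A₀'`, then
acyclicity for `A₀` implies acyclicity for `A`. -/
theorem acyclic_of_last_mem {A₀ : Q.Sub} {A₀' : Q'.Sub} (h₀ : ∀ n, A₀.carrier n ⊆ A.carrier n)
    (h₀' : ∀ n, A₀'.carrier n ⊆ A'.carrier n)
    (hH : ∀ {n m : ℕ} (α : C(Splx m, Splx n × unitInterval)), ∀ q ∈ A.carrier n,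
      p.ch m (H.app α q) = H'.app α (p.app q))
    (h1 : ∀ n, ∀ q ∈ A.carrier n, H.app (cylIncl n 1) q ∈ A₀.ch n)
    (h1' : ∀ n, ∀ q ∈ A'.carrier n, H'.app (cylIncl n 1) q ∈ A₀'.ch n)
    (hac : p.Acyclic A₀ A₀') : p.Acyclic A A' := by
  intro n a b hab
  -- `p` commutes with the homotopies on chains, hence with the prism operators
  have hlin : ∀ {n m : ℕ} (α : C(Splx m, Splx n × unitInterval)), ∀ a ∈ A.ch n,
      p.ch m (H.lin α a) = H'.lin α (p.ch n a) := fun {n m} α a ha =>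
    eqOn_ch (f := (p.ch m).toAddMonoidHom.comp (H.lin α))
      (g := (H'.lin α).comp (p.ch n).toAddMonoidHom) (fun q hq => by
        simp only [AddMonoidHom.comp_apply, lin_of, LinearMap.toAddMonoidHom_coe, Hom.ch_of]
        exact hH α q hq) ha
  have hprism : ∀ {n : ℕ}, ∀ a ∈ A.ch n, p.ch (n + 1) (H.prism n a) = H'.prism n (p.ch n a) := by
    intro n a ha
    rw [prism, prism, prismOp_apply, prismOp_apply]
    exact LinearMap.congr_fun (f := p.ch (n + 1) ∘ₗ cylEv fun α => H.lin α a)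
      (g := cylEv fun α => H'.lin α (p.ch n a)) (OrdChain.hom_ext fun w => by
        rw [LinearMap.comp_apply, cylEv_of, cylEv_of, hlin _ a ha]) _
  have hlast : H.last n a ∈ A₀.ch n :=
    supported_induction (H.last n).toIntLinearMap (fun q hq => by
      change H.lin _ (of q) ∈ _
      rw [lin_of]
      exact h1 n q hq) hab.fst_mem
  have hlast' : H'.last (n + 1) b ∈ A₀'.ch (n + 1) :=
    supported_induction (H'.last (n + 1)).toIntLinearMap (fun q hq => by
      change H'.lin _ (of q) ∈ _
      rw [lin_of]
      exact h1' _ q hq) hab.snd_mem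
  have hda := IsCycle.d_prism H hab.fst_mem hab.isCycle
  have hdb := H'.d_prism hab.snd_mem
  obtain ⟨a', ha', b', hb', e1, e2⟩ := hac (H.last n a) (H'.last (n + 1) b) ⟨hlast, hlast', by
      have : H.last n a = a + Q.d (H.prism n a) := by rw [hda]; abel
      rw [this]
      cases n with
      | zero => trivial
      | succ n =>
        have h : Q.d a = 0 := hab.isCycle
        change Q.d _ = 0
        rw [map_add, h, Q.d_d, zero_add], by
      have e3 := IsCycle.d_prism H' (A'.d_mem hab.snd_mem) (SplxSet.IsCycle.of_d Q' b)
      have e4 : H'.last (n + 1) b = b + H'.prism n (Q'.d b) + Q'.d (H'.prism (n + 1) b) := by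
        rw [hdb]; abel
      rw [e4, map_add, map_add, Q'.d_d, e3, last, hlin _ a hab.fst_mem, hab.map_eq, last]
      abel⟩
  -- a filling of the deformed cycle, corrected by the prisms, fills the given cycle
  refine ⟨a' - H.prism n a, sub_mem (Finsupp.supported_mono (h₀ _) ha') (H.prism_mem hab.fst_mem),
    b' - H'.prism (n + 1) b,
    sub_mem (Finsupp.supported_mono (h₀' _) hb') (H'.prism_mem hab.snd_mem), ?_, ?_⟩
  · rw [map_sub, e1, hda]
    abel
  · rw [map_sub, e2, hdb, ← hab.map_eq, map_sub, hprism a hab.fst_mem]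
    abel

end CylHtpy

/-- The preimage of a subpresheaf. -/
def Hom.comap (p : Hom Q Q') (A : Q'.Sub) : Q.Sub where
  carrier n := {q | p.app q ∈ A.carrier n}
  act_mem α q hq := by
    change p.app _ ∈ A.carrier _
    rw [p.app_act]
    exact A.act_mem α hq

end SplxSet

/-! ### Singular simplices of a `Γ`-space and of its orbit space -/

section Singular

open SplxSet

/-- The singular simplices of a space. -/
@[reducible] def sing (B : Type u) [TopologicalSpace B] : SplxSet.{u} where
  S n := C(Splx n, B)
  act α σ := σ.comp α
  act_id _ := rfl
  act_comp _ _ _ := rfl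

/-- The singular simplices with image in `W`. -/
def singSub {B : Type u} [TopologicalSpace B] (W : Set B) : (sing B).Sub where
  carrier n := {σ : C(Splx n, B) | ∀ y, σ y ∈ W}
  act_mem α _ h y := h (α y)

variable (Γ : Type u) [Group Γ] (X : Type u) [TopologicalSpace X] [MulAction Γ X]

/-- The orbit space. -/
abbrev Orb := MulAction.orbitRel.Quotient Γ X

variable {X} in
/-- The projection to the orbit space. -/
abbrev proj (x : X) : Orb Γ X := Quotient.mk _ x

variable {X} {Γ} in
omit [TopologicalSpace X] in
theorem proj_eq_iff {x y : X} : proj Γ x = proj Γ y ↔ ∃ g : Γ, g • y = x := by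
  rw [Quotient.eq]
  rfl

variable {X} in
omit [TopologicalSpace X] in
@[simp] theorem proj_smul (g : Γ) (x : X) : proj Γ (g • x) = proj Γ x := proj_eq_iff.2 ⟨g, rfl⟩

variable [ContinuousConstSMul Γ X]

theorem isOpenQuotientMap_proj : IsOpenQuotientMap (proj Γ : X → Orb Γ X) :=
  MulAction.isOpenQuotientMap_quotientMk

/-- The `Γ`-orbits of singular simplices of `X`. -/
@[reducible] def orbSing : SplxSet.{u} where
  S n := Orb Γ C(Splx n, X)
  act α := Quotient.map (fun σ => σ.comp α) (by
    rintro _ σ ⟨g, rfl⟩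
    exact ⟨g, rfl⟩)
  act_id q := by
    induction q using Quotient.inductionOn
    rfl
  act_comp _ _ q := by
    induction q using Quotient.inductionOn
    rfl

variable {X} in
/-- The composition of a singular simplex with the projection to the orbit space. -/
def projSing {n : ℕ} (σ : C(Splx n, X)) : C(Splx n, Orb Γ X) :=
  ⟨fun y => proj Γ (σ y), (isOpenQuotientMap_proj Γ X).continuous.comp σ.continuous⟩

/-- The map from the orbits of simplices to the simplices of the orbit space. -/
def orbMap : Hom (orbSing Γ X) (sing (Orb Γ X)) where
  app := Quotient.lift (projSing Γ) (by
    rintro _ σ ⟨g, rfl⟩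
    exact ContinuousMap.ext fun y => proj_smul Γ g _)
  app_act α q := by
    induction q using Quotient.inductionOn
    rfl

/-- The mapping cone of the chains on `orbMap` is acyclic over the subset `W` of the orbit space. -/
def AcyclicOver (W : Set (Orb Γ X)) : Prop :=
  (orbMap Γ X).Acyclic ((orbMap Γ X).comap (singSub W)) (singSub W)

/-- Iterated subdivision of a simplex over `W` yields simplices over `W ∩ O₁` or over `W ∩ O₂`. -/
theorem exists_sd_pow_mem_ch {Q : SplxSet.{u}} {B : Type u} [TopologicalSpace B]
    (p : Hom Q (sing B)) {W O₁ O₂ : Set B} (h₁ : IsOpen O₁) (h₂ : IsOpen O₂) (hW : W ⊆ O₁ ∪ O₂)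
    {n : ℕ} {q : Q.S n} (hq : q ∈ (p.comap (singSub W)).carrier n) :
    ∃ N, ∀ j ≥ N, ((Q.sd n) ^ j) (of q) ∈
      (p.comap (singSub (W ∩ O₁))).ch n ⊔ (p.comap (singSub (W ∩ O₂))).ch n := by
  obtain ⟨τ, hτ⟩ : ∃ τ : C(Splx n, B), p.app q = τ := ⟨_, rfl⟩
  replace hq : ∀ y, τ y ∈ W := hτ ▸ hq
  obtain ⟨N, hN⟩ := exists_sd_pow_mem_supported (h₁.preimage τ.continuous)
    (h₂.preimage τ.continuous) (Set.eq_univ_of_forall fun y => hW (hq y))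
  refine ⟨N, fun j hj => ?_⟩
  rw [sd_pow_of]
  refine supported_induction (ev q) (fun w hw => ?_) (hN j hj)
  change ev q (OrdChain.of w) ∈ _
  rw [ev_of]
  have key : p.app (Q.act (real w) q) = τ.comp (real w) := by
    rw [p.app_act, hτ]
  rcases hw with hw | hw
  · refine Submodule.mem_sup_left (Sub.of_mem _ ?_)
    change p.app _ ∈ (singSub _).carrier n
    rw [key]
    exact fun y => ⟨hq _, hw ⟨y, rfl⟩⟩
  · refine Submodule.mem_sup_right (Sub.of_mem _ ?_)
    change p.app _ ∈ (singSub _).carrier n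
    rw [key]
    exact fun y => ⟨hq _, hw ⟨y, rfl⟩⟩

variable {X}

/-- The Mayer–Vietoris argument, for a relatively open cover of a subset of the orbit space by two
sets. The set itself does not have to be open. -/
theorem AcyclicOver.of_cover {W O₁ O₂ : Set (Orb Γ X)} (h₁ : IsOpen O₁) (h₂ : IsOpen O₂)
    (hW : W ⊆ O₁ ∪ O₂) (a₁ : AcyclicOver Γ X (W ∩ O₁)) (a₂ : AcyclicOver Γ X (W ∩ O₂))
    (a₁₂ : AcyclicOver Γ X (W ∩ O₁ ∩ O₂)) : AcyclicOver Γ X W := by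
  have e' : (singSub (W ∩ O₁)).inter (singSub (W ∩ O₂)) = singSub (W ∩ O₁ ∩ O₂) := by
    unfold Sub.inter singSub
    congr 1
    funext n
    ext σ
    exact ⟨fun h y => ⟨⟨(h.1 y).1, (h.1 y).2⟩, (h.2 y).2⟩,
      fun h => ⟨fun y => (h y).1, fun y => ⟨(h y).1.1, (h y).2⟩⟩⟩
  have e : ((orbMap Γ X).comap (singSub (W ∩ O₁))).inter ((orbMap Γ X).comap (singSub (W ∩ O₂))) =
      (orbMap Γ X).comap (singSub (W ∩ O₁ ∩ O₂)) := by
    rw [← e']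
    rfl
  refine Hom.Acyclic.of_cover (A₁ := (orbMap Γ X).comap (singSub (W ∩ O₁)))
    (A₂ := (orbMap Γ X).comap (singSub (W ∩ O₂))) (A₁' := singSub (W ∩ O₁))
    (A₂' := singSub (W ∩ O₂)) (fun n q h y => (h y).1) (fun n q h y => (h y).1)
    (fun n q h y => (h y).1) (fun n q h y => (h y).1)
    (fun n q hq => exists_sd_pow_mem_ch (orbMap Γ X) h₁ h₂ hW hq)
    (fun n q hq => exists_sd_pow_mem_ch ⟨id, fun _ _ => rfl⟩ h₁ h₂ hW hq)
    (fun n q h => h) (fun n q h => h) ?_ a₁ a₂ ?_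
  · intro (q' : C(Splx 0, Orb Γ X)) hq'
    obtain ⟨x, hx⟩ := Quotient.exists_rep (q' default)
    have : projSing Γ (ContinuousMap.const (Splx 0) x) = q' := by
      ext1 y
      rw [Subsingleton.elim y default]
      exact hx
    refine ⟨Quotient.mk _ (ContinuousMap.const _ x), ?_, this⟩
    rw [e]
    rw [e'] at hq'
    change projSing Γ (ContinuousMap.const (Splx 0) x) ∈ (singSub (W ∩ O₁ ∩ O₂)).carrier 0
    rw [this]
    exact hq'
  · rw [e, e']
    exact a₁₂

/-- Over a subset over which every singular simplex has a unique orbit of lifts, the map is an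
isomorphism on chains. -/
theorem AcyclicOver.of_lift {W : Set (Orb Γ X)}
    (hex : ∀ (n : ℕ) (τ : C(Splx n, Orb Γ X)), (∀ y, τ y ∈ W) →
      ∃ σ : C(Splx n, X), projSing Γ σ = τ)
    (huniq : ∀ (n : ℕ) (σ σ' : C(Splx n, X)), (∀ y, proj Γ (σ y) ∈ W) →
      projSing Γ σ = projSing Γ σ' → ∃ g : Γ, g • σ' = σ) : AcyclicOver Γ X W := by
  intro n a b hab
  set p := orbMap Γ X
  have hsurj : ∀ b ∈ (singSub W).ch (n + 1), ∃ a ∈ (p.comap (singSub W)).ch (n + 1),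
      p.ch (n + 1) a = b := by
    intro c hc'
    have : (singSub W).ch (n + 1) ≤ ((p.comap (singSub W)).ch (n + 1)).map (p.ch (n + 1)) := by
      rw [Sub.ch, Finsupp.supported_eq_span_single, Submodule.span_le]
      rintro _ ⟨q, hq, rfl⟩
      obtain ⟨σ, hσ⟩ := hex _ q hq
      have e : p.app (Quotient.mk _ σ : (orbSing Γ X).S (n + 1)) = q := hσ
      generalize (Quotient.mk _ σ : (orbSing Γ X).S (n + 1)) = q' at e
      refine ⟨SplxSet.of q', Sub.of_mem _ ?_, ?_⟩
      · change p.app _ ∈ (singSub W).carrier _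
        rw [e]
        exact hq
      · rw [Hom.ch_of, e]
        rfl
    exact this hc'
  have hinj : Set.InjOn (p.ch n) (((p.comap (singSub W)).ch n : Submodule ℤ _) : Set _) := by
    refine Finsupp.mapDomain_injOn _ ?_
    intro q hq q' hq' h
    induction q using Quotient.inductionOn
    induction q' using Quotient.inductionOn
    obtain ⟨g, hg⟩ := huniq n _ _ hq h
    exact Quotient.sound ⟨g, hg⟩
  obtain ⟨a', ha', h⟩ := hsurj b hab.snd_mem
  refine ⟨a', ha', 0, zero_mem _, ?_, by rw [h, sub_self, map_zero]⟩
  refine hinj (Sub.d_mem _ ha') hab.fst_mem ?_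
  rw [Hom.ch_d, h, hab.map_eq]

/-- The composition of a homotopy `H` on the simplex `σ` with a map `α` to the cylinder over the
standard simplex. -/
def cylMap {Y : Type*} {n m : ℕ} (H : unitInterval → Y → Y)
    (α : Splx m → Splx n × unitInterval) (σ : Splx n → Y) (y : Splx m) : Y :=
  H (α y).2 (σ (α y).1)

theorem continuous_cylMap {Y : Type*} [TopologicalSpace Y] {n m : ℕ} {H : unitInterval → Y → Y}
    {A : Set Y} (hH : ContinuousOn (fun z : unitInterval × Y => H z.1 z.2) (Set.univ ×ˢ A))
    (α : C(Splx m, Splx n × unitInterval)) {σ : C(Splx n, Y)} (hσ : ∀ y, σ y ∈ A) :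
    Continuous (cylMap H α σ) :=
  hH.comp_continuous (f := fun y => ((α y).2, σ (α y).1)) (by fun_prop) fun y =>
    ⟨trivial, hσ _⟩

open Classical in
/-- The partial homotopy on singular simplices given by a homotopy on a subset. -/
noncomputable def singHtpy {B : Type u} [TopologicalSpace B] (H : unitInterval → B → B) (W : Set B)
    (hH : ContinuousOn (fun z : unitInterval × B => H z.1 z.2) (Set.univ ×ˢ W))
    (hW : ∀ t, ∀ x ∈ W, H t x ∈ W) (h0 : ∀ x ∈ W, H 0 x = x) : CylHtpy (singSub W) where
  app {n m} α (σ : C(Splx n, B)) := if h : Continuous (cylMap H α σ)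
    then SplxSet.of (Q := sing B) (n := m) (⟨_, h⟩ : C(Splx m, B)) else 0
  app_mem {n m} α σ hσ := by
    rw [dif_pos (continuous_cylMap hH α hσ)]
    exact Sub.of_mem _ fun y => hW _ _ (hσ _)
  act_app {n m} i α σ hσ := by
    rw [dif_pos (continuous_cylMap hH α hσ), dif_pos (continuous_cylMap hH _ hσ)]
    exact Finsupp.mapDomain_single
  app_act i α σ hσ := rfl
  app_zero {n σ} hσ := by
    rw [dif_pos (continuous_cylMap hH _ hσ)]
    congr 1
    exact ContinuousMap.ext fun y => h0 _ (hσ y)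

open Classical in
theorem singHtpy_app {B : Type u} [TopologicalSpace B] {H : unitInterval → B → B} {W : Set B}
    (hH : ContinuousOn (fun z : unitInterval × B => H z.1 z.2) (Set.univ ×ˢ W))
    (hW : ∀ t, ∀ x ∈ W, H t x ∈ W) (h0 : ∀ x ∈ W, H 0 x = x) {n m : ℕ}
    (α : C(Splx m, Splx n × unitInterval)) {σ : C(Splx n, B)} (hσ : ∀ y, σ y ∈ W) :
    (singHtpy H W hH hW h0).app α σ =
      SplxSet.of (Q := sing B) (⟨_, continuous_cylMap hH α hσ⟩ : C(Splx m, B)) :=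
  dif_pos _

section OrbHtpy

variable {Γ}
variable (H : unitInterval → X → X) (hΓ : ∀ (t : unitInterval) (g : Γ) (x : X),
  H t (g • x) = g • H t x)

include hΓ in
omit [TopologicalSpace X] [ContinuousConstSMul Γ X] in
theorem cylMap_smul {n m : ℕ} (α : Splx m → Splx n × unitInterval) (g : Γ) (σ : Splx n → X) :
    cylMap H α (g • σ) = g • cylMap H α σ :=
  funext fun _ => hΓ _ _ _

include hΓ in
theorem continuous_cylMap_smul_iff {n m : ℕ} (α : Splx m → Splx n × unitInterval) (g : Γ)
    (σ : Splx n → X) : Continuous (cylMap H α (g • σ)) ↔ Continuous (cylMap H α σ) := by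
  rw [cylMap_smul H hΓ]
  exact ⟨fun h => by simpa using h.const_smul g⁻¹, fun h => h.const_smul g⟩

open Classical in
/-- The partial homotopy on the orbits of singular simplices given by an equivariant homotopy on
the preimage of a subset of the orbit space. -/
noncomputable def orbHtpy (W : Set (Orb Γ X))
    (hH : ContinuousOn (fun z : unitInterval × X => H z.1 z.2) (Set.univ ×ˢ (proj Γ ⁻¹' W)))
    (hW : ∀ t x, proj Γ x ∈ W → proj Γ (H t x) ∈ W) (h0 : ∀ x, proj Γ x ∈ W → H 0 x = x) :
    CylHtpy ((orbMap Γ X).comap (singSub W)) where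
  app {n m} α := Quotient.lift (fun σ : C(Splx n, X) => if h : Continuous (cylMap H α σ)
    then SplxSet.of (Q := orbSing Γ X) (n := m) (Quotient.mk _ (⟨_, h⟩ : C(Splx m, X))) else 0) (by
      rintro _ σ ⟨g, rfl⟩
      by_cases h : Continuous (cylMap H α σ)
      · have h' : Continuous (cylMap H α (g • σ)) := (continuous_cylMap_smul_iff H hΓ α g σ).2 h
        have h'' : Continuous (cylMap H α ⇑(g • σ : C(Splx n, X))) := h'
        change dite _ _ _ = _
        rw [dif_pos h'', dif_pos h]
        congr 1
        exact Quotient.sound ⟨g, ContinuousMap.ext fun y => (hΓ _ _ _).symm⟩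
      · have h' : ¬ Continuous (cylMap H α (g • σ)) :=
          fun h' => h ((continuous_cylMap_smul_iff H hΓ α g σ).1 h')
        have h'' : ¬ Continuous (cylMap H α ⇑(g • σ : C(Splx n, X))) := h'
        change dite _ _ _ = _
        rw [dif_neg h'', dif_neg h])
  app_mem {n m} α q hq := by
    induction q using Quotient.inductionOn with | _ σ
    change dite _ _ _ ∈ _
    rw [dif_pos (continuous_cylMap hH α hq)]
    exact Sub.of_mem _ fun y => hW _ _ (hq _)
  act_app {n m} i α q hq := by
    induction q using Quotient.inductionOn with | _ σ
    change Finsupp.lmapDomain ℤ ℤ _ (dite _ _ _) = dite _ _ _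
    rw [dif_pos (continuous_cylMap hH α hq), dif_pos (continuous_cylMap hH _ hq)]
    exact Finsupp.mapDomain_single
  app_act i α q hq := by
    induction q using Quotient.inductionOn with | _ σ
    rfl
  app_zero {n q} hq := by
    induction q using Quotient.inductionOn with | _ σ
    change dite _ _ _ = _
    rw [dif_pos (continuous_cylMap hH _ hq)]
    congr 2
    ext1 y
    exact h0 _ (hq y)

open Classical in
theorem orbHtpy_app {W : Set (Orb Γ X)}
    (hH : ContinuousOn (fun z : unitInterval × X => H z.1 z.2) (Set.univ ×ˢ (proj Γ ⁻¹' W)))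
    (hW : ∀ t x, proj Γ x ∈ W → proj Γ (H t x) ∈ W) (h0 : ∀ x, proj Γ x ∈ W → H 0 x = x) {n m : ℕ}
    (α : C(Splx m, Splx n × unitInterval)) {σ : C(Splx n, X)} (hσ : ∀ y, σ y ∈ proj Γ ⁻¹' W) :
    (orbHtpy H hΓ W hH hW h0).app α (Quotient.mk _ σ) =
      SplxSet.of (Q := orbSing Γ X)
        (Quotient.mk _ (⟨_, continuous_cylMap hH α hσ⟩ : C(Splx m, X))) :=
  dif_pos _

include hΓ in
/-- An equivariant homotopy that deforms the preimage of `W` into the preimage of `W₀`, within the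
preimage of `W`, reduces acyclicity over `W` to acyclicity over `W₀`. -/
theorem AcyclicOver.of_homotopy {W₀ W : Set (Orb Γ X)} (hW₀ : W₀ ⊆ W)
    (hH : ContinuousOn (fun z : unitInterval × X => H z.1 z.2) (Set.univ ×ˢ (proj Γ ⁻¹' W)))
    (hW : ∀ t x, proj Γ x ∈ W → proj Γ (H t x) ∈ W) (h0 : ∀ x, proj Γ x ∈ W → H 0 x = x)
    (h1 : ∀ x, proj Γ x ∈ W → proj Γ (H 1 x) ∈ W₀) (hac : AcyclicOver Γ X W₀) :
    AcyclicOver Γ X W := by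
  -- the induced homotopy of the orbit space, which is continuous since the projection is open
  let K : unitInterval → Orb Γ X → Orb Γ X := fun t => Quotient.map (H t) (by
    rintro _ x ⟨g, rfl⟩
    exact ⟨g, (hΓ t g x).symm⟩)
  have hp := isOpenQuotientMap_proj Γ X
  have hK : ContinuousOn (fun z : unitInterval × Orb Γ X => K z.1 z.2) (Set.univ ×ˢ W) := by
    rintro ⟨t, z⟩ ⟨-, hz⟩
    obtain ⟨x, rfl⟩ := hp.surjective z
    have hq : IsOpenQuotientMap (Prod.map (id : unitInterval → unitInterval) (proj Γ : X → _)) :=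
      IsOpenQuotientMap.id.prodMap hp
    have hn : nhdsWithin (t, proj Γ x) (Set.univ ×ˢ W) =
        Filter.map (Prod.map id (proj Γ)) (nhdsWithin (t, x) (Set.univ ×ˢ (proj Γ ⁻¹' W))) := by
      have e : (Set.univ ×ˢ (proj Γ ⁻¹' W) : Set (unitInterval × X)) =
          Prod.map id (proj Γ) ⁻¹' (Set.univ ×ˢ W) := rfl
      rw [nhdsWithin, nhdsWithin, e, ← Filter.comap_principal, inf_comm (nhds (t, x)),
        Filter.push_pull', hq.map_nhds_eq, inf_comm]
      rfl
    change Filter.Tendsto _ (nhdsWithin (t, proj Γ x) _) _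
    rw [hn, Filter.tendsto_map'_iff]
    exact hp.continuous.continuousAt.tendsto.comp (hH (t, x) ⟨trivial, hz⟩)
  have hWK : ∀ t, ∀ z ∈ W, K t z ∈ W := fun t z hz => by
    obtain ⟨x, rfl⟩ := hp.surjective z
    exact hW t x hz
  have h0K : ∀ z ∈ W, K 0 z = z := fun z hz => by
    obtain ⟨x, rfl⟩ := hp.surjective z
    exact congrArg (proj Γ) (h0 x hz)
  have h1K : ∀ z ∈ W, K 1 z ∈ W₀ := fun z hz => by
    obtain ⟨x, rfl⟩ := hp.surjective z
    exact h1 x hz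
  refine CylHtpy.acyclic_of_last_mem (orbHtpy H hΓ W hH hW h0) (singHtpy K W hK hWK h0K) _
    (A₀ := (orbMap Γ X).comap (singSub W₀)) (A₀' := singSub W₀)
    (fun n q hq y => hW₀ (hq y)) (fun n q hq y => hW₀ (hq y)) ?_ ?_ ?_ hac
  · intro n m α q hq
    induction q using Quotient.inductionOn with | _ σ
    have hq' : ∀ y, (projSing Γ σ : C(Splx n, Orb Γ X)) y ∈ W := hq
    rw [orbHtpy_app H hΓ hH hW h0 α hq, Hom.ch_of]
    exact (singHtpy_app hK hWK h0K α hq').symm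
  · intro n q hq
    induction q using Quotient.inductionOn with | _ σ
    rw [orbHtpy_app H hΓ hH hW h0 _ hq]
    exact Sub.of_mem _ fun y => h1 _ (hq y)
  · intro n σ hσ
    rw [singHtpy_app hK hWK h0K _ hσ]
    exact Sub.of_mem _ fun y => h1K _ (hσ y)

end OrbHtpy

/-- Acyclicity over an ascending sequence of subsets that absorbs all compact sets. -/
theorem AcyclicOver.univ_of_filtration (W : ℕ → Set (Orb Γ X)) (hmono : Monotone W)
    (hcpt : ∀ K : Set (Orb Γ X), IsCompact K → ∃ n, K ⊆ W n) (hac : ∀ n, AcyclicOver Γ X (W n)) :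
    AcyclicOver Γ X Set.univ := by
  -- a chain involves finitely many simplices, and each of these has a compact image
  have key : ∀ {Q : SplxSet.{u}} (p : Hom Q (sing (Orb Γ X))) {n : ℕ} (c : Q.Ch n),
      ∃ N, ∀ k ≥ N, c ∈ (p.comap (singSub (W k))).ch n := by
    intro Q p n c
    induction c using Finsupp.induction_linear with
    | zero => exact ⟨0, fun k _ => zero_mem _⟩
    | add x y hx hy =>
      obtain ⟨N, hN⟩ := hx
      obtain ⟨M, hM⟩ := hy
      exact ⟨max N M, fun k hk => add_mem (hN k (le_of_max_le_left hk))
        (hM k (le_of_max_le_right hk))⟩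
    | single q r =>
      obtain ⟨τ, hτ⟩ : ∃ τ : C(Splx n, Orb Γ X), p.app q = τ := ⟨_, rfl⟩
      obtain ⟨N, hN⟩ := hcpt (Set.range τ) (isCompact_range τ.continuous)
      refine ⟨N, fun k hk => Finsupp.single_mem_supported ℤ r ?_⟩
      change p.app q ∈ (singSub (W k)).carrier n
      rw [hτ]
      exact fun y => hmono hk (hN ⟨y, rfl⟩)
  intro n a b hab
  obtain ⟨N, hN⟩ := key (orbMap Γ X) a
  obtain ⟨M, hM⟩ := key (Q := sing (Orb Γ X)) ⟨id, fun _ _ => rfl⟩ b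
  obtain ⟨a', ha', b', hb', h⟩ := hac (max N M) a b
    ⟨hN _ (le_max_left _ _), hM _ (le_max_right _ _), hab.isCycle, hab.map_eq⟩
  exact ⟨a', Finsupp.supported_mono (fun _ _ _ => trivial) ha', b',
    Finsupp.supported_mono (fun _ _ _ => trivial) hb', h⟩

end Singular

/-! ### Cells of `Γ`-CW complexes -/

section GammaCW

set_option linter.unusedSectionVars false

open Topology Topology.RelCWComplex

variable (Γ : Type u) [Group Γ] (X : Type u) [TopologicalSpace X] [MulAction Γ X] [T2Space X]
  [ContinuousConstSMul Γ X] [GammaCW Γ X]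

/-- The `n`-cells of a `Γ`-CW complex. -/
abbrev GCell (n : ℕ) := cell (Set.univ : Set X) n

variable {Γ X}

/-- The open cell of dimension `n` with index `e`. -/
abbrev oCell {n : ℕ} (e : GCell Γ X n) : Set X := openCell n e

variable (Γ X) in
/-- The union of the cells of dimension less than `n`. -/
def sk (n : ℕ) : Set X := (skeletonLT (Set.univ : Set X) (n : ℕ∞) : Set X)

theorem exists_mem_oCell (x : X) : ∃ (n : ℕ) (e : GCell Γ X n), x ∈ oCell e := by
  have := CWComplex.iUnion_openCell_eq_complex (C := (Set.univ : Set X))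
  have hx : x ∈ ⋃ (n : ℕ) (j : cell (Set.univ : Set X) n), openCell n j := by
    rw [this]
    trivial
  simpa using hx

theorem eq_of_mem_oCell {n : ℕ} {e e' : GCell Γ X n} {x : X} (h : x ∈ oCell e)
    (h' : x ∈ oCell e') : e = e' := by
  have := eq_of_not_disjoint_openCell (C := (Set.univ : Set X))
    (Set.not_disjoint_iff.2 ⟨x, h, h'⟩)
  simpa using this

theorem dim_eq_of_mem_oCell {n m : ℕ} {e : GCell Γ X n} {e' : GCell Γ X m} {x : X} (h : x ∈ oCell e)
    (h' : x ∈ oCell e') : n = m := by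
  have := eq_of_not_disjoint_openCell (C := (Set.univ : Set X))
    (Set.not_disjoint_iff.2 ⟨x, h, h'⟩)
  exact congrArg Sigma.fst this

theorem mem_sk_iff {n : ℕ} {x : X} :
    x ∈ sk Γ X n ↔ ∃ (m : ℕ) (_ : m < n) (e : GCell Γ X m), x ∈ oCell e := by
  have := CWComplex.mem_skeletonLT_iff (C := (Set.univ : Set X)) (n := n) (x := x)
  change x ∈ skeletonLT (Set.univ : Set X) (n : ℕ∞) ↔ _
  simpa using this

theorem isClosed_sk (n : ℕ) : IsClosed (sk Γ X n) :=
  (skeletonLT (Set.univ : Set X) (n : ℕ∞)).closed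

theorem sk_mono : Monotone (sk Γ X) := fun n m h x hx => by
  rw [mem_sk_iff] at hx ⊢
  obtain ⟨k, hk, e, he⟩ := hx
  exact ⟨k, hk.trans_le h, e, he⟩

theorem notMem_sk {n m : ℕ} {e : GCell Γ X m} {x : X} (h : x ∈ oCell e) (hnm : n ≤ m) :
    x ∉ sk Γ X n := fun hx => by
  obtain ⟨k, hk, e', he'⟩ := mem_sk_iff.1 hx
  have := dim_eq_of_mem_oCell h he'
  omega

theorem exists_mem_oCell_of_mem_sk_succ {n : ℕ} {x : X} (h : x ∈ sk Γ X (n + 1))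
    (h' : x ∉ sk Γ X n) : ∃ e : GCell Γ X n, x ∈ oCell e := by
  obtain ⟨k, hk, e, he⟩ := mem_sk_iff.1 h
  have : k = n := by
    by_contra hne
    exact h' (mem_sk_iff.2 ⟨k, by omega, e, he⟩)
  subst this
  exact ⟨e, he⟩

theorem oCell_subset_sk {n m : ℕ} (e : GCell Γ X n) (h : n < m) : oCell e ⊆ sk Γ X m :=
  fun _ hx => mem_sk_iff.2 ⟨n, h, e, hx⟩

theorem exists_smul_mem_oCell (g : Γ) {n : ℕ} (e : GCell Γ X n) :
    ∃ e' : GCell Γ X n, (fun x => g • x) '' oCell e = oCell e' :=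
  GammaCW.exists_image_openCell g n e

theorem image_oCell_eq {g : Γ} {n : ℕ} {e e' : GCell Γ X n} {x : X} (h : x ∈ oCell e)
    (h' : g • x ∈ oCell e') : (fun x => g • x) '' oCell e = oCell e' := by
  obtain ⟨e'', he⟩ := exists_smul_mem_oCell g e
  rw [he, eq_of_mem_oCell (he ▸ ⟨x, h, rfl⟩ : g • x ∈ oCell e'') h']

/-- A group element that maps a point of an open cell into this cell fixes the cell pointwise. -/
theorem smul_eq_of_mem_oCell {g : Γ} {n : ℕ} {e : GCell Γ X n} {x : X} (h : x ∈ oCell e)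
    (h' : g • x ∈ oCell e) {y : X} (hy : y ∈ oCell e) : g • y = y :=
  GammaCW.smul_eq_of_image_openCell_eq g n e (image_oCell_eq h h') y hy

theorem smul_mem_sk_iff (g : Γ) {n : ℕ} {x : X} : g • x ∈ sk Γ X n ↔ x ∈ sk Γ X n := by
  have key : ∀ (g : Γ) (x : X), x ∈ sk Γ X n → g • x ∈ sk Γ X n := fun g x hx => by
    obtain ⟨k, hk, e, he⟩ := mem_sk_iff.1 hx
    obtain ⟨e', he'⟩ := exists_smul_mem_oCell g e
    exact mem_sk_iff.2 ⟨k, hk, e', he' ▸ ⟨x, he, rfl⟩⟩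
  exact ⟨fun h => by simpa using key g⁻¹ _ h, key g x⟩

/-- A set is closed if its intersection with each cell is closed, where the open or the closed cell
can be taken. -/
theorem isClosed_of_cells {A : Set X}
    (h : ∀ n (e : GCell Γ X n), IsClosed (A ∩ oCell e) ∨ IsClosed (A ∩ closedCell n e)) :
    IsClosed A :=
  CWComplex.isClosed_of_isClosed_inter_openCell_or_isClosed_inter_closedCell
    (C := (Set.univ : Set X)) (Set.subset_univ _) fun n _ e => h n e

theorem closedCell_subset_sk {n : ℕ} (e : GCell Γ X n) :
    closedCell n e ⊆ sk Γ X n ∪ oCell e := by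
  rw [← cellFrontier_union_openCell_eq_closedCell]
  exact Set.union_subset_union_left _ (cellFrontier_subset_skeletonLT n e)

/-! ### The orbits of an open cell -/

/-- The complement in the `n`-skeleton of a single open `n`-cell is closed. -/
theorem isClosed_sk_diff {n : ℕ} (e : GCell Γ X n) : IsClosed (sk Γ X (n + 1) \ oCell e) := by
  refine isClosed_of_cells (Γ := Γ) fun m e' => ?_
  rcases lt_trichotomy m n with h | h | h
  · right
    rw [Set.inter_eq_right.2]
    · exact isClosed_closedCell
    · intro x hx
      have hx' : x ∈ sk Γ X n := by
        rcases closedCell_subset_sk e' hx with h' | h'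
        · exact sk_mono h.le h'
        · exact oCell_subset_sk e' h h'
      exact ⟨sk_mono (Nat.le_succ n) hx', fun h' => notMem_sk h' le_rfl hx'⟩
  · subst h
    by_cases he : e' = e
    · left
      rw [he, Set.sdiff_inter_self]
      exact isClosed_empty
    · right
      rw [Set.inter_eq_right.2]
      · exact isClosed_closedCell
      · intro x hx
        rcases closedCell_subset_sk e' hx with h' | h'
        · exact ⟨sk_mono (Nat.le_succ m) h', fun h'' => notMem_sk h'' le_rfl h'⟩
        · exact ⟨oCell_subset_sk e' (Nat.lt_succ_self m) h',
            fun h'' => he (eq_of_mem_oCell h' h'')⟩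
  · left
    rw [Set.disjoint_iff_inter_eq_empty.1]
    · exact isClosed_empty
    · exact Set.disjoint_left.2 fun x hx hx' => notMem_sk hx' h hx.1

/-- An open set that meets the `n`-skeleton in exactly one open `n`-cell. -/
theorem exists_isOpen_inter_sk {n : ℕ} (e : GCell Γ X n) :
    ∃ O : Set X, IsOpen O ∧ ∀ x ∈ sk Γ X (n + 1), x ∈ O ↔ x ∈ oCell e :=
  ⟨_, (isClosed_sk_diff e).isOpen_compl, fun x hx => by simp [hx]⟩

theorem proj_mem_image_sk_iff {n : ℕ} {x : X} :
    proj Γ x ∈ (proj Γ '' sk Γ X n) ↔ x ∈ sk Γ X n := by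
  refine ⟨?_, fun h => ⟨x, h, rfl⟩⟩
  rintro ⟨y, hy, hyx⟩
  obtain ⟨g, rfl⟩ := proj_eq_iff.1 hyx
  exact (smul_mem_sk_iff g).1 hy

/-- A singular simplex with image in the union of the open `n`-cells has image in one of them. -/
theorem exists_forall_mem_oCell {n k : ℕ} (σ : C(Splx k, X))
    (hσ : ∀ y, σ y ∈ sk Γ X (n + 1) \ sk Γ X n) (y₀ : Splx k) {e : GCell Γ X n}
    (he : σ y₀ ∈ oCell e) (y : Splx k) : σ y ∈ oCell e := by
  have hopen : ∀ e' : GCell Γ X n, IsOpen (σ ⁻¹' oCell e') := fun e' => by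
    obtain ⟨O, hO, h⟩ := exists_isOpen_inter_sk e'
    have : σ ⁻¹' oCell e' = σ ⁻¹' O := Set.ext fun y => (h _ (hσ y).1).symm
    rw [this]
    exact hO.preimage σ.continuous
  -- the open `n`-cells are disjoint and relatively open in their union, hence relatively closed
  have hclosed : IsClosed (σ ⁻¹' oCell e) := by
    have : (σ ⁻¹' oCell e)ᶜ = ⋃ (e' : GCell Γ X n) (_ : e' ≠ e), σ ⁻¹' oCell e' := by
      ext y
      simp only [Set.mem_compl_iff, Set.mem_preimage, Set.mem_iUnion, exists_prop]
      constructor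
      · intro hy
        obtain ⟨e', he'⟩ := exists_mem_oCell_of_mem_sk_succ (hσ y).1 (hσ y).2
        exact ⟨e', fun h => hy (h ▸ he'), he'⟩
      · rintro ⟨e', hne, he'⟩ hy
        exact hne (eq_of_mem_oCell he' hy)
    rw [← isOpen_compl_iff, this]
    exact isOpen_iUnion fun e' => isOpen_iUnion fun _ => hopen e'
  have := IsClopen.eq_univ ⟨hclosed, hopen e⟩ ⟨y₀, he⟩
  have hy : y ∈ σ ⁻¹' oCell e := by
    rw [this]
    trivial
  exact hy

/-- Over the open `n`-cells, singular simplices of the orbit space have lifts, and these are unique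
up to the group action: the open cells are mapped homeomorphically to the orbit space. -/
theorem AcyclicOver.of_subset_cells {n : ℕ} {W : Set (Orb Γ X)}
    (hW : W ⊆ proj Γ '' (sk Γ X (n + 1) \ sk Γ X n)) : AcyclicOver Γ X W := by
  have hmem : ∀ x : X, proj Γ x ∈ W → x ∈ sk Γ X (n + 1) \ sk Γ X n := fun x hx => by
    obtain ⟨y, hy, hyx⟩ := hW hx
    obtain ⟨g, rfl⟩ := proj_eq_iff.1 hyx
    exact ⟨(smul_mem_sk_iff g).1 hy.1, fun h => hy.2 ((smul_mem_sk_iff g).2 h)⟩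
  have hp := isOpenQuotientMap_proj Γ X
  have inj : ∀ {e : GCell Γ X n} {x y : X}, x ∈ oCell e → y ∈ oCell e → proj Γ x = proj Γ y →
      x = y := by
    intro e x y hx hy h
    obtain ⟨g, rfl⟩ := proj_eq_iff.1 h
    exact smul_eq_of_mem_oCell hy hx hy
  refine AcyclicOver.of_lift Γ (fun k τ hτ => ?_) (fun k σ σ' hσ h => ?_)
  · -- the image of `τ` is contained in the image of a single open cell
    choose O hO hOe using fun e : GCell Γ X n => exists_isOpen_inter_sk e
    have himg : ∀ (e : GCell Γ X n) (y : Splx k), τ y ∈ proj Γ '' O e ↔ τ y ∈ proj Γ '' oCell e := by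
      intro e y
      constructor
      · rintro ⟨x, hx, hxy⟩
        exact ⟨x, (hOe e x (hmem x (hxy ▸ hτ y)).1).1 hx, hxy⟩
      · rintro ⟨x, hx, hxy⟩
        exact ⟨x, (hOe e x (hmem x (hxy ▸ hτ y)).1).2 hx, hxy⟩
    have hopen : ∀ e : GCell Γ X n, IsOpen (τ ⁻¹' (proj Γ '' oCell e)) := fun e => by
      have : τ ⁻¹' (proj Γ '' oCell e) = τ ⁻¹' (proj Γ '' O e) :=
        Set.ext fun y => (himg e y).symm
      rw [this]
      exact (hp.isOpenMap _ (hO e)).preimage τ.continuous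
    have hcov : ∀ y, ∃ e : GCell Γ X n, τ y ∈ proj Γ '' oCell e := fun y => by
      obtain ⟨x, hx⟩ := hp.surjective (τ y)
      have := hmem x (hx ▸ hτ y)
      obtain ⟨e, he⟩ := exists_mem_oCell_of_mem_sk_succ this.1 this.2
      exact ⟨e, x, he, hx⟩
    have heq : ∀ (e e' : GCell Γ X n) (z : Orb Γ X), z ∈ proj Γ '' oCell e →
        z ∈ proj Γ '' oCell e' → proj Γ '' oCell e = proj Γ '' oCell e' := by
      rintro e e' _ ⟨x, hx, rfl⟩ ⟨y, hy, hxy⟩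
      obtain ⟨g, rfl⟩ := proj_eq_iff.1 hxy
      rw [← image_oCell_eq hx hy, Set.image_image]
      simp
    obtain ⟨e, he⟩ := hcov (stdSimplex.vertex 0)
    have hclopen : IsClopen (τ ⁻¹' (proj Γ '' oCell e)) := by
      refine ⟨?_, hopen e⟩
      have : (τ ⁻¹' (proj Γ '' oCell e))ᶜ =
          ⋃ (e' : GCell Γ X n) (_ : proj Γ '' oCell e' ≠ proj Γ '' oCell e),
            τ ⁻¹' (proj Γ '' oCell e') := by
        ext y
        simp only [Set.mem_compl_iff, Set.mem_iUnion, exists_prop]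
        constructor
        · intro hy
          obtain ⟨e', he'⟩ := hcov y
          exact ⟨e', fun h => hy (by rw [Set.mem_preimage, ← h]; exact he'), he'⟩
        · rintro ⟨e', hne, he'⟩ hy
          exact hne (heq e' e _ he' hy)
      rw [← isOpen_compl_iff, this]
      exact isOpen_iUnion fun e' => isOpen_iUnion fun _ => hopen e'
    have hall : ∀ y, τ y ∈ proj Γ '' oCell e := fun y => by
      have := IsClopen.eq_univ hclopen ⟨_, he⟩
      have hy : y ∈ τ ⁻¹' (proj Γ '' oCell e) := by
        rw [this]
        trivial
      exact hy
    -- the pointwise lift to the cell `e` is unique, and it is continuous because the projection is open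
    choose l hl hlτ using hall
    refine ⟨⟨l, continuous_def.2 fun U hU => ?_⟩, ContinuousMap.ext hlτ⟩
    have : l ⁻¹' U = τ ⁻¹' (proj Γ '' (U ∩ O e)) := by
      ext y
      constructor
      · intro hy
        exact ⟨l y, ⟨hy, (hOe e _ (hmem _ (by rw [hlτ]; exact hτ y)).1).2 (hl y)⟩, hlτ y⟩
      · rintro ⟨x, ⟨hxU, hxO⟩, hx⟩
        have hxe := (hOe e x (hmem x (hx ▸ hτ y)).1).1 hxO
        have : x = l y := inj hxe (hl y) (hx.trans (hlτ y).symm)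
        change l y ∈ U
        rw [← this]
        exact hxU
    rw [this]
    exact (hp.isOpenMap _ (hU.inter (hO e))).preimage τ.continuous
  · have h' : ∀ y, proj Γ (σ y) = proj Γ (σ' y) := fun y => DFunLike.congr_fun h y
    -- translate one lift such that both agree at a vertex; then both lie in the same open cell, on
    -- which the projection is injective
    let y₀ : Splx k := stdSimplex.vertex 0
    obtain ⟨g, hg⟩ := proj_eq_iff.1 (h' y₀)
    refine ⟨g, ContinuousMap.ext fun y => ?_⟩
    obtain ⟨e, he⟩ := exists_mem_oCell_of_mem_sk_succ (hmem _ (hσ y₀)).1 (hmem _ (hσ y₀)).2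
    refine inj (e := e) (exists_forall_mem_oCell (g • σ') (fun y => hmem _ ?_) y₀ ?_ y)
      (exists_forall_mem_oCell σ (fun y => hmem _ (hσ y)) y₀ he y) ?_
    · change proj Γ (g • σ' y) ∈ W
      rw [proj_smul, ← h']
      exact hσ y
    · change g • σ' y₀ ∈ _
      rw [hg]
      exact he
    · change proj Γ (g • σ' y) = _
      rw [proj_smul, h']

/-! ### Compact subsets of the orbit space -/

/-- A compact subset of the orbit space of a `Γ`-CW complex is contained in the image of a
skeleton. -/
theorem exists_subset_image_sk {K : Set (Orb Γ X)} (hK : IsCompact K) :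
    ∃ n, K ⊆ proj Γ '' sk Γ X n := by
  by_contra! hcon
  have : ∀ n, ∃ b ∈ K, b ∉ proj Γ '' sk Γ X n := fun n => Set.not_subset.1 (hcon n)
  choose b hbK hb using this
  -- a sequence of points of `K` that leaves all skeleta has closed tails with empty intersection
  let Z : ℕ → Set (Orb Γ X) := fun N => b '' Set.Ici N
  have hclosed : ∀ N, IsClosed (Z N) := fun N => by
    rw [← (isOpenQuotientMap_proj Γ X).isQuotientMap.isClosed_preimage]
    refine isClosed_of_cells (Γ := Γ) fun m e => Or.inl ?_
    -- an open `m`-cell contains at most one point over each `b n`, and none for `m < n`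
    have hsub : (proj Γ ⁻¹' Z N ∩ oCell e).Finite := by
      refine Set.Finite.of_finite_image (f := proj Γ) (((Set.finite_Iic m).image b).subset ?_) ?_
      · rintro _ ⟨x, ⟨⟨n, -, hn⟩, hx⟩, rfl⟩
        refine ⟨n, ?_, hn⟩
        by_contra hnm
        refine hb n ⟨x, oCell_subset_sk e ?_ hx, hn.symm⟩
        simpa using hnm
      · rintro x ⟨-, hx⟩ y ⟨-, hy⟩ h
        obtain ⟨g, rfl⟩ := proj_eq_iff.1 h
        exact smul_eq_of_mem_oCell hy hx hy
    exact hsub.isClosed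
  have hne : (⋂ N, Z N).Nonempty := by
    refine IsCompact.nonempty_iInter_of_sequence_nonempty_isCompact_isClosed Z (fun N => ?_)
      (fun N => ⟨b N, N, Set.mem_Ici.2 le_rfl, rfl⟩) ?_ hclosed
    · exact Set.image_mono (Set.Ici_subset_Ici.2 (Nat.le_succ N))
    · exact hK.of_isClosed_subset (hclosed 0) (by rintro _ ⟨n, -, rfl⟩; exact hbK n)
  obtain ⟨z, hz⟩ := hne
  obtain ⟨x, rfl⟩ := (isOpenQuotientMap_proj Γ X).surjective z
  obtain ⟨m, e, he⟩ := exists_mem_oCell (Γ := Γ) x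
  obtain ⟨n, hn, hx⟩ := Set.mem_iInter.1 hz (m + 1)
  exact hb n (hx ▸ ⟨x, oCell_subset_sk e (Nat.lt_of_succ_le hn) he, rfl⟩)

end GammaCW

/-! ### Equivariant characteristic maps -/

section Charts

set_option linter.unusedSectionVars false

open Topology Topology.RelCWComplex Metric

variable {Γ : Type u} [Group Γ] {X : Type u} [TopologicalSpace X] [MulAction Γ X] [T2Space X]
  [ContinuousConstSMul Γ X] [GammaCW Γ X] {n : ℕ}

variable (Γ X n) in
/-- Two cells are equivalent if an element of `Γ` maps the first to the second one. -/
def cellSetoid : Setoid (GCell Γ X n) where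
  r e e' := ∃ g : Γ, (fun x => g • x) '' oCell e = oCell e'
  iseqv :=
    { refl := fun e => ⟨1, by simp⟩
      symm := by
        rintro e e' ⟨g, h⟩
        refine ⟨g⁻¹, ?_⟩
        rw [← h, Set.image_image]
        simp
      trans := by
        rintro e e' e'' ⟨g, h⟩ ⟨g', h'⟩
        refine ⟨g' * g, ?_⟩
        rw [← h', ← h, Set.image_image]
        simp [mul_smul] }

/-- The chosen representative of the orbit of a cell. -/
noncomputable def cellRep (e : GCell Γ X n) : GCell Γ X n :=
  (Quotient.mk (cellSetoid Γ X n) e).out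

theorem exists_image_cellRep (e : GCell Γ X n) :
    ∃ g : Γ, (fun x => g • x) '' oCell (cellRep e) = oCell e :=
  Quotient.exact (s := cellSetoid Γ X n) (Quotient.out_eq (Quotient.mk (cellSetoid Γ X n) e))

/-- A characteristic map for the cell `e`, obtained by translation from the one of the
representative of its orbit, so that these maps are permuted by `Γ`. -/
noncomputable def chart (e : GCell Γ X n) (v : Fin n → ℝ) : X :=
  (exists_image_cellRep e).choose • map (C := (Set.univ : Set X)) n (cellRep e) v

theorem continuousOn_chart (e : GCell Γ X n) : ContinuousOn (chart e) (closedBall 0 1) :=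
  (continuousOn (C := (Set.univ : Set X)) n (cellRep e)).const_smul _

theorem chart_image_ball (e : GCell Γ X n) : chart e '' ball 0 1 = oCell e := by
  rw [← (exists_image_cellRep e).choose_spec]
  change _ = _ '' (_ '' _)
  rw [Set.image_image]
  rfl

theorem chart_mem_oCell (e : GCell Γ X n) {v : Fin n → ℝ} (hv : v ∈ ball (0 : Fin n → ℝ) 1) :
    chart e v ∈ oCell e :=
  chart_image_ball e ▸ ⟨v, hv, rfl⟩

theorem injOn_chart (e : GCell Γ X n) : Set.InjOn (chart e) (ball 0 1) := fun v hv w hw h => by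
  have := (map (C := (Set.univ : Set X)) n (cellRep e)).injOn
  rw [source_eq] at this
  exact this hv hw (MulAction.injective _ h)

theorem chart_mem_sk (e : GCell Γ X n) {v : Fin n → ℝ} (hv : ‖v‖ = 1) : chart e v ∈ sk Γ X n := by
  refine (smul_mem_sk_iff _).2 (cellFrontier_subset_skeletonLT n (cellRep e) ⟨v, ?_, rfl⟩)
  simpa using hv

theorem chart_image_closedBall (e : GCell Γ X n) : chart e '' closedBall 0 1 = closedCell n e := by
  have hc : IsCompact (chart e '' closedBall 0 1) :=
    (isCompact_closedBall 0 1).image_of_continuousOn (continuousOn_chart e)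
  refine Set.Subset.antisymm ?_ ?_
  · rw [← closure_openCell_eq_closedCell]
    change _ ⊆ closure (oCell e)
    rw [← chart_image_ball e]
    refine ContinuousOn.image_closure (f := chart e) (s := ball 0 1) ?_ |>.trans' ?_
    · rw [closure_ball _ one_ne_zero]
      exact continuousOn_chart e
    · rw [closure_ball _ one_ne_zero]
  · rw [← closure_openCell_eq_closedCell]
    refine closure_minimal ?_ hc.isClosed
    change oCell e ⊆ _
    rw [← chart_image_ball e]
    exact Set.image_mono ball_subset_closedBall

/-- The charts are equivariant: an element of `Γ` that maps an open cell to itself fixes it, so that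
the choice of the translating elements does not matter. -/
theorem smul_chart {g : Γ} {e e' : GCell Γ X n} (h : (fun x => g • x) '' oCell e = oCell e')
    {v : Fin n → ℝ} (hv : v ∈ closedBall (0 : Fin n → ℝ) 1) : g • chart e v = chart e' v := by
  have hrep : cellRep e = cellRep e' :=
    congrArg Quotient.out (Quotient.sound (s := cellSetoid Γ X n) ⟨g, h⟩)
  have hb : Set.EqOn (fun v => g • chart e v) (chart e') (ball 0 1) := fun v hv => by
    have h₁ := (exists_image_cellRep e).choose_spec
    have h₂ := (exists_image_cellRep e').choose_spec
    dsimp only [chart]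
    generalize (exists_image_cellRep e).choose = a at *
    generalize (exists_image_cellRep e').choose = b at *
    rw [← hrep] at h₂ ⊢
    have hm : map (C := (Set.univ : Set X)) n (cellRep e) v ∈ oCell (cellRep e) := ⟨v, hv, rfl⟩
    have hab : (b⁻¹ * g * a) • map (C := (Set.univ : Set X)) n (cellRep e) v ∈ oCell (cellRep e) := by
      have : g • a • map (C := (Set.univ : Set X)) n (cellRep e) v ∈ oCell e' := by
        rw [← h, ← h₁]
        exact ⟨_, ⟨_, hm, rfl⟩, rfl⟩
      rw [← h₂] at this
      obtain ⟨y, hy, hyx⟩ := this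
      rw [mul_smul, mul_smul, ← hyx]
      simpa using hy
    have := smul_eq_of_mem_oCell hm hab hm
    rw [mul_smul, mul_smul, inv_smul_eq_iff] at this
    exact this
  -- the equality extends from the open to the closed ball by continuity
  refine Set.EqOn.of_subset_closure hb ((continuousOn_chart e).const_smul g)
    (continuousOn_chart e') ball_subset_closedBall ?_ hv
  rw [closure_ball _ one_ne_zero]

/-! ### Pushing the complement of the centres of the cells to the boundary -/

/-- The radial expansion by the factor `1 + t`, cut off at the unit sphere. -/
noncomputable def clamp (t : unitInterval) (v : Fin n → ℝ) : Fin n → ℝ :=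
  (max 1 ((1 + (t : ℝ)) * ‖v‖))⁻¹ • ((1 + (t : ℝ)) • v)

theorem continuous_clamp :
    Continuous fun z : unitInterval × (Fin n → ℝ) => clamp z.1 z.2 := by
  have h : Continuous fun z : unitInterval × (Fin n → ℝ) => 1 + (z.1 : ℝ) :=
    continuous_const.add (continuous_subtype_val.comp continuous_fst)
  refine Continuous.smul (Continuous.inv₀ (continuous_const.max
    (h.mul continuous_snd.norm)) fun z => ?_) (h.smul continuous_snd)
  exact (lt_of_lt_of_le one_pos (le_max_left _ _)).ne'

theorem norm_clamp (t : unitInterval) (v : Fin n → ℝ) :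
    ‖clamp t v‖ = (max 1 ((1 + (t : ℝ)) * ‖v‖))⁻¹ * ((1 + (t : ℝ)) * ‖v‖) := by
  have ht : 0 ≤ (1 + (t : ℝ)) := add_nonneg zero_le_one t.2.1
  have hm : 0 < max 1 ((1 + (t : ℝ)) * ‖v‖) := lt_of_lt_of_le one_pos (le_max_left _ _)
  rw [clamp, norm_smul, norm_smul, Real.norm_of_nonneg ht, norm_inv, Real.norm_of_nonneg hm.le]

theorem clamp_mem (t : unitInterval) (v : Fin n → ℝ) : clamp t v ∈ closedBall (0 : Fin n → ℝ) 1 := by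
  have hm : 0 < max 1 ((1 + (t : ℝ)) * ‖v‖) := lt_of_lt_of_le one_pos (le_max_left _ _)
  rw [mem_closedBall_zero_iff, norm_clamp, inv_mul_le_one₀ hm]
  exact le_max_right _ _

theorem clamp_zero {v : Fin n → ℝ} (hv : v ∈ closedBall (0 : Fin n → ℝ) 1) : clamp 0 v = v := by
  rw [mem_closedBall_zero_iff] at hv
  simp [clamp, hv]

theorem clamp_of_norm_eq_one (t : unitInterval) {v : Fin n → ℝ} (hv : ‖v‖ = 1) : clamp t v = v := by
  have ht : (1 : ℝ) ≤ 1 + (t : ℝ) := le_add_of_nonneg_right t.2.1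
  rw [clamp, hv, mul_one, max_eq_right ht, smul_smul, inv_mul_cancel₀ (by positivity), one_smul]

theorem norm_clamp_eq_one {t : unitInterval} {v : Fin n → ℝ} (h : 1 ≤ (1 + (t : ℝ)) * ‖v‖) :
    ‖clamp t v‖ = 1 := by
  rw [norm_clamp, max_eq_right h, inv_mul_cancel₀ (by positivity)]

theorem half_lt_norm_clamp (t : unitInterval) {v : Fin n → ℝ} (h : 1 / 2 < ‖v‖) :
    1 / 2 < ‖clamp t v‖ := by
  by_cases h1 : 1 ≤ (1 + (t : ℝ)) * ‖v‖
  · rw [norm_clamp_eq_one h1]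
    norm_num
  · rw [norm_clamp, max_eq_left (not_le.1 h1).le, inv_one, one_mul]
    nlinarith [t.2.1]

variable (Γ X n) in
open Classical in
/-- The homotopy that expands the open `n`-cells radially and fixes all other points. -/
noncomputable def cellHtpy (t : unitInterval) (x : X) : X :=
  if h : ∃ p : GCell Γ X n × (Fin n → ℝ), p.2 ∈ ball (0 : Fin n → ℝ) 1 ∧ chart p.1 p.2 = x
  then chart h.choose.1 (clamp t h.choose.2) else x

theorem cellHtpy_chart_of_mem_ball (t : unitInterval) (e : GCell Γ X n) {v : Fin n → ℝ}
    (hv : v ∈ ball (0 : Fin n → ℝ) 1) :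
    cellHtpy Γ X n t (chart e v) = chart e (clamp t v) := by
  have h : ∃ p : GCell Γ X n × (Fin n → ℝ), p.2 ∈ ball (0 : Fin n → ℝ) 1 ∧
    chart p.1 p.2 = chart e v := ⟨(e, v), hv, rfl⟩
  rw [cellHtpy, dif_pos h]
  obtain ⟨h₁, h₂⟩ := h.choose_spec
  have he : h.choose.1 = e :=
    eq_of_mem_oCell (chart_mem_oCell _ h₁) (by rw [h₂]; exact chart_mem_oCell e hv)
  generalize h.choose = p at *
  obtain ⟨e', w⟩ := p
  dsimp only at he h₁ h₂ ⊢
  subst he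
  rw [injOn_chart _ h₁ hv h₂]

theorem cellHtpy_of_forall_notMem (t : unitInterval) {x : X} (h : ∀ e : GCell Γ X n, x ∉ oCell e) :
    cellHtpy Γ X n t x = x := by
  refine dif_neg ?_
  rintro ⟨p, hp, rfl⟩
  exact h _ (chart_mem_oCell p.1 hp)

theorem cellHtpy_of_mem_sk (t : unitInterval) {x : X} (h : x ∈ sk Γ X n) :
    cellHtpy Γ X n t x = x :=
  cellHtpy_of_forall_notMem t fun _ he => notMem_sk he le_rfl h

theorem cellHtpy_chart (t : unitInterval) (e : GCell Γ X n) {v : Fin n → ℝ}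
    (hv : v ∈ closedBall (0 : Fin n → ℝ) 1) :
    cellHtpy Γ X n t (chart e v) = chart e (clamp t v) := by
  rcases (mem_closedBall_zero_iff.1 hv).lt_or_eq with h | h
  · exact cellHtpy_chart_of_mem_ball t e (mem_ball_zero_iff.2 h)
  · rw [clamp_of_norm_eq_one t h, cellHtpy_of_mem_sk t (chart_mem_sk e h)]

theorem exists_chart_eq {e : GCell Γ X n} {x : X} (hx : x ∈ oCell e) :
    ∃ v ∈ ball (0 : Fin n → ℝ) 1, chart e v = x := by
  rwa [← chart_image_ball e] at hx

theorem cellHtpy_smul (t : unitInterval) (g : Γ) (x : X) :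
    cellHtpy Γ X n t (g • x) = g • cellHtpy Γ X n t x := by
  by_cases h : ∃ e : GCell Γ X n, x ∈ oCell e
  · obtain ⟨e, he⟩ := h
    obtain ⟨v, hv, rfl⟩ := exists_chart_eq he
    obtain ⟨e', he'⟩ := exists_smul_mem_oCell g e
    have hv' := ball_subset_closedBall hv
    rw [smul_chart he' hv', cellHtpy_chart t e' hv', cellHtpy_chart t e hv',
      smul_chart he' (clamp_mem t v)]
  · push Not at h
    rw [cellHtpy_of_forall_notMem t h, cellHtpy_of_forall_notMem t]
    intro e he
    obtain ⟨e', he'⟩ := exists_smul_mem_oCell g⁻¹ e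
    exact h e' (he' ▸ ⟨_, he, by simp⟩)

theorem cellHtpy_zero (x : X) : cellHtpy Γ X n 0 x = x := by
  by_cases h : ∃ e : GCell Γ X n, x ∈ oCell e
  · obtain ⟨e, he⟩ := h
    obtain ⟨v, hv, rfl⟩ := exists_chart_eq he
    have hv' := ball_subset_closedBall hv
    rw [cellHtpy_chart 0 e hv', clamp_zero hv']
  · push Not at h
    exact cellHtpy_of_forall_notMem 0 h

/-- The homotopy is continuous on the `n`-skeleton.  As the unit interval is compact, this can be
checked on the adjoint map to the space of paths, and there cell by cell. -/
theorem continuousOn_cellHtpy : ContinuousOn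
    (fun z : unitInterval × X => cellHtpy Γ X n z.1 z.2) (Set.univ ×ˢ sk Γ X (n + 1)) := by
  have hcell : ∀ e : GCell Γ X n, Continuous
      fun z : closedBall (0 : Fin n → ℝ) 1 × unitInterval => chart e (clamp z.2 z.1) := fun e =>
    (continuousOn_chart e).comp_continuous
      (continuous_clamp.comp (continuous_snd.prodMk (continuous_subtype_val.comp continuous_fst)))
      fun z => clamp_mem _ _
  have hpath : ∀ x ∈ sk Γ X (n + 1), Continuous fun t => cellHtpy Γ X n t x := by
    intro x hx
    by_cases h : x ∈ sk Γ X n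
    · simp only [cellHtpy_of_mem_sk _ h]
      exact continuous_const
    · obtain ⟨e, he⟩ := exists_mem_oCell_of_mem_sk_succ hx h
      obtain ⟨v, hv, rfl⟩ := exists_chart_eq he
      have hv' := ball_subset_closedBall hv
      simp only [cellHtpy_chart _ e hv']
      exact (hcell e).comp (Continuous.prodMk continuous_const continuous_id :
        Continuous fun t : unitInterval => ((⟨v, hv'⟩ : closedBall (0 : Fin n → ℝ) 1), t))
  -- the adjoint map to the space of paths
  let P : sk Γ X (n + 1) → C(unitInterval, X) := fun x => ⟨_, hpath x x.2⟩
  have hP : Continuous P := by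
    refine continuous_iff_isClosed.2 fun Z hZ => ?_
    have hcl : IsClosed ((↑) '' (P ⁻¹' Z) : Set X) := by
      refine isClosed_of_cells (Γ := Γ) fun m e => ?_
      rcases lt_trichotomy m n with h | h | h
      · right
        -- on the lower skeleton all paths are constant
        have hsub : closedCell m e ⊆ sk Γ X n := fun x hx => by
          rcases closedCell_subset_sk e hx with h' | h'
          · exact sk_mono h.le h'
          · exact oCell_subset_sk e h h'
        have : (↑) '' (P ⁻¹' Z) ∩ closedCell m e =
            (ContinuousMap.const unitInterval) ⁻¹' Z ∩ closedCell m e := by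
          ext x
          refine and_congr_left fun hx => ?_
          have hPx : ∀ hx' : x ∈ sk Γ X (n + 1), P ⟨x, hx'⟩ = ContinuousMap.const unitInterval x :=
            fun _ => ContinuousMap.ext fun t => cellHtpy_of_mem_sk t (hsub hx)
          constructor
          · rintro ⟨y, hy, rfl⟩
            change ContinuousMap.const unitInterval _ ∈ Z
            rw [← hPx y.2]
            exact hy
          · intro hy
            refine ⟨⟨x, sk_mono (Nat.le_succ n) (hsub hx)⟩, ?_, rfl⟩
            change P _ ∈ Z
            rw [hPx]
            exact hy
        rw [this]
        exact (hZ.preimage ContinuousMap.continuous_const').inter isClosed_closedCell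
      · subst h
        right
        -- on an `n`-cell the map is given in the chart by a continuous map on the compact ball
        let q : closedBall (0 : Fin m → ℝ) 1 → C(unitInterval, X) :=
          fun v => ContinuousMap.curry ⟨_, hcell e⟩ v
        have hq : Continuous q := (ContinuousMap.curry ⟨_, hcell e⟩).continuous
        have hsk : ∀ v : closedBall (0 : Fin m → ℝ) 1, chart e v ∈ sk Γ X (m + 1) := fun v => by
          rcases (mem_closedBall_zero_iff.1 v.2).lt_or_eq with h | h
          · exact oCell_subset_sk e (Nat.lt_succ_self m)
              (chart_mem_oCell e (mem_ball_zero_iff.2 h))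
          · exact sk_mono (Nat.le_succ m) (chart_mem_sk e h)
        have hPq : ∀ v : closedBall (0 : Fin m → ℝ) 1, P ⟨chart e v, hsk v⟩ = q v := fun v =>
          ContinuousMap.ext fun t => cellHtpy_chart t e v.2
        have : (↑) '' (P ⁻¹' Z) ∩ closedCell m e =
            (fun v : closedBall (0 : Fin m → ℝ) 1 => chart e v) '' (q ⁻¹' Z) := by
          rw [← chart_image_closedBall e]
          ext x
          constructor
          · rintro ⟨⟨y, hy, rfl⟩, v, hv, hvy⟩
            refine ⟨⟨v, hv⟩, ?_, hvy⟩
            change q _ ∈ Z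
            rw [← hPq]
            have : y = ⟨chart e v, hsk ⟨v, hv⟩⟩ := Subtype.ext hvy.symm
            rw [← this]
            exact hy
          · rintro ⟨v, hv, rfl⟩
            refine ⟨⟨⟨_, hsk v⟩, ?_, rfl⟩, v, v.2, rfl⟩
            change P _ ∈ Z
            rw [hPq]
            exact hv
        rw [this]
        have hcpt : CompactSpace (closedBall (0 : Fin m → ℝ) 1) :=
          isCompact_iff_compactSpace.1 (isCompact_closedBall 0 1)
        exact ((hZ.preimage hq).isCompact.image
          (continuousOn_iff_continuous_domRestrict.1 (continuousOn_chart e))).isClosed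
      · left
        rw [Set.disjoint_iff_inter_eq_empty.1]
        · exact isClosed_empty
        · refine Set.disjoint_left.2 ?_
          rintro _ ⟨y, -, rfl⟩ hy
          exact notMem_sk hy h y.2
    have := hcl.preimage (continuous_subtype_val (p := (· ∈ sk Γ X (n + 1))))
    rwa [Set.preimage_image_eq _ Subtype.val_injective] at this
  have hunc : Continuous fun z : unitInterval × sk Γ X (n + 1) => P z.2 z.1 :=
    continuous_eval.comp ((hP.comp continuous_snd).prodMk continuous_fst)
  rw [continuousOn_iff_continuous_domRestrict]
  exact hunc.comp (Continuous.prodMk (continuous_fst.comp continuous_subtype_val)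
    ((continuous_snd.comp continuous_subtype_val).subtype_mk fun z => z.2.2) :
      Continuous fun z : (Set.univ ×ˢ sk Γ X (n + 1) : Set (unitInterval × X)) =>
        (z.1.1, (⟨z.1.2, z.2.2⟩ : sk Γ X (n + 1))))

variable (Γ X n) in
/-- The points of radius at most one half in the open `n`-cells. -/
def innerCells : Set X := {x | ∃ (e : GCell Γ X n) (v : Fin n → ℝ), ‖v‖ ≤ 1 / 2 ∧ chart e v = x}

theorem mem_ball_of_norm_le_half {v : Fin n → ℝ} (hv : ‖v‖ ≤ 1 / 2) :
    v ∈ ball (0 : Fin n → ℝ) 1 :=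
  mem_ball_zero_iff.2 (hv.trans_lt (by norm_num))

theorem chart_mem_innerCells_iff (e : GCell Γ X n) {v : Fin n → ℝ}
    (hv : v ∈ closedBall (0 : Fin n → ℝ) 1) : chart e v ∈ innerCells Γ X n ↔ ‖v‖ ≤ 1 / 2 := by
  refine ⟨?_, fun h => ⟨e, v, h, rfl⟩⟩
  rintro ⟨e', w, hw, h⟩
  have hw' := mem_ball_of_norm_le_half hw
  rcases (mem_closedBall_zero_iff.1 hv).lt_or_eq with h1 | h1
  · have h1' : v ∈ ball (0 : Fin n → ℝ) 1 := mem_ball_zero_iff.2 h1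
    obtain rfl := eq_of_mem_oCell (chart_mem_oCell e' hw') (h ▸ chart_mem_oCell e h1')
    rwa [← injOn_chart _ hw' h1' h]
  · exact absurd (chart_mem_sk e h1) (h ▸ notMem_sk (chart_mem_oCell e' hw') le_rfl)

theorem notMem_innerCells {x : X} (hx : x ∈ sk Γ X n) : x ∉ innerCells Γ X n := by
  rintro ⟨e, v, hv, rfl⟩
  exact notMem_sk (chart_mem_oCell e (mem_ball_of_norm_le_half hv)) le_rfl hx

theorem smul_mem_innerCells (g : Γ) {x : X} (hx : x ∈ innerCells Γ X n) :
    g • x ∈ innerCells Γ X n := by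
  obtain ⟨e, v, hv, rfl⟩ := hx
  obtain ⟨e', he'⟩ := exists_smul_mem_oCell g e
  exact ⟨e', v, hv, (smul_chart he' (ball_subset_closedBall (mem_ball_of_norm_le_half hv))).symm⟩

theorem isClosed_innerCells : IsClosed (innerCells Γ X n) := by
  refine isClosed_of_cells (Γ := Γ) fun m e => Or.inl ?_
  by_cases h : m = n
  · subst h
    have : innerCells Γ X m ∩ oCell e = chart e '' closedBall 0 (1 / 2) := by
      ext x
      constructor
      · rintro ⟨hx, hxe⟩
        obtain ⟨v, hv, rfl⟩ := exists_chart_eq hxe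
        exact ⟨v, mem_closedBall_zero_iff.2
          ((chart_mem_innerCells_iff e (ball_subset_closedBall hv)).1 hx), rfl⟩
      · rintro ⟨v, hv, rfl⟩
        rw [mem_closedBall_zero_iff] at hv
        exact ⟨⟨e, v, hv, rfl⟩, chart_mem_oCell e (mem_ball_of_norm_le_half hv)⟩
    rw [this]
    exact ((isCompact_closedBall _ _).image_of_continuousOn ((continuousOn_chart e).mono
      (closedBall_subset_closedBall (by norm_num)))).isClosed
  · have : innerCells Γ X n ∩ oCell e = ∅ := by
      refine Set.eq_empty_of_forall_notMem ?_
      rintro _ ⟨⟨e', v, hv, rfl⟩, hx⟩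
      exact h (dim_eq_of_mem_oCell hx (chart_mem_oCell e' (mem_ball_of_norm_le_half hv)))
    rw [this]
    exact isClosed_empty

/-! ### Chains of the orbit space of a `Γ`-CW complex -/

theorem proj_mem_image_innerCells_iff {x : X} :
    proj Γ x ∈ proj Γ '' innerCells Γ X n ↔ x ∈ innerCells Γ X n := by
  refine ⟨?_, fun h => ⟨x, h, rfl⟩⟩
  rintro ⟨y, hy, hyx⟩
  obtain ⟨g, rfl⟩ := proj_eq_iff.1 hyx
  simpa using smul_mem_innerCells g⁻¹ hy

/-- The induction over the skeleta: cover the `n`-skeleton by the complement of the inner parts of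
the `n`-cells, which is pushed to the lower skeleton, and the union of the open `n`-cells. -/
theorem AcyclicOver.sk (n : ℕ) : AcyclicOver Γ X (proj Γ '' sk Γ X n) := by
  induction n with
  | zero =>
    refine AcyclicOver.of_subset_cells (n := 0) ?_
    rintro _ ⟨x, hx, rfl⟩
    obtain ⟨m, hm, -⟩ := mem_sk_iff.1 hx
    omega
  | succ n ih =>
    have hp := isOpenQuotientMap_proj Γ X
    have hinner : IsOpen (proj Γ '' innerCells Γ X n)ᶜ := by
      rw [isOpen_compl_iff, ← hp.isQuotientMap.isClosed_preimage]
      convert isClosed_innerCells (Γ := Γ) (X := X) (n := n)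
      ext x
      exact proj_mem_image_innerCells_iff
    have hsk : IsOpen (proj Γ '' Bredon.sk Γ X n)ᶜ := by
      rw [isOpen_compl_iff, ← hp.isQuotientMap.isClosed_preimage]
      convert isClosed_sk (Γ := Γ) (X := X) n
      ext x
      exact proj_mem_image_sk_iff
    have hcells : ∀ z ∈ proj Γ '' Bredon.sk Γ X (n + 1) ∩ (proj Γ '' Bredon.sk Γ X n)ᶜ,
        z ∈ proj Γ '' (Bredon.sk Γ X (n + 1) \ Bredon.sk Γ X n) := by
      rintro _ ⟨⟨x, hx, rfl⟩, hx'⟩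
      exact ⟨x, ⟨hx, fun h => hx' ⟨x, h, rfl⟩⟩, rfl⟩
    refine AcyclicOver.of_cover Γ hinner hsk ?_ ?_ (AcyclicOver.of_subset_cells hcells)
      (AcyclicOver.of_subset_cells fun z hz => hcells z ⟨hz.1.1, hz.2⟩)
    · rintro _ ⟨x, -, rfl⟩
      rw [← Set.compl_inter]
      rintro ⟨h₁, h₂⟩
      exact notMem_innerCells (proj_mem_image_sk_iff.1 h₂) (proj_mem_image_innerCells_iff.1 h₁)
    · -- away from the inner cells, push everything into the lower skeleton
      have hmem : ∀ x : X, proj Γ x ∈ proj Γ '' Bredon.sk Γ X (n + 1) ∩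
          (proj Γ '' innerCells Γ X n)ᶜ ↔ x ∈ Bredon.sk Γ X (n + 1) ∧ x ∉ innerCells Γ X n :=
        fun x => and_congr proj_mem_image_sk_iff (not_congr proj_mem_image_innerCells_iff)
      have hcases : ∀ x : X, x ∈ Bredon.sk Γ X (n + 1) → x ∉ innerCells Γ X n →
          x ∈ Bredon.sk Γ X n ∨ ∃ (e : GCell Γ X n) (v : Fin n → ℝ),
            v ∈ closedBall (0 : Fin n → ℝ) 1 ∧ 1 / 2 < ‖v‖ ∧ chart e v = x := by
        intro x hx hx'
        by_cases h : x ∈ Bredon.sk Γ X n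
        · exact Or.inl h
        · obtain ⟨e, he⟩ := exists_mem_oCell_of_mem_sk_succ hx h
          obtain ⟨v, hv, rfl⟩ := exists_chart_eq he
          refine Or.inr ⟨e, v, ball_subset_closedBall hv, ?_, rfl⟩
          rw [chart_mem_innerCells_iff e (ball_subset_closedBall hv)] at hx'
          exact not_le.1 hx'
      refine AcyclicOver.of_homotopy (cellHtpy Γ X n) cellHtpy_smul
        (W₀ := proj Γ '' Bredon.sk Γ X n) ?_ ?_ ?_ (fun x _ => cellHtpy_zero x) ?_ ih
      · rintro _ ⟨x, hx, rfl⟩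
        exact (hmem x).2 ⟨sk_mono (Nat.le_succ n) hx, notMem_innerCells hx⟩
      · refine continuousOn_cellHtpy.mono ?_
        rintro ⟨t, x⟩ ⟨-, hx⟩
        exact ⟨trivial, ((hmem x).1 hx).1⟩
      · intro t x hx
        rw [hmem] at hx ⊢
        rcases hcases x hx.1 hx.2 with h | ⟨e, v, hv, hv', rfl⟩
        · rwa [cellHtpy_of_mem_sk t h]
        · rw [cellHtpy_chart t e hv, chart_mem_innerCells_iff e (clamp_mem t v)]
          refine ⟨?_, not_le.2 (half_lt_norm_clamp t hv')⟩
          rcases (mem_closedBall_zero_iff.1 (clamp_mem t v)).lt_or_eq with h | h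
          · exact oCell_subset_sk e (Nat.lt_succ_self n)
              (chart_mem_oCell e (mem_ball_zero_iff.2 h))
          · exact sk_mono (Nat.le_succ n) (chart_mem_sk e h)
      · intro x hx
        rw [proj_mem_image_sk_iff]
        rw [hmem] at hx
        rcases hcases x hx.1 hx.2 with h | ⟨e, v, hv, hv', rfl⟩
        · rwa [cellHtpy_of_mem_sk 1 h]
        · rw [cellHtpy_chart 1 e hv]
          refine chart_mem_sk e (norm_clamp_eq_one ?_)
          rw [Set.Icc.coe_one]
          linarith

variable (Γ X) in
/-- For a `Γ`-CW complex `X`, the complex of the `Γ`-orbits of singular simplices of `X` maps to the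
singular complex of the orbit space by a quasi-isomorphism. -/
theorem acyclicOver_univ : AcyclicOver Γ X Set.univ :=
  AcyclicOver.univ_of_filtration (Γ := Γ) (fun n => proj Γ '' sk Γ X n)
    (fun _ _ h => Set.image_mono (sk_mono h)) (fun _ hK => exists_subset_image_sk hK) AcyclicOver.sk

end Charts

/-! ### Averages over finite groups -/

section Representations

variable {H K : Type*} [Group H] [Group K] [Finite H] [Finite K]

/-- The normalised sum `|H|⁻¹ ∑ w(h) f(h)`, as a function of `f`. -/
noncomputable def avg (w : H → ℂ) : (H → ℂ) →ₗ[ℂ] ℂ where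
  toFun f := (Nat.card H : ℂ)⁻¹ * ∑ᶠ h, w h * f h
  map_add' f g := by
    cases nonempty_fintype H
    simp [finsum_eq_sum_of_fintype, mul_add, Finset.sum_add_distrib]
  map_smul' c f := by
    cases nonempty_fintype H
    simp only [finsum_eq_sum_of_fintype, Pi.smul_apply, smul_eq_mul, RingHom.id_apply,
      mul_left_comm _ c, ← Finset.mul_sum]

omit [Group H] in
theorem avg_apply [Fintype H] (w f : H → ℂ) :
    avg w f = (Fintype.card H : ℂ)⁻¹ * ∑ h, w h * f h := by
  simp [avg, finsum_eq_sum_of_fintype]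

omit [Finite H] in
theorem card_ne_zero' [Fintype H] : (Fintype.card H : ℂ) ≠ 0 := by
  exact_mod_cast Fintype.card_ne_zero

/-- Frobenius reciprocity for class functions. -/
theorem avg_indFun (φ : H →* K) {w : K → ℂ} (hw : ∀ x k, w (x * k * x⁻¹) = w k) (f : H → ℂ) :
    avg w (indFun φ f) = avg (fun h => w (φ h)) f := by
  classical
  cases nonempty_fintype H
  cases nonempty_fintype K
  rw [avg_apply, avg_apply]
  simp only [indFun_apply]
  have e (x : K) (h : H) : ∑ k : K, (if φ h = x⁻¹ * k * x then w k * f h else 0) =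
      w (φ h) * f h := by
    have : ∀ k : K, φ h = x⁻¹ * k * x ↔ k = x * φ h * x⁻¹ := fun k =>
      ⟨fun e => by rw [e]; group, fun e => by rw [e]; group⟩
    simp only [this, Finset.sum_ite_eq', Finset.mem_univ, if_true, hw]
  have : ∑ k : K, w k * ((Fintype.card H : ℂ)⁻¹ *
      ∑ x : K, ∑ h : H, if φ h = x⁻¹ * k * x then f h else 0) =
      (Fintype.card H : ℂ)⁻¹ * ∑ k : K, ∑ x : K, ∑ h : H,
        if φ h = x⁻¹ * k * x then w k * f h else 0 := by
    rw [Finset.mul_sum]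
    refine Finset.sum_congr rfl fun k _ => ?_
    rw [mul_left_comm, Finset.mul_sum (a := w k)]
    simp only [Finset.mul_sum, mul_ite, mul_zero]
  rw [this, Finset.sum_comm]
  have e' : ∀ x : K, (∑ k : K, ∑ h : H, if φ h = x⁻¹ * k * x then w k * f h else 0) =
      ∑ h : H, w (φ h) * f h := fun x => by
    rw [Finset.sum_comm]
    exact Finset.sum_congr rfl fun h _ => e x h
  simp only [e', Finset.sum_const, Finset.card_univ, nsmul_eq_mul]
  rw [mul_left_comm, ← mul_assoc (Fintype.card K : ℂ)⁻¹, inv_mul_cancel₀ card_ne_zero', one_mul]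

omit [Finite H] in
theorem one_mem_RC : (1 : H → ℂ) ∈ RC H := by
  refine AddSubgroup.subset_closure ?_
  have : (1 : H → ℂ) = (Representation.trivial ℂ H ℂ).character := by
    funext h
    simp [Representation.character]
  change IsCharacter H 1
  rw [this]
  exact IsCharacter.of_representation _

/-- The pairing of two virtual characters is an integer. -/
theorem exists_int_avg_eq {f g : H → ℂ} (hf : f ∈ RC H) (hg : g ∈ RC H) :
    ∃ n : ℤ, avg (fun h => g h⁻¹) f = n := by
  cases nonempty_fintype H
  have : Invertible (Nat.card H : ℂ) := invertibleOfNonzero (by simp)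
  induction hg using AddSubgroup.closure_induction with
  | zero =>
    exact ⟨0, by simp [avg_apply]⟩
  | add g g' _ _ h h' =>
    obtain ⟨n, hn⟩ := h
    obtain ⟨n', hn'⟩ := h'
    refine ⟨n + n', ?_⟩
    rw [avg_apply] at hn hn' ⊢
    push_cast
    rw [← hn, ← hn', ← mul_add, ← Finset.sum_add_distrib]
    simp [add_mul]
  | neg g _ h =>
    obtain ⟨n, hn⟩ := h
    refine ⟨-n, ?_⟩
    rw [avg_apply] at hn ⊢
    push_cast
    rw [← hn]
    simp
  | mem g hg =>
    obtain ⟨m, σ, rfl⟩ := hg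
    induction hf using AddSubgroup.closure_induction with
    | zero => exact ⟨0, by simp⟩
    | add f f' _ _ h h' =>
      obtain ⟨n, hn⟩ := h
      obtain ⟨n', hn'⟩ := h'
      exact ⟨n + n', by rw [map_add, hn, hn', Int.cast_add]⟩
    | neg f _ h =>
      obtain ⟨n, hn⟩ := h
      exact ⟨-n, by rw [map_neg, hn, Int.cast_neg]⟩
    | mem f hf =>
      obtain ⟨k, ρ, rfl⟩ := hf
      -- for characters of representations, the pairing is the dimension of the intertwining space
      refine ⟨Module.finrank ℂ (Representation.IntertwiningMap σ ρ), ?_⟩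
      have := Representation.card_inv_mul_sum_char_mul_char_eq_finrank σ ρ
      rw [avg_apply, Int.cast_natCast, ← this, Nat.card_eq_fintype_card]
      simp only [mul_comm]

/-- The pairing `⟨f, g⟩ = |H|⁻¹ ∑ f(h) g(h⁻¹)` of virtual characters, which has integral values. -/
noncomputable def RC.pair (g : RC H) : RC H →+ ℤ where
  toFun f := (exists_int_avg_eq f.2 g.2).choose
  map_zero' := by
    apply Int.cast_injective (α := ℂ)
    rw [← (exists_int_avg_eq (0 : RC H).2 g.2).choose_spec]
    simp
  map_add' f f' := by
    apply Int.cast_injective (α := ℂ)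
    rw [Int.cast_add, ← (exists_int_avg_eq f.2 g.2).choose_spec,
      ← (exists_int_avg_eq f'.2 g.2).choose_spec, ← (exists_int_avg_eq (f + f').2 g.2).choose_spec]
    simp

theorem RC.pair_eq (g f : RC H) : (RC.pair g f : ℂ) = avg (fun h => g.1 h⁻¹) f.1 :=
  (exists_int_avg_eq f.2 g.2).choose_spec.symm

/-- The trivial character. -/
def RC.one (H : Type*) [Group H] [Finite H] : RC H := ⟨1, one_mem_RC⟩

variable (H) in
/-- The multiplicity of the trivial representation in a virtual character. -/
noncomputable def RC.aug : RC H →+ ℤ := RC.pair (RC.one H)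

theorem RC.aug_eq (f : RC H) : (RC.aug H f : ℂ) = avg 1 f.1 :=
  RC.pair_eq _ _

theorem RC.aug_one : RC.aug H (RC.one H) = 1 := by
  apply Int.cast_injective (α := ℂ)
  cases nonempty_fintype H
  rw [RC.aug_eq, avg_apply]
  simp [RC.one]

theorem RC.aug_ind (φ : H →* K) (r : RC H) : RC.aug K (RC.ind φ r) = RC.aug H r := by
  apply Int.cast_injective (α := ℂ)
  rw [RC.aug_eq, RC.aug_eq]
  exact avg_indFun φ (fun _ _ => rfl) r.1

/-- Over the trivial group, a virtual character with augmentation zero is zero. -/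
theorem RC.eq_zero_of_subsingleton [Subsingleton H] {r : RC H} (h : RC.aug H r = 0) : r = 0 := by
  cases nonempty_fintype H
  have := RC.aug_eq r
  rw [h, avg_apply, Fintype.sum_subsingleton _ 1, Fintype.card_eq_one_iff_nonempty_unique.2 ⟨⟨⟨1⟩,
    fun _ => Subsingleton.elim _ _⟩⟩] at this
  refine Subtype.ext (funext fun k => ?_)
  rw [Subsingleton.elim k 1]
  simpa using this.symm

theorem RC.ind_one (φ : H ≃* K) : RC.ind φ.toMonoidHom (RC.one H) = RC.one K := by
  classical
  cases nonempty_fintype H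
  cases nonempty_fintype K
  refine Subtype.ext (funext fun k => ?_)
  change indFun φ.toMonoidHom 1 k = 1
  rw [indFun_apply]
  have (x : K) : (∑ h : H, if φ.toMonoidHom h = x⁻¹ * k * x then (1 : H → ℂ) h else 0) = 1 := by
    rw [Finset.sum_eq_single (φ.symm (x⁻¹ * k * x))]
    · simp
    · intro h _ hne
      refine if_neg fun h' => hne ?_
      rw [← h']
      simp
    · simp
  rw [Finset.sum_congr rfl fun x _ => this x, Fintype.card_congr φ.toEquiv]
  simp

/-! ### The rank of the representation ring -/

variable (H) in
/-- The complex vector space of class functions. -/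
def classFun : Submodule ℂ (H → ℂ) where
  carrier := {f | ∀ x k, f (x⁻¹ * k * x) = f k}
  zero_mem' := fun _ _ => rfl
  add_mem' := fun hf hg x k => by rw [Pi.add_apply, hf, hg, Pi.add_apply]
  smul_mem' := fun c f hf x k => by rw [Pi.smul_apply, hf, Pi.smul_apply]

omit [Finite H] in
theorem mk_eq_mk_iff' {k k' : H} :
    ConjClasses.mk k = ConjClasses.mk k' ↔ ∃ x, x⁻¹ * k' * x = k := by
  rw [ConjClasses.mk_eq_mk_iff_isConj, isConj_comm, isConj_iff]
  constructor
  · rintro ⟨c, rfl⟩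
    exact ⟨c⁻¹, by simp⟩
  · rintro ⟨x, rfl⟩
    exact ⟨x⁻¹, by simp⟩

variable (H) in
/-- Class functions are functions on the set of conjugacy classes. -/
def classFunEquiv : (ConjClasses H → ℂ) ≃ₗ[ℂ] classFun H where
  toFun f := ⟨fun h => f (ConjClasses.mk h), fun x k =>
    congrArg f (mk_eq_mk_iff'.2 ⟨x, rfl⟩)⟩
  map_add' _ _ := rfl
  map_smul' _ _ := rfl
  invFun f := Quotient.lift f.1 (by
    intro a b hab
    obtain ⟨x, rfl⟩ := mk_eq_mk_iff'.1 (Quotient.sound hab)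
    exact f.2 x b)
  left_inv f := by
    funext c
    induction c using Quotient.inductionOn
    rfl
  right_inv f := rfl

theorem indFun_smul (φ : H →* K) (c : ℂ) (f : H → ℂ) : indFun φ (c • f) = c • indFun φ f := by
  classical
  cases nonempty_fintype H
  cases nonempty_fintype K
  funext k
  rw [Pi.smul_apply, indFun_apply, indFun_apply, smul_eq_mul, mul_left_comm, Finset.mul_sum]
  simp only [Finset.mul_sum, mul_ite, mul_zero, Pi.smul_apply, smul_eq_mul]

theorem indFun_mem_span (φ : H →* K) {f : H → ℂ}
    (hf : f ∈ Submodule.span ℂ (RC H : Set (H → ℂ))) :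
    indFun φ f ∈ Submodule.span ℂ (RC K : Set (K → ℂ)) := by
  induction hf using Submodule.span_induction with
  | mem f hf => exact Submodule.subset_span (indFun_mem φ hf)
  | zero =>
    rw [map_zero]
    exact zero_mem _
  | add f g _ _ hf hg =>
    rw [map_add]
    exact add_mem hf hg
  | smul c f _ hf =>
    rw [indFun_smul]
    exact Submodule.smul_mem _ c hf

/-- On a finite abelian group every function is a combination of characters, by Fourier theory. -/
theorem span_RC_of_comm {A : Type*} [CommGroup A] [Finite A] (f : A → ℂ) :
    f ∈ Submodule.span ℂ (RC A : Set (A → ℂ)) := by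
  have hf : (fun a : Additive A => f a.toMul) ∈
      Submodule.span ℂ (Set.range (AddChar.complexBasis (Additive A))) := by
    rw [Module.Basis.span_eq]
    trivial
  let e : (Additive A → ℂ) →ₗ[ℂ] (A → ℂ) := LinearMap.funLeft ℂ ℂ Additive.ofMul
  have := Submodule.apply_mem_span_image_of_mem_span e hf
  refine Submodule.span_mono ?_ this
  rintro _ ⟨_, ⟨ψ, rfl⟩, rfl⟩
  refine AddSubgroup.subset_closure ?_
  let ρ : Representation ℂ A ℂ :=
    { toFun := fun a => ψ (Additive.ofMul a) • LinearMap.id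
      map_one' := by
        rw [ofMul_one, AddChar.map_zero_eq_one, one_smul]
        rfl
      map_mul' := fun a b => by
        rw [ofMul_mul, AddChar.map_add_eq_mul]
        ext
        simp [mul_comm] }
  have : e (AddChar.complexBasis (Additive A) ψ) = ρ.character := by
    funext a
    simp [e, ρ, Representation.character, LinearMap.funLeft]
  change IsCharacter A _
  rw [this]
  exact IsCharacter.of_representation ρ

/-- Complex linear combinations of characters are exactly the class functions.  A class function
is a combination of functions induced from the cyclic subgroups. -/
theorem span_RC : Submodule.span ℂ (RC H : Set (H → ℂ)) = classFun H := by
  classical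
  cases nonempty_fintype H
  refine le_antisymm (Submodule.span_le.2 fun f hf x k => RC.conj_invariant hf x k) fun f hf => ?_
  -- `Ind δ_g`, from the cyclic group generated by `g`, is a multiple of the indicator function of the
  -- conjugacy class of `g`
  have hf' : f = ∑ g : H, ((Fintype.card H : ℂ)⁻¹ * f g * Fintype.card (Subgroup.zpowers g)) •
      indFun (Subgroup.zpowers g).subtype (Pi.single ⟨g, Subgroup.mem_zpowers g⟩ 1) := by
    funext k
    have e (g : H) : indFun (Subgroup.zpowers g).subtype
        (Pi.single ⟨g, Subgroup.mem_zpowers g⟩ 1) k =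
        (Fintype.card (Subgroup.zpowers g) : ℂ)⁻¹ * ∑ x : H, if g = x⁻¹ * k * x then 1 else 0 := by
      rw [indFun_apply]
      congr 1
      refine Finset.sum_congr rfl fun x _ => ?_
      rw [Finset.sum_eq_single ⟨g, Subgroup.mem_zpowers g⟩]
      · simp
      · intro h _ hne
        simp [hne]
      · simp
    have e' (g : H) : ((Fintype.card H : ℂ)⁻¹ * f g * Fintype.card (Subgroup.zpowers g)) *
        ((Fintype.card (Subgroup.zpowers g) : ℂ)⁻¹ *
          ∑ x : H, if g = x⁻¹ * k * x then 1 else 0) =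
        (Fintype.card H : ℂ)⁻¹ * ∑ x : H, if g = x⁻¹ * k * x then f g else 0 := by
      rw [mul_assoc, mul_inv_cancel_left₀ card_ne_zero', mul_assoc, Finset.mul_sum]
      simp
    simp only [Finset.sum_apply, Pi.smul_apply, smul_eq_mul, e, e', ← Finset.mul_sum]
    rw [Finset.sum_comm]
    simp [hf _ k]
  rw [hf']
  refine sum_mem fun g _ => Submodule.smul_mem _ _ (indFun_mem_span _ ?_)
  let _ : CommGroup (Subgroup.zpowers g) :=
    { (inferInstance : Group (Subgroup.zpowers g)) with
      mul_comm := fun a b => by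
        obtain ⟨_, i, rfl⟩ := a
        obtain ⟨_, j, rfl⟩ := b
        exact Subtype.ext (zpow_mul_comm g i j) }
  exact span_RC_of_comm (A := Subgroup.zpowers g) _

/-- The group of virtual characters is free of rank the number of conjugacy classes: by
integrality of the pairing, a complex basis of characters embeds it in a lattice. -/
theorem RC.free_and_finrank : Module.Free ℤ (RC H) ∧ Module.Finite ℤ (RC H) ∧
    Module.finrank ℤ (RC H) = Nat.card (ConjClasses H) := by
  classical
  cases nonempty_fintype H
  obtain ⟨t, ht, hspan, hli⟩ := exists_linearIndependent ℂ (RC H : Set (H → ℂ))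
  have : Finite t := hli.finite
  have := Fintype.ofFinite t
  rw [span_RC] at hspan
  have hcard : Fintype.card t = Nat.card (ConjClasses H) := by
    have h1 := finrank_span_eq_card hli
    rw [Subtype.range_coe, hspan, ← (classFunEquiv H).finrank_eq] at h1
    have := Fintype.ofFinite (ConjClasses H)
    rw [← h1, Module.finrank_fintype_fun_eq_card, Nat.card_eq_fintype_card]
  -- pairing with the basis `t` of characters is an injection into a lattice of the expected rank,
  -- and the characters in `t` themselves are independent over the integers
  let L : RC H →ₗ[ℤ] (t → ℤ) :=
    LinearMap.pi fun b => (RC.pair ⟨b, ht b.2⟩).toIntLinearMap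
  have hL : Function.Injective L := by
    rw [injective_iff_map_eq_zero]
    intro f hf
    have h0 : ∀ b ∈ t, avg (fun h => b h⁻¹) f.1 = 0 := fun b hb => by
      rw [← RC.pair_eq ⟨b, ht hb⟩ f, Int.cast_eq_zero]
      exact congrFun hf ⟨b, hb⟩
    have h1 : ∀ g ∈ classFun H, avg (fun h => g h⁻¹) f.1 = 0 := by
      intro g hg
      rw [← hspan] at hg
      induction hg using Submodule.span_induction with
      | mem b hb => exact h0 b hb
      | zero => simp [avg_apply]
      | add a b _ _ ha hb =>
        rw [avg_apply] at ha hb ⊢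
        simp only [Pi.add_apply, add_mul, Finset.sum_add_distrib, mul_add, ha, hb, add_zero]
      | smul c a _ ha =>
        rw [avg_apply] at ha ⊢
        simp only [Pi.smul_apply, smul_eq_mul, mul_assoc, ← Finset.mul_sum]
        rw [mul_left_comm, ha, mul_zero]
    -- pair `f` with its complex conjugate
    have h2 := h1 (fun k => starRingEnd ℂ (f.1 k⁻¹)) fun x k => by
      have : (x⁻¹ * k * x)⁻¹ = x⁻¹ * k⁻¹ * x := by group
      change starRingEnd ℂ (f.1 (x⁻¹ * k * x)⁻¹) = starRingEnd ℂ (f.1 k⁻¹)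
      rw [this, RC.conj_invariant f.2]
    rw [avg_apply, mul_eq_zero, or_iff_right (inv_ne_zero card_ne_zero')] at h2
    simp only [inv_inv, ← Complex.normSq_eq_conj_mul_self] at h2
    rw [← Complex.ofReal_sum, Complex.ofReal_eq_zero,
      Finset.sum_eq_zero_iff_of_nonneg fun h _ => Complex.normSq_nonneg _] at h2
    exact Subtype.ext (funext fun k => Complex.normSq_eq_zero.1 (h2 k (Finset.mem_univ k)))
  have hfin : Module.Finite ℤ (RC H) := Module.Finite.of_injective L hL
  have htf : Module.IsTorsionFree ℤ (RC H) := hL.moduleIsTorsionFree L (fun _ _ => map_smul L _ _)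
  have hfree : Module.Free ℤ (RC H) := Module.free_of_finite_type_torsion_free'
  refine ⟨hfree, hfin, le_antisymm ?_ ?_⟩
  · have := LinearMap.finrank_le_finrank_of_injective hL
    rwa [Module.finrank_fintype_fun_eq_card, hcard] at this
  · have hliZ : LinearIndependent ℤ fun b : t => (⟨b, ht b.2⟩ : RC H) := by
      refine LinearIndependent.of_comp (RC H).subtype.toIntLinearMap ?_
      exact hli.restrict_scalars (R := ℤ) fun a b h => by simpa using h
    rw [← hcard]
    exact hliZ.fintype_card_le_finrank

variable (H) in
/-- The reduced representation ring: the virtual characters in which the trivial representation has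
multiplicity zero. -/
noncomputable def RC.reduced : AddSubgroup (RC H) := (RC.aug H).ker

theorem RC.mem_reduced {r : RC H} : r ∈ RC.reduced H ↔ RC.aug H r = 0 := Iff.rfl

/-- The reduced representation ring is the kernel of a surjection to `ℤ`, so that its rank is one less
than the number of conjugacy classes. -/
theorem RC.nonempty_reduced_equiv :
    Nonempty (RC.reduced H ≃+ ({c : ConjClasses H // c ≠ ConjClasses.mk 1} →₀ ℤ)) := by
  classical
  obtain ⟨hfree, hfin, hrank⟩ := RC.free_and_finrank (H := H)
  let L := (RC.aug H).toIntLinearMap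
  have hsurj : LinearMap.range L = ⊤ := LinearMap.range_eq_top.2 fun n =>
    ⟨n • RC.one H, by
      change RC.aug H _ = n
      rw [map_zsmul, RC.aug_one]
      simp⟩
  have hr := (LinearMap.ker L).finrank_quotient_add_finrank
  rw [L.quotKerEquivRange.finrank_eq, hsurj, finrank_top, Module.finrank_self, hrank] at hr
  have := Fintype.ofFinite (ConjClasses H)
  have hc : Fintype.card {c : ConjClasses H // c ≠ ConjClasses.mk 1} =
      Module.finrank ℤ (LinearMap.ker L) := by
    rw [Fintype.card_subtype_compl, Fintype.card_subtype_eq]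
    rw [Nat.card_eq_fintype_card] at hr
    omega
  let b := Module.finBasis ℤ (LinearMap.ker L)
  let e : LinearMap.ker L ≃ₗ[ℤ] ({c : ConjClasses H // c ≠ ConjClasses.mk 1} →₀ ℤ) :=
    (b.reindex (Fintype.equivOfCardEq (by rw [hc, Fintype.card_fin]))).repr
  exact ⟨e.toAddEquiv⟩

end Representations

/-! ### Bredon chains -/

section BredonChains

variable {Γ : Type u} [Group Γ] {X : Type u} [TopologicalSpace X] [MulAction Γ X]
  [ContinuousConstSMul Γ X] {n m k : ℕ}

/-- The pointwise stabiliser of a singular simplex. -/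
abbrev stb (Γ : Type u) [Group Γ] {X : Type u} [TopologicalSpace X] [MulAction Γ X]
    [ContinuousConstSMul Γ X] {n : ℕ} (σ : C(Splx n, X)) : Subgroup Γ :=
  Sing.stab Γ X (n := SimplexCategory.mk n) σ

variable [FiniteStabilizers Γ X]

variable (Γ X) in
/-- The Bredon chains of degree `n`. -/
abbrev BC (n : ℕ) : Type u := Chains Γ X (SimplexCategory.mk n)

/-- The Bredon chain given by the singular simplex `σ` with coefficient `r`. -/
noncomputable def cls (σ : C(Splx n, X)) : RC (stb Γ σ) →+ BC Γ X n :=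
  (QuotientAddGroup.mk' _).comp (PreChains.of Γ X (n := SimplexCategory.mk n) σ)

theorem cls_smul (g : Γ) (σ : C(Splx n, X)) (r : RC (stb Γ σ)) :
    cls (g • σ) (RC.ind (Sing.conj (n := SimplexCategory.mk n) g σ) r) = cls σ r :=
  (QuotientAddGroup.eq_iff_sub_mem).2 (AddSubgroup.subset_closure ⟨g, σ, r, rfl⟩)

theorem cls_congr {σ τ : C(Splx n, X)} (e : σ = τ) {H : Type u} [Group H] [Finite H]
    (φ : H →* stb Γ σ) (ψ : H →* stb Γ τ) (hφψ : ∀ h, (φ h : Γ) = ψ h) (r : RC H) :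
    cls σ (RC.ind φ r) = cls τ (RC.ind ψ r) :=
  congrArg (QuotientAddGroup.mk' _)
    (PreChains.of_congr Γ X (n := SimplexCategory.mk n) e φ ψ hφψ r)

theorem BC.induction {P : BC Γ X n → Prop} (zero : P 0) (add : ∀ a b, P a → P b → P (a + b))
    (cls : ∀ σ r, P (cls σ r)) (c : BC Γ X n) : P c := by
  classical
  induction c using QuotientAddGroup.induction_on with | _ c
  induction c using DirectSum.induction_on with
  | zero => exact zero
  | of σ r => exact cls σ r
  | add a b ha hb => exact add _ _ ha hb

open Classical in
/-- The homomorphism on Bredon chains with prescribed values on the generators. -/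
noncomputable def BC.lift {A : Type*} [AddCommGroup A] (F : ∀ σ : C(Splx n, X), RC (stb Γ σ) →+ A)
    (hF : ∀ (g : Γ) σ r, F (g • σ) (RC.ind (Sing.conj (n := SimplexCategory.mk n) g σ) r) = F σ r) :
    BC Γ X n →+ A :=
  QuotientAddGroup.lift _ (DirectSum.toAddMonoid F) (by
    refine (AddSubgroup.closure_le _).2 ?_
    rintro _ ⟨g, σ, r, rfl⟩
    change DirectSum.toAddMonoid F _ = 0
    rw [map_sub, sub_eq_zero]
    exact (DirectSum.toAddMonoid_of F (g • σ) _).trans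
      ((hF g σ r).trans (DirectSum.toAddMonoid_of F σ r).symm))

theorem BC.lift_cls {A : Type*} [AddCommGroup A] (F : ∀ σ : C(Splx n, X), RC (stb Γ σ) →+ A)
    (hF : ∀ (g : Γ) σ r, F (g • σ) (RC.ind (Sing.conj (n := SimplexCategory.mk n) g σ) r) = F σ r)
    (σ : C(Splx n, X)) (r : RC (stb Γ σ)) : BC.lift F hF (cls σ r) = F σ r := by
  classical
  exact DirectSum.toAddMonoid_of F σ r

omit [FiniteStabilizers Γ X] in
theorem stb_le_stb (F : C(Splx n, X) →[Γ] C(Splx m, X)) (σ : C(Splx n, X)) :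
    stb Γ σ ≤ stb Γ (F σ) := fun g hg => by
  have hg' : g • σ = σ := hg
  have : g • F σ = F σ := by rw [← map_smul, hg']
  exact this

/-- The map `(σ, r) ↦ (F σ, Ind r)` induced by an equivariant map on singular simplices. -/
noncomputable def push (F : C(Splx n, X) →[Γ] C(Splx m, X)) : BC Γ X n →+ BC Γ X m :=
  BC.lift (fun σ => (cls (F σ)).comp (RC.ind (Subgroup.inclusion (stb_le_stb F σ)))) fun g σ r => by
    rw [AddMonoidHom.comp_apply, AddMonoidHom.comp_apply, ← cls_smul g (F σ), RC.ind_comp,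
      RC.ind_comp]
    exact cls_congr (map_smul F g σ) _ _ (fun _ => rfl) r

theorem push_cls (F : C(Splx n, X) →[Γ] C(Splx m, X)) (σ : C(Splx n, X)) (r : RC (stb Γ σ)) :
    push F (cls σ r) = cls (F σ) (RC.ind (Subgroup.inclusion (stb_le_stb F σ)) r) :=
  BC.lift_cls _ _ σ r

theorem push_cls_congr {F G : C(Splx n, X) →[Γ] C(Splx m, X)} {σ : C(Splx n, X)} (h : F σ = G σ)
    (r : RC (stb Γ σ)) : push F (cls σ r) = push G (cls σ r) := by
  rw [push_cls, push_cls]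
  exact cls_congr h _ _ (fun _ => rfl) r

theorem push_cls_eq_self {F : C(Splx n, X) →[Γ] C(Splx n, X)} {σ : C(Splx n, X)} (h : F σ = σ)
    (r : RC (stb Γ σ)) : push F (cls σ r) = cls σ r := by
  rw [push_cls]
  conv_rhs => rw [← RC.ind_id r]
  exact cls_congr h _ _ (fun _ => rfl) r

theorem push_push (G : C(Splx m, X) →[Γ] C(Splx k, X)) (F : C(Splx n, X) →[Γ] C(Splx m, X))
    (c : BC Γ X n) : push G (push F c) = push (G.comp F) c := by
  induction c using BC.induction with
  | zero => simp
  | add a b ha hb => simp only [map_add, ha, hb]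
  | cls σ r =>
    rw [push_cls, push_cls, push_cls, RC.ind_comp]
    rfl

/-- The map on singular simplices given by precomposition. -/
def pullHom (α : C(Splx m, Splx n)) : C(Splx n, X) →[Γ] C(Splx m, X) where
  toFun σ := σ.comp α
  map_smul' _ _ := rfl

variable (Γ X) in
/-- The differential of the Bredon chains. -/
noncomputable def bd (n : ℕ) (c : BC Γ X (n + 1)) : BC Γ X n :=
  ∑ i : Fin (n + 2), (-1 : ℤ) ^ (i : ℕ) • push (pullHom (face i)) c

theorem bd_zero : bd Γ X n 0 = 0 := by simp [bd]

theorem bd_add (a b : BC Γ X (n + 1)) : bd Γ X n (a + b) = bd Γ X n a + bd Γ X n b := by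
  simp [bd, Finset.sum_add_distrib]

theorem bd_sub (a b : BC Γ X (n + 1)) : bd Γ X n (a - b) = bd Γ X n a - bd Γ X n b := by
  simp [bd, Finset.sum_sub_distrib, smul_sub]

theorem pull_eq (f : SimplexCategory.mk m ⟶ SimplexCategory.mk n) (σ : C(Splx n, X)) :
    Sing.pull (n := SimplexCategory.mk n) f σ = σ.comp (real (vert n ∘ f)) :=
  ContinuousMap.ext fun t => congrArg σ (map_eq_real _ t)

theorem chainsMap_cls (f : SimplexCategory.mk m ⟶ SimplexCategory.mk n) (c : BC Γ X n) :
    Chains.map Γ X f c = push (pullHom (real (vert n ∘ f))) c := by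
  induction c using BC.induction with
  | zero => simp
  | add a b ha hb => simp only [map_add, ha, hb]
  | cls σ r =>
    rw [push_cls]
    refine (congrArg (QuotientAddGroup.mk' _) (PreChains.map_of Γ X f σ r)).trans ?_
    exact cls_congr (pull_eq f σ) (Subgroup.inclusion (Sing.stab_le_pull Γ f σ))
      (Subgroup.inclusion (stb_le_stb (pullHom (real (vert n ∘ f))) σ)) (fun h => Eq.refl (h : Γ)) r

theorem chainComplex_d_apply (n : ℕ) (c : BC Γ X (n + 1)) :
    ((chainComplex Γ X).d (n + 1) n).hom c = bd Γ X n c := by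
  unfold chainComplex
  rw [AlgebraicTopology.alternatingFaceMapComplex_obj_d, AlgebraicTopology.AlternatingFaceMapComplex.objD]
  have : ∀ (s : Finset (Fin (n + 2))) (F : Fin (n + 2) → ((simplicialChains Γ X).obj
      (Opposite.op (SimplexCategory.mk (n + 1))) ⟶ (simplicialChains Γ X).obj
      (Opposite.op (SimplexCategory.mk n)))), (∑ i ∈ s, F i).hom c = ∑ i ∈ s, (F i).hom c := by
    intro s F
    rw [ModuleCat.hom_sum]
    exact LinearMap.sum_apply _ _ _
  refine (this _ _).trans (Finset.sum_congr rfl fun i _ => ?_)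
  rw [ModuleCat.hom_zsmul]
  exact congrArg (fun b : BC Γ X n => (-1 : ℤ) ^ (i : ℕ) • b)
    (chainsMap_cls (SimplexCategory.δ i) c)

theorem bd_bd (c : BC Γ X (n + 2)) : bd Γ X n (bd Γ X (n + 1) c) = 0 := by
  rw [← chainComplex_d_apply, ← chainComplex_d_apply]
  have := (chainComplex Γ X).d_comp_d (n + 2) (n + 1) n
  exact LinearMap.congr_fun (congrArg ModuleCat.Hom.hom this) c

/-! ### The augmentation of the coefficients -/

open SplxSet

variable (Γ X n) in
/-- The map from Bredon chains to the chains on orbits of singular simplices that is given by the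
multiplicity of the trivial representation. -/
noncomputable def eps : BC Γ X n →+ (orbSing Γ X).Ch n :=
  BC.lift (fun σ => ((zmultiplesHom ((orbSing Γ X).Ch n)) (of (Quotient.mk _ σ))).comp
    (RC.aug (stb Γ σ))) fun g σ r => by
    have : (Quotient.mk _ (g • σ) : Orb Γ C(Splx n, X)) = Quotient.mk _ σ :=
      Quotient.sound ⟨g, rfl⟩
    simp only [AddMonoidHom.comp_apply, RC.aug_ind, this]

theorem eps_cls (σ : C(Splx n, X)) (r : RC (stb Γ σ)) :
    eps Γ X n (cls σ r) = RC.aug (stb Γ σ) r • of (Q := orbSing Γ X) (Quotient.mk _ σ) :=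
  BC.lift_cls _ _ σ r

theorem eps_push_pullHom (α : C(Splx m, Splx n)) (c : BC Γ X n) :
    eps Γ X m (push (pullHom α) c) =
      Finsupp.lmapDomain ℤ ℤ ((orbSing Γ X).act α) (eps Γ X n c) := by
  induction c using BC.induction with
  | zero => simp
  | add a b ha hb => simp only [map_add, ha, hb]
  | cls σ r =>
    rw [push_cls, eps_cls, eps_cls, RC.aug_ind, map_zsmul]
    congr 1
    rw [of, of, Finsupp.lmapDomain_apply, Finsupp.mapDomain_single]
    rfl

theorem eps_bd (c : BC Γ X (n + 1)) :
    eps Γ X n (bd Γ X n c) = (orbSing Γ X).d (eps Γ X (n + 1) c) := by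
  simp only [bd, map_sum, map_zsmul, eps_push_pullHom, SplxSet.d, LinearMap.sum_apply,
    LinearMap.smul_apply]

theorem cls_one_smul (g : Γ) (σ : C(Splx n, X)) :
    cls (g • σ) (RC.one (stb Γ (g • σ))) = cls σ (RC.one (stb Γ σ)) := by
  rw [← cls_smul g σ]
  congr 1
  exact (RC.ind_one (MulAction.stabilizerEquivStabilizer (G := Γ) (a := σ) (b := g • σ) rfl)).symm

variable (Γ X n) in
/-- The section of `eps` given by the trivial representations. -/
noncomputable def sec : (orbSing Γ X).Ch n →+ BC Γ X n :=
  (Finsupp.linearCombination ℤ (Quotient.lift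
    (fun σ : C(Splx n, X) => cls σ (RC.one (stb Γ σ))) (by
      rintro _ σ ⟨g, rfl⟩
      exact cls_one_smul g σ))).toAddMonoidHom

theorem sec_of (σ : C(Splx n, X)) :
    sec Γ X n (of (Q := orbSing Γ X) (Quotient.mk _ σ)) = cls σ (RC.one (stb Γ σ)) :=
  (Finsupp.linearCombination_single ℤ _ _).trans (one_smul ℤ _)

theorem eps_sec (c : (orbSing Γ X).Ch n) : eps Γ X n (sec Γ X n c) = c := by
  have : (eps Γ X n).toIntLinearMap ∘ₗ (sec Γ X n).toIntLinearMap = LinearMap.id :=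
    SplxSet.hom_ext fun q => by
      induction q using Quotient.inductionOn with | _ σ
      change eps Γ X n (sec Γ X n _) = _
      rw [sec_of, eps_cls, RC.aug_one, one_smul]
      rfl
  exact LinearMap.congr_fun this c

variable (Γ) in
/-- The chains generated by the simplices in `A` with coefficients in which the trivial
representation has multiplicity zero. -/
def redChains (A : Set C(Splx n, X)) : AddSubgroup (BC Γ X n) :=
  AddSubgroup.closure {c | ∃ σ ∈ A, ∃ r : RC (stb Γ σ), RC.aug _ r = 0 ∧ c = cls σ r}

theorem cls_mem_redChains {A : Set C(Splx n, X)} {σ : C(Splx n, X)} (hσ : σ ∈ A)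
    {r : RC (stb Γ σ)} (hr : RC.aug _ r = 0) : cls σ r ∈ redChains Γ A :=
  AddSubgroup.subset_closure ⟨σ, hσ, r, hr, rfl⟩

theorem redChains_induction {A : Set C(Splx n, X)} {P : BC Γ X n → Prop}
    (zero : P 0) (add : ∀ a b, P a → P b → P (a + b))
    (cls : ∀ σ ∈ A, ∀ r : RC (stb Γ σ), RC.aug _ r = 0 → P (cls σ r))
    {c : BC Γ X n} (hc : c ∈ redChains Γ A) : P c := by
  refine AddSubgroup.closure_induction_left (p := fun c _ => P c) zero ?_ ?_ hc
  · rintro _ ⟨σ, hσ, r, hr, rfl⟩ y _ hy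
    exact add _ _ (cls σ hσ r hr) hy
  · rintro _ ⟨σ, hσ, r, hr, rfl⟩ y _ hy
    rw [← map_neg]
    exact add _ _ (cls σ hσ (-r) (by rw [map_neg, hr, neg_zero])) hy

theorem push_mem_redChains {A : Set C(Splx n, X)} {B : Set C(Splx m, X)}
    (F : C(Splx n, X) →[Γ] C(Splx m, X)) (hF : ∀ σ ∈ A, F σ ∈ B) {c : BC Γ X n}
    (hc : c ∈ redChains Γ A) : push F c ∈ redChains Γ B := by
  refine redChains_induction (P := fun c => push F c ∈ redChains Γ B) ?_ (fun a b ha hb => ?_)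
    (fun σ hσ r hr => ?_) hc
  · rw [map_zero]
    exact zero_mem _
  · rw [map_add]
    exact add_mem ha hb
  · rw [push_cls]
    exact cls_mem_redChains (hF σ hσ) (by rw [RC.aug_ind, hr])

theorem push_eq_push {A : Set C(Splx n, X)} {F G : C(Splx n, X) →[Γ] C(Splx m, X)}
    (h : ∀ σ ∈ A, F σ = G σ) {c : BC Γ X n} (hc : c ∈ redChains Γ A) : push F c = push G c := by
  exact redChains_induction (P := fun c => push F c = push G c) (by simp)
    (fun a b ha hb => by rw [map_add, map_add, ha, hb]) (fun σ hσ r _ => push_cls_congr (h σ hσ) r) hc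

theorem push_eq_self {A : Set C(Splx n, X)} {F : C(Splx n, X) →[Γ] C(Splx n, X)}
    (h : ∀ σ ∈ A, F σ = σ) {c : BC Γ X n} (hc : c ∈ redChains Γ A) : push F c = c := by
  exact redChains_induction (P := fun c => push F c = c) (by simp)
    (fun a b ha hb => by rw [map_add, ha, hb]) (fun σ hσ r _ => push_cls_eq_self (h σ hσ) r) hc

variable (Γ X n) in
/-- The singular simplices of the singular part. -/
def singSimplices : Set C(Splx n, X) := {σ | ∀ y, σ y ∈ singularPart Γ X}

omit [FiniteStabilizers Γ X] in
theorem mem_singSimplices_of_stb_ne_bot {σ : C(Splx n, X)} (h : stb Γ σ ≠ ⊥) :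
    σ ∈ singSimplices Γ X n := fun y hy => h (eq_bot_iff.2 fun g hg => by
  rw [← hy]
  exact (Sing.mem_stab (n := SimplexCategory.mk n) σ g).1 hg y)

theorem eps_eq_zero_of_mem {A : Set C(Splx n, X)} {c : BC Γ X n} (hc : c ∈ redChains Γ A) :
    eps Γ X n c = 0 := by
  exact redChains_induction (P := fun c => eps Γ X n c = 0) (by simp)
    (fun a b ha hb => by rw [map_add, ha, hb, add_zero])
    (fun σ _ r hr => by rw [eps_cls, hr, zero_smul]) hc

theorem sub_sec_eps_mem (c : BC Γ X n) :
    c - sec Γ X n (eps Γ X n c) ∈ redChains Γ (singSimplices Γ X n) := by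
  induction c using BC.induction with
  | zero =>
    simp only [map_zero, sub_zero]
    exact zero_mem _
  | add a b ha hb =>
    rw [map_add, map_add, add_sub_add_comm]
    exact add_mem ha hb
  | cls σ r =>
    rw [eps_cls, map_zsmul, sec_of, ← map_zsmul, ← map_sub]
    have h0 : RC.aug (stb Γ σ) (r - RC.aug (stb Γ σ) r • RC.one (stb Γ σ)) = 0 := by
      rw [map_sub, map_zsmul, RC.aug_one]
      simp
    by_cases h : stb Γ σ = ⊥
    · have : Subsingleton (stb Γ σ) := by
        rw [h]
        infer_instance
      rw [RC.eq_zero_of_subsingleton h0, map_zero]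
      exact zero_mem _
    · exact cls_mem_redChains (mem_singSimplices_of_stb_ne_bot h) h0

/-- The kernel of `eps` is generated by simplices of the singular part. -/
theorem mem_redChains_of_eps_eq_zero {c : BC Γ X n} (h : eps Γ X n c = 0) :
    c ∈ redChains Γ (singSimplices Γ X n) := by
  simpa [h] using sub_sec_eps_mem c

/-! ### Detecting coefficients by class functions -/

open Classical in
/-- The sum of the values of the coefficients of a Bredon chain on the conjugacy class `c`, where the
coefficient of `σ` is weighted by the inverse of the order of the stabiliser of `σ`. -/
noncomputable def classSum (c : ConjClasses Γ) : BC Γ X n →+ ℂ :=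
  BC.lift (fun σ => (avg fun h : stb Γ σ =>
      if ConjClasses.mk (h : Γ) = c then 1 else 0).toAddMonoidHom.comp (RC (stb Γ σ)).subtype)
    fun g σ r => by
      have hconj : ∀ g x : Γ, ConjClasses.mk (g * x * g⁻¹) = ConjClasses.mk x := fun g x =>
        ConjClasses.mk_eq_mk_iff_isConj.2 (isConj_comm.1 (isConj_iff.2 ⟨g, rfl⟩))
      refine (avg_indFun _ (fun x k => ?_) r.1).trans ?_
      · simp only [Subgroup.coe_mul, Subgroup.coe_inv, hconj]
      · refine congrArg (fun w => avg w r.1) (funext fun h => ?_)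
        have : ((Sing.conj (n := SimplexCategory.mk n) g σ h : _) : Γ) = g * h * g⁻¹ := rfl
        rw [this, hconj]

open Classical in
theorem classSum_cls (c : ConjClasses Γ) (σ : C(Splx n, X)) (r : RC (stb Γ σ)) :
    classSum c (cls σ r) =
      avg (fun h : stb Γ σ => if ConjClasses.mk (h : Γ) = c then 1 else 0) r.1 :=
  BC.lift_cls _ _ σ r

theorem classSum_push (c : ConjClasses Γ) (F : C(Splx n, X) →[Γ] C(Splx m, X)) (b : BC Γ X n) :
    classSum c (push F b) = classSum c b := by
  classical
  induction b using BC.induction with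
  | zero => simp
  | add a b ha hb => simp only [map_add, ha, hb]
  | cls σ r =>
    rw [push_cls, classSum_cls, classSum_cls]
    refine (avg_indFun _ (fun x k => ?_) r.1).trans rfl
    have : ConjClasses.mk (((x * k * x⁻¹ : stb Γ (F σ)) : Γ)) = ConjClasses.mk (k : Γ) :=
      ConjClasses.mk_eq_mk_iff_isConj.2 (isConj_comm.1 (isConj_iff.2 ⟨x, rfl⟩))
    rw [this]

theorem classSum_bd (c : ConjClasses Γ) (b : BC Γ X 1) : classSum c (bd Γ X 0 b) = 0 := by
  simp [bd, classSum_push, Fin.sum_univ_two]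

end BredonChains

/-! ### Deformations of the singular part to a discrete set -/

section Deformation

variable (Γ : Type u) [Group Γ] (X : Type u) [TopologicalSpace X] [MulAction Γ X]
  [ContinuousConstSMul Γ X]

/-- An equivariant deformation of the singular part of `X`, at time `0`, to a set of points that is
discrete in the sense that connected subsets of the singular part are contracted to points.  The
maps are total functions on `X` that are subject to a continuity condition on the singular part
only. -/
structure DiscreteDeformation where
  /-- The deformation at time `t`. -/
  toFun : unitInterval → X → X
  map_smul : ∀ t (g : Γ) x, toFun t (g • x) = g • toFun t x
  continuousOn : ContinuousOn (fun z : unitInterval × X => toFun z.1 z.2)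
    (Set.univ ×ˢ (singularPart Γ X : Set X))
  one : ∀ x, toFun 1 x = x
  const : ∀ A ⊆ (singularPart Γ X : Set X), IsPreconnected A →
    ∀ x ∈ A, ∀ y ∈ A, toFun 0 x = toFun 0 y
  idem : ∀ x ∈ singularPart Γ X, toFun 0 (toFun 0 x) = toFun 0 x

variable {Γ X} {n m : ℕ}

namespace DiscreteDeformation

variable (D : DiscreteDeformation Γ X)

omit [ContinuousConstSMul Γ X] in
theorem smul_eq {g : Γ} {x : X} (t : unitInterval) (h : g • x = x) :
    g • D.toFun t x = D.toFun t x := by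
  rw [← D.map_smul, h]

omit [ContinuousConstSMul Γ X] in
theorem mem (t : unitInterval) {x : X} (hx : x ∈ singularPart Γ X) :
    D.toFun t x ∈ singularPart Γ X := fun h => hx (eq_bot_iff.2 fun g hg => by
  rw [← h]
  exact D.smul_eq t hg)

open Classical in
/-- The map on singular simplices given by the deformation and a map to the cylinder over the
standard simplex.  Its values are meaningful on the simplices of the singular part, where the first
case of the definition applies. -/
noncomputable def cylHom (α : C(Splx m, Splx n × unitInterval)) :
    C(Splx n, X) →[Γ] C(Splx m, X) where
  toFun σ := if h : Continuous (cylMap D.toFun α σ) then ⟨_, h⟩ else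
    σ.comp (ContinuousMap.fst.comp α)
  map_smul' g σ := by
    have key := continuous_cylMap_smul_iff D.toFun D.map_smul α g σ
    by_cases h : Continuous (cylMap D.toFun α σ)
    · have h' : Continuous (cylMap D.toFun α ⇑(g • σ : C(Splx n, X))) := key.2 h
      rw [dif_pos h, dif_pos h']
      exact ContinuousMap.ext fun y => D.map_smul _ _ _
    · have h' : ¬ Continuous (cylMap D.toFun α ⇑(g • σ : C(Splx n, X))) := fun h' => h (key.1 h')
      rw [dif_neg h, dif_neg h']
      rfl

open Classical in
theorem cylHom_apply (α : C(Splx m, Splx n × unitInterval)) {σ : C(Splx n, X)}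
    (hσ : σ ∈ singSimplices Γ X n) (y : Splx m) :
    D.cylHom α σ y = D.toFun (α y).2 (σ (α y).1) := by
  change (dite _ _ _ : C(Splx m, X)) y = _
  rw [dif_pos (continuous_cylMap D.continuousOn α hσ)]
  rfl

theorem cylHom_mem (α : C(Splx m, Splx n × unitInterval)) {σ : C(Splx n, X)}
    (hσ : σ ∈ singSimplices Γ X n) : D.cylHom α σ ∈ singSimplices Γ X m := fun y => by
  rw [D.cylHom_apply α hσ]
  exact D.mem _ (hσ _)

variable [FiniteStabilizers Γ X]

/-- The chain homotopy given by the deformation. -/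
noncomputable def prism (n : ℕ) : BC Γ X n →+ BC Γ X (n + 1) :=
  prismOp (A := BC Γ X) (A' := BC Γ X) (fun {_ _} α => push (D.cylHom α)) n

/-- The effect on chains of the deformation at time `0`. -/
noncomputable def retract (n : ℕ) : BC Γ X n →+ BC Γ X n := push (D.cylHom (cylIncl n 0))

theorem prism_mem {a : BC Γ X n} (ha : a ∈ redChains Γ (singSimplices Γ X n)) :
    D.prism n a ∈ redChains Γ (singSimplices Γ X (n + 1)) := by
  have key : ∀ c : OrdChain (Splx n × unitInterval) (n + 1),
      cylEv (fun α => push (D.cylHom α) a) c ∈ redChains Γ (singSimplices Γ X (n + 1)) := by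
    intro c
    induction c using Finsupp.induction_linear with
    | zero =>
      rw [map_zero]
      exact zero_mem _
    | add x y hx hy =>
      rw [map_add]
      exact add_mem hx hy
    | single w r =>
      rw [cylEv, Finsupp.linearCombination_single]
      exact AddSubgroup.zsmul_mem _
        (push_mem_redChains _ (fun σ hσ => D.cylHom_mem _ hσ) ha) r
  exact key _

theorem pullHom_cylHom {a : BC Γ X n} (ha : a ∈ redChains Γ (singSimplices Γ X n)) {k : ℕ}
    (α : C(Splx m, Splx n × unitInterval)) (β : C(Splx k, Splx m)) :
    push (pullHom β) (push (D.cylHom α) a) = push (D.cylHom (α.comp β)) a := by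
  rw [push_push]
  refine push_eq_push (fun σ hσ => ContinuousMap.ext fun y => ?_) ha
  change D.cylHom α σ (β y) = _
  rw [D.cylHom_apply _ hσ, D.cylHom_apply _ hσ]
  rfl

theorem push_cylHom_one {a : BC Γ X n} (ha : a ∈ redChains Γ (singSimplices Γ X n)) :
    push (D.cylHom (cylIncl n 1)) a = a :=
  push_eq_self (fun σ hσ => ContinuousMap.ext fun y => by
    rw [D.cylHom_apply _ hσ]
    exact D.one _) ha

theorem bd_prism_succ {a : BC Γ X (n + 1)} (ha : a ∈ redChains Γ (singSimplices Γ X (n + 1))) :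
    bd Γ X (n + 1) (D.prism (n + 1) a) = a - D.retract (n + 1) a - D.prism n (bd Γ X n a) := by
  refine (alternatingSum_prismOp_succ (A := BC Γ X) (A' := BC Γ X)
    (fun n i => push (pullHom (face i))) (fun n i => push (pullHom (face i)))
    (fun {_ _} α => push (D.cylHom α)) a (fun m i α => D.pullHom_cylHom ha α _)
    (fun m i α => ?_)).trans ?_
  · rw [push_push]
    refine push_eq_push (fun σ hσ => ContinuousMap.ext fun y => ?_) ha
    have hσ' : σ.comp (face i) ∈ singSimplices Γ X n := fun y => hσ _
    refine (D.cylHom_apply _ hσ' y).trans ?_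
    rw [D.cylHom_apply _ hσ]
    rfl
  · rw [D.push_cylHom_one ha]
    rfl

theorem bd_prism_zero {a : BC Γ X 0} (ha : a ∈ redChains Γ (singSimplices Γ X 0)) :
    bd Γ X 0 (D.prism 0 a) = a - D.retract 0 a := by
  refine (alternatingSum_prismOp_zero (A := BC Γ X) (A' := BC Γ X)
    (fun n i => push (pullHom (face i)))
    (fun {_ _} α => push (D.cylHom α)) a (fun m i α => D.pullHom_cylHom ha α _)).trans ?_
  rw [D.push_cylHom_one ha]
  rfl

/-- The constant singular simplices of the singular part. -/
def constSimplices (Γ : Type u) [Group Γ] (X : Type u) [TopologicalSpace X] [MulAction Γ X]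
    (n : ℕ) : Set C(Splx n, X) :=
  {σ | (∀ y, σ y ∈ singularPart Γ X) ∧ ∀ y y', σ y = σ y'}

theorem retract_mem {a : BC Γ X n} (ha : a ∈ redChains Γ (singSimplices Γ X n)) :
    D.retract n a ∈ redChains Γ (constSimplices Γ X n) := by
  have key : ∀ σ ∈ singSimplices Γ X n, D.cylHom (cylIncl n 0) σ ∈ constSimplices Γ X n :=
    fun σ hσ => ⟨D.cylHom_mem _ hσ, fun y y' => ?_⟩
  · exact push_mem_redChains _ key ha
  rw [D.cylHom_apply _ hσ, D.cylHom_apply _ hσ]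
  exact D.const (Set.range σ) (by rintro _ ⟨z, rfl⟩; exact hσ z)
    (isPreconnected_range σ.continuous) _ ⟨y, rfl⟩ _ ⟨y', rfl⟩

theorem push_pullHom_const {a : BC Γ X n} (ha : a ∈ redChains Γ (constSimplices Γ X n))
    (α β : C(Splx m, Splx n)) : push (pullHom α) a = push (pullHom β) a :=
  push_eq_push (fun _ hσ => ContinuousMap.ext fun _ => hσ.2 _ _) ha

theorem push_pullHom_const_self {a : BC Γ X n} (ha : a ∈ redChains Γ (constSimplices Γ X n))
    (α : C(Splx n, Splx n)) : push (pullHom α) a = a :=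
  push_eq_self (fun _ hσ => ContinuousMap.ext fun _ => hσ.2 _ _) ha

/-- Cycles of constant simplices in positive degree are boundaries. -/
theorem exists_bd_eq_of_const {a : BC Γ X (n + 1)} (ha : a ∈ redChains Γ (constSimplices Γ X (n + 1)))
    (hc : bd Γ X n a = 0) : ∃ b ∈ redChains Γ (singSimplices Γ X (n + 2)), bd Γ X (n + 1) b = a := by
  let up : C(Splx (n + 2), Splx (n + 1)) := ContinuousMap.const _ (vert (n + 1) 0)
  let down : C(Splx n, Splx (n + 1)) := ContinuousMap.const _ (vert (n + 1) 0)
  let back : C(Splx (n + 1), Splx n) := ContinuousMap.const _ (vert n 0)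
  -- on constant simplices all faces agree, so that the differentials are alternately zero and the
  -- identity
  rcases Nat.even_or_odd n with hn | hn
  · refine ⟨push (pullHom up) a, push_mem_redChains _ (fun σ hσ y => hσ.1 _) ha, ?_⟩
    have : ∀ i : Fin (n + 3), push (pullHom (face i)) (push (pullHom up) a) = a := fun i => by
      rw [push_push]
      exact push_pullHom_const_self ha (up.comp (face i))
    simp only [bd, this]
    rw [← Finset.sum_smul, Fin.sum_neg_one_pow, if_neg, one_smul]
    simpa [Nat.even_add] using hn
  · have : a = 0 := by
      have h1 : ∀ i : Fin (n + 2), push (pullHom (face i)) a = push (pullHom down) a := fun i =>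
        push_pullHom_const ha _ _
      simp only [bd, h1] at hc
      rw [← Finset.sum_smul, Fin.sum_neg_one_pow, if_neg, one_smul] at hc
      · have h2 : push (pullHom back) (push (pullHom down) a) = a :=
          (push_push _ _ a).trans (push_pullHom_const_self ha (down.comp back))
        rw [← h2, hc, map_zero]
      · simpa [Nat.even_add] using hn
    exact ⟨0, zero_mem _, by rw [this, bd_zero]⟩

include D in
/-- In positive degrees, the cycles of reduced chains are boundaries of reduced chains. -/
theorem exists_bd_eq {a : BC Γ X (n + 1)} (ha : a ∈ redChains Γ (singSimplices Γ X (n + 1)))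
    (hc : bd Γ X n a = 0) : ∃ b ∈ redChains Γ (singSimplices Γ X (n + 2)), bd Γ X (n + 1) b = a := by
  have h := D.bd_prism_succ ha
  rw [hc, map_zero, sub_zero] at h
  have hr : bd Γ X n (D.retract (n + 1) a) = 0 := by
    have h' := congrArg (bd Γ X n) h
    rw [bd_bd, bd_sub, hc, zero_sub] at h'
    exact neg_eq_zero.1 h'.symm
  obtain ⟨b, hb, hb'⟩ := exists_bd_eq_of_const (D.retract_mem ha) hr
  refine ⟨D.prism (n + 1) a + b, add_mem (D.prism_mem ha) hb, ?_⟩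
  rw [bd_add, h, hb', sub_add_cancel]

end DiscreteDeformation

end Deformation

/-! ### Degree zero -/

section DegreeZero

variable {Γ : Type u} [Group Γ] {X : Type u} [TopologicalSpace X] [MulAction Γ X] {n : ℕ}
  [IsClassifyingSpaceForProperActions Γ X]

/-- The singular `0`-simplex given by a point. -/
def pt (x : X) : C(Splx 0, X) := ContinuousMap.const _ x

omit [IsClassifyingSpaceForProperActions Γ X] in
theorem eq_pt (σ : C(Splx 0, X)) : σ = pt (σ (vert 0 0)) :=
  ContinuousMap.ext fun y => congrArg σ (Subsingleton.elim y _)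

theorem mem_stb_pt {g : Γ} {x : X} : g ∈ stb Γ (pt x) ↔ g • x = x :=
  (Sing.mem_stab (n := SimplexCategory.mk 0) (pt x) g).trans
    ⟨fun h => h (vert 0 0), fun h _ => h⟩

/-- A group element of finite order fixes a non-empty path connected set. -/
theorem isPathConnected_fixed {g : Γ} (hg : IsOfFinOrder g) : IsPathConnected {x : X | g • x = x} := by
  have hfin : Finite (Subgroup.zpowers g) := finite_zpowers.2 hg
  have := IsClassifyingSpaceForProperActions.contractible_fixedPoints (X := X) _ hfin
  have hc : PathConnectedSpace (MulAction.fixedPoints (Subgroup.zpowers g) X) := inferInstance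
  have := isPathConnected_iff_pathConnectedSpace.2 hc
  convert this
  ext x
  constructor
  · rintro hx ⟨_, k, rfl⟩
    have : g ∈ MulAction.stabilizer Γ x := hx
    exact Subgroup.zpow_mem _ this k
  · intro hx
    exact hx ⟨g, Subgroup.mem_zpowers g⟩

theorem pathConnectedSpace (Γ : Type u) [Group Γ] (X : Type u) [TopologicalSpace X] [MulAction Γ X]
    [IsClassifyingSpaceForProperActions Γ X] : PathConnectedSpace X := by
  have := isPathConnected_fixed (Γ := Γ) (X := X) (g := 1) IsOfFinOrder.one
  rw [pathConnectedSpace_iff_univ]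
  simpa using this

omit [TopologicalSpace X] [IsClassifyingSpaceForProperActions Γ X] in
theorem mem_singularPart_of_smul_eq {g : Γ} (hg : g ≠ 1) {x : X} (h : g • x = x) :
    x ∈ singularPart Γ X := fun h' => hg (by
  have : g ∈ MulAction.stabilizer Γ x := h
  rwa [h', Subgroup.mem_bot] at this)

theorem isOfFinOrder_stb {x : X} (h : stb Γ (pt x)) : IsOfFinOrder (h : Γ) :=
  Submonoid.isOfFinOrder_coe.2 (isOfFinOrder_of_finite h)

namespace DiscreteDeformation

variable (D : DiscreteDeformation Γ X)

/-- A non-trivial element of finite order fixes at most one point of the discrete set. -/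
theorem eq_of_smul_eq {g : Γ} (hg : IsOfFinOrder g) (hg1 : g ≠ 1) {x y : X} (hx : g • x = x)
    (hy : g • y = y) (hDx : D.toFun 0 x = x) (hDy : D.toFun 0 y = y) : x = y := by
  rw [← hDx, ← hDy]
  exact D.const {x : X | g • x = x} (fun z hz => mem_singularPart_of_smul_eq hg1 hz)
    (isPathConnected_fixed hg).isConnected.isPreconnected x hx y hy

/-- The orbits of the points of the discrete set. -/
def Orbits : Type u :=
  {o : Orb Γ X // ∃ s ∈ singularPart Γ X, D.toFun 0 s = s ∧ proj Γ s = o}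

variable {D}

/-- The chosen representative of an orbit in the discrete set. -/
noncomputable def rep (o : D.Orbits) : X := o.2.choose

omit [IsClassifyingSpaceForProperActions Γ X] in
theorem toFun_rep (o : D.Orbits) : D.toFun 0 (rep o) = rep o := o.2.choose_spec.2.1

omit [IsClassifyingSpaceForProperActions Γ X] in
theorem proj_rep (o : D.Orbits) : proj Γ (rep o) = o.1 := o.2.choose_spec.2.2

omit [IsClassifyingSpaceForProperActions Γ X] in
theorem exists_smul_rep {x : X} (hx : x ∈ singularPart Γ X) (h : D.toFun 0 x = x) :
    ∃ (o : D.Orbits) (g : Γ), g • rep o = x := by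
  refine ⟨⟨proj Γ x, x, hx, h, rfl⟩, ?_⟩
  exact proj_eq_iff.1 (proj_rep (D := D) ⟨proj Γ x, x, hx, h, rfl⟩).symm

/-- Non-trivial elements of the stabilisers of representatives are conjugate in `Γ` only if the
representatives coincide and the elements are conjugate in the stabiliser. -/
theorem eq_of_conj {o o' : D.Orbits} {h h' g : Γ} (h1 : h ≠ 1) (hh : h • rep o = rep o)
    (hh' : h' • rep o' = rep o') (hg : g * h * g⁻¹ = h') (hf : IsOfFinOrder h') :
    o = o' ∧ g • rep o = rep o' := by
  have hne : h' ≠ 1 := fun e => h1 (by rwa [e, conj_eq_one_iff] at hg)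
  have hfix : h' • g • rep o = g • rep o := by
    rw [← hg, mul_smul, mul_smul, inv_smul_smul, hh]
  have : g • rep o = rep o' := D.eq_of_smul_eq hf hne hfix hh'
    (by rw [D.map_smul, toFun_rep]) (toFun_rep o')
  refine ⟨Subtype.ext ?_, this⟩
  rw [← proj_rep o, ← proj_rep o', ← this, proj_smul]

variable (D)

open DirectSum in
/-- The direct sum of the reduced representation rings of the stabilisers of the discrete set. -/
abbrev Coeff : Type u := ⨁ o : D.Orbits, RC.reduced (stb Γ (pt (rep o)))

open Classical in
/-- The inclusion of the coefficients as `0`-chains. -/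
noncomputable def incl : D.Coeff →+ BC Γ X 0 :=
  DirectSum.toAddMonoid fun o => (cls (pt (rep o))).comp (RC.reduced _).subtype

open Classical in
theorem incl_of (o : D.Orbits) (r : RC.reduced (stb Γ (pt (rep o)))) :
    D.incl (DirectSum.of (fun o : D.Orbits => RC.reduced (stb Γ (pt (rep o)))) o r) =
      cls (pt (rep o)) r.1 :=
  DirectSum.toAddMonoid_of _ _ _

theorem eps_incl (v : D.Coeff) : eps Γ X 0 (D.incl v) = 0 := by
  classical
  induction v using DirectSum.induction_on with
  | zero => simp
  | of o r => rw [incl_of, eps_cls, RC.mem_reduced.1 r.2, zero_smul]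
  | add a b ha hb => rw [map_add, map_add, ha, hb, add_zero]

/-- Coefficients on a translated simplex come from the simplex itself, with the same augmentation. -/
theorem exists_cls_eq (g : Γ) (σ : C(Splx n, X)) (r : RC (stb Γ (g • σ))) :
    ∃ r' : RC (stb Γ σ), RC.aug _ r' = RC.aug _ r ∧ cls (g • σ) r = cls σ r' := by
  let e := MulAction.stabilizerEquivStabilizer (G := Γ) (a := σ) (b := g • σ) rfl
  refine ⟨RC.ind e.symm.toMonoidHom r, RC.aug_ind _ _, ?_⟩
  have hr : RC.ind (Sing.conj (n := SimplexCategory.mk n) g σ) (RC.ind e.symm.toMonoidHom r) = r := by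
    rw [RC.ind_comp]
    have : (Sing.conj (n := SimplexCategory.mk n) g σ).comp e.symm.toMonoidHom = MonoidHom.id _ :=
      MonoidHom.ext fun h => e.apply_symm_apply h
    rw [this, RC.ind_id]
  conv_lhs => rw [← hr]
  exact cls_smul g σ _

/-- At time `0`, a reduced `0`-chain of the singular part becomes a chain on the representatives of
the discrete set. -/
theorem retract_mem_range {a : BC Γ X 0} (ha : a ∈ redChains Γ (singSimplices Γ X 0)) :
    ∃ v, D.incl v = D.retract 0 a := by
  classical
  refine redChains_induction (P := fun a => ∃ v, D.incl v = D.retract 0 a) ⟨0, by simp⟩ ?_ ?_ ha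
  · rintro a b ⟨v, hv⟩ ⟨w, hw⟩
    exact ⟨v + w, by rw [map_add, map_add, hv, hw]⟩
  · intro σ hσ r hr
    have h1 : ∀ y, D.cylHom (cylIncl 0 0) σ y = D.toFun 0 (σ y) := fun y => D.cylHom_apply _ hσ y
    obtain ⟨o, g, hg⟩ := exists_smul_rep (D := D) (D.mem 0 (hσ (vert 0 0))) (D.idem _ (hσ _))
    have h2 : D.cylHom (cylIncl 0 0) σ = g • pt (rep o) := by
      rw [eq_pt (D.cylHom (cylIncl 0 0) σ), h1, ← hg]
      rfl
    have h3 : ∀ (τ : C(Splx 0, X)) (s : RC (stb Γ τ)), τ = g • pt (rep o) → RC.aug _ s = 0 →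
        ∃ v, D.incl v = cls τ s := by
      rintro _ s rfl hs
      obtain ⟨s', hs', e⟩ := exists_cls_eq g (pt (rep o)) s
      exact ⟨DirectSum.of (fun o : D.Orbits => RC.reduced (stb Γ (pt (rep o)))) o
        ⟨s', RC.mem_reduced.2 (hs'.trans hs)⟩, by rw [incl_of, e]⟩
    rw [retract, push_cls]
    exact h3 _ _ h2 (by rw [RC.aug_ind, hr])

open Classical in
theorem classSum_cls_rep {o o' : D.Orbits} {h : stb Γ (pt (rep o))} (h1 : h ≠ 1) (hne : o' ≠ o)
    (r : RC (stb Γ (pt (rep o')))) :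
    classSum (ConjClasses.mk (h : Γ)) (cls (pt (rep o')) r) = 0 := by
  rw [classSum_cls]
  have : (fun h' : stb Γ (pt (rep o')) =>
      if ConjClasses.mk (h' : Γ) = ConjClasses.mk (h : Γ) then (1 : ℂ) else 0) = 0 := by
    funext h'
    refine if_neg fun e => hne ?_
    obtain ⟨g, hg⟩ := isConj_iff.1 (ConjClasses.mk_eq_mk_iff_isConj.1 e.symm)
    exact (eq_of_conj (fun e => h1 (Subtype.ext e)) (mem_stb_pt.1 h.2) (mem_stb_pt.1 h'.2) hg
      (isOfFinOrder_stb h')).1.symm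
  rw [this]
  cases nonempty_fintype (stb Γ (pt (rep o')))
  simp [avg_apply]

/-- The coefficients of a chain on the discrete set can be recovered from its class sums, because
conjugacy classes of stabilisers are not fused in `Γ`. -/
theorem eq_zero_of_classSum {o : D.Orbits} {r : RC (stb Γ (pt (rep o)))} (hr : RC.aug _ r = 0)
    (h : ∀ k : stb Γ (pt (rep o)), k ≠ 1 →
      classSum (ConjClasses.mk (k : Γ)) (cls (pt (rep o)) r) = 0) : r = 0 := by
  classical
  cases nonempty_fintype (stb Γ (pt (rep o)))
  have key : ∀ k : stb Γ (pt (rep o)), k ≠ 1 → r.1 k = 0 := by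
    intro k hk
    have hsum := h k hk
    rw [classSum_cls, avg_apply, mul_eq_zero, or_iff_right (inv_ne_zero card_ne_zero')] at hsum
    have hval : ∀ k' : stb Γ (pt (rep o)),
        (if ConjClasses.mk (k' : Γ) = ConjClasses.mk (k : Γ) then (1 : ℂ) else 0) * r.1 k' =
        if ConjClasses.mk (k' : Γ) = ConjClasses.mk (k : Γ) then r.1 k else 0 := by
      intro k'
      split_ifs with e
      · rw [one_mul]
        obtain ⟨g, hg⟩ := isConj_iff.1 (ConjClasses.mk_eq_mk_iff_isConj.1 e.symm)
        have hgs := (eq_of_conj (fun e => hk (Subtype.ext e)) (mem_stb_pt.1 k.2)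
          (mem_stb_pt.1 k'.2) hg (isOfFinOrder_stb k')).2
        let x : stb Γ (pt (rep o)) := ⟨g, mem_stb_pt.2 hgs⟩
        have : k = x⁻¹ * k' * x := Subtype.ext (by
          change (k : Γ) = g⁻¹ * (k' : Γ) * g
          rw [← hg]
          group)
        rw [this, RC.conj_invariant r.2]
      · rw [zero_mul]
    simp only [hval] at hsum
    rw [← Finset.sum_filter, Finset.sum_const, nsmul_eq_mul, mul_eq_zero] at hsum
    refine hsum.resolve_left fun h0 => ?_
    rw [Nat.cast_eq_zero, Finset.card_eq_zero] at h0
    exact Finset.notMem_empty k (h0 ▸ Finset.mem_filter.2 ⟨Finset.mem_univ k, rfl⟩)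
  refine Subtype.ext (funext fun k => ?_)
  by_cases hk : k = 1
  · subst hk
    have h0 := RC.aug_eq r
    rw [hr, avg_apply, Finset.sum_eq_single 1] at h0
    · simpa using h0
    · intro k _ hk
      rw [key k hk, mul_zero]
    · simp
  · exact key k hk

/-- Chains on the representatives of the discrete set are not boundaries: class sums vanish on
boundaries, and they detect these chains. -/
theorem eq_zero_of_incl_eq_bd {v : D.Coeff} {b : BC Γ X 1} (h : D.incl v = bd Γ X 0 b) : v = 0 := by
  classical
  refine DFinsupp.ext fun o => Subtype.ext ?_
  refine D.eq_zero_of_classSum (RC.mem_reduced.1 (v o).2) fun k hk => ?_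
  rw [← classSum_bd (ConjClasses.mk (k : Γ)) b, ← h]
  clear h
  induction v using DirectSum.induction_on with
  | zero => simp
  | add a b ha hb =>
    rw [map_add, map_add, ← ha, ← hb, ← map_add, ← map_add]
    rfl
  | of o' r =>
    rw [incl_of]
    by_cases e : o' = o
    · subst e
      rw [DirectSum.of_eq_same]
    · rw [DirectSum.of_eq_of_ne _ _ _ (Ne.symm e), D.classSum_cls_rep hk e]
      simp

end DiscreteDeformation

open SplxSet

variable (Γ X) in
/-- The sum of the coefficients of a `0`-chain of orbits of simplices. -/
noncomputable def coeffSum : (orbSing Γ X).Ch 0 →ₗ[ℤ] ℤ :=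
  Finsupp.linearCombination ℤ fun _ => (1 : ℤ)

theorem coeffSum_of (q : (orbSing Γ X).S 0) : coeffSum Γ X (of q) = 1 := by
  simp [coeffSum, of]

theorem coeffSum_d (c : (orbSing Γ X).Ch 1) : coeffSum Γ X ((orbSing Γ X).d c) = 0 := by
  have : coeffSum Γ X ∘ₗ (orbSing Γ X).d = 0 := SplxSet.hom_ext fun q => by
    rw [LinearMap.comp_apply, d_of, map_sum, Fin.sum_univ_two]
    simp [coeffSum_of]
  exact LinearMap.congr_fun this c

theorem exists_d_eq_sub (x y : X) : ∃ w : (orbSing Γ X).Ch 1, (orbSing Γ X).d w =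
    of (Q := orbSing Γ X) (n := 0) (Quotient.mk _ (pt y)) -
      of (Q := orbSing Γ X) (n := 0) (Quotient.mk _ (pt x)) := by
  have := pathConnectedSpace Γ X
  let γ := PathConnectedSpace.somePath x y
  let τ : C(Splx 1, X) := ⟨fun z => γ ⟨z 1, z.2.1 1, stdSimplex.le_one z 1⟩,
    γ.continuous.comp (by
      refine Continuous.subtype_mk ?_ _
      exact (continuous_apply 1).comp continuous_subtype_val)⟩
  have hface : ∀ (i : Fin 2), τ.comp (face i) = pt (τ (vert 1 (i.succAbove 0))) := fun i => by
    rw [eq_pt (τ.comp (face i))]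
    exact congrArg (fun z => pt (τ z)) (congrFun (real_comp_vert (vert 1 ∘ i.succAbove)) 0)
  refine ⟨of (Q := orbSing Γ X) (n := 1) (Quotient.mk _ τ), ?_⟩
  have h0 : τ (vert 1 0) = x := by
    refine Eq.trans (congrArg γ (Subtype.ext ?_)) γ.source
    simp [vert]
  have h1 : τ (vert 1 1) = y := by
    refine Eq.trans (congrArg γ (Subtype.ext ?_)) γ.target
    simp [vert]
  rw [d_of, Fin.sum_univ_two]
  have e0 : (orbSing Γ X).act (face 0) (Quotient.mk _ τ) = Quotient.mk _ (pt y) := by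
    rw [← h1]
    exact congrArg (Quotient.mk _) (hface 0)
  have e1 : (orbSing Γ X).act (face 1) (Quotient.mk _ τ) = Quotient.mk _ (pt x) := by
    rw [← h0]
    exact congrArg (Quotient.mk _) (hface 1)
  rw [e0, e1]
  simp [sub_eq_add_neg]

theorem exists_d_eq_sub_zsmul (x : X) (c : (orbSing Γ X).Ch 0) :
    ∃ (m : ℤ) (w : (orbSing Γ X).Ch 1), (orbSing Γ X).d w =
      c - m • of (Q := orbSing Γ X) (n := 0) (Quotient.mk _ (pt x)) := by
  induction c using Finsupp.induction_linear with
  | zero => exact ⟨0, 0, by simp⟩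
  | add a b ha hb =>
    obtain ⟨m, w, h⟩ := ha
    obtain ⟨m', w', h'⟩ := hb
    exact ⟨m + m', w + w', by rw [map_add, h, h', add_smul]; abel⟩
  | single q r =>
    induction q using Quotient.inductionOn with | _ σ
    obtain ⟨w, hw⟩ := exists_d_eq_sub (Γ := Γ) x (σ (vert 0 0))
    refine ⟨r, r • w, ?_⟩
    rw [map_zsmul, hw, ← eq_pt σ, smul_sub]
    congr 1
    rw [of, Finsupp.smul_single, smul_eq_mul, mul_one]

namespace DiscreteDeformation

variable (D : DiscreteDeformation Γ X)

/-- The `0`-chains that represent the homology classes of degree zero. -/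
noncomputable def zeroChains (x : X) : ℤ × D.Coeff →+ BC Γ X 0 :=
  ((zmultiplesHom (BC Γ X 0)) (cls (pt x) (RC.one _))).coprod D.incl

theorem zeroChains_apply (x : X) (m : ℤ) (v : D.Coeff) :
    D.zeroChains x (m, v) = m • cls (pt x) (RC.one _) + D.incl v := rfl

/-- The integer is recovered by `eps` and the sum of the coefficients, and the rest by class sums. -/
theorem eq_zero_of_zeroChains_eq_bd (x : X) {a : ℤ × D.Coeff} {b : BC Γ X 1}
    (h : D.zeroChains x a = bd Γ X 0 b) : a = 0 := by
  obtain ⟨m, v⟩ := a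
  rw [zeroChains_apply] at h
  have hm : m = 0 := by
    have := congrArg (fun c => coeffSum Γ X (eps Γ X 0 c)) h
    rwa [eps_bd, coeffSum_d, map_add, eps_incl, add_zero, map_zsmul, eps_cls, RC.aug_one, one_smul,
      map_zsmul, coeffSum_of, smul_eq_mul, mul_one] at this
  subst hm
  rw [zero_smul, zero_add] at h
  rw [D.eq_zero_of_incl_eq_bd h]
  rfl

theorem exists_sub_zeroChains_eq_bd (x : X) (c : BC Γ X 0) :
    ∃ (a : ℤ × D.Coeff) (b : BC Γ X 1), c - D.zeroChains x a = bd Γ X 0 b := by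
  obtain ⟨m, w, hw⟩ := exists_d_eq_sub_zsmul (Γ := Γ) x (eps Γ X 0 c)
  have h0 : eps Γ X 0 (c - m • cls (pt x) (RC.one _) - bd Γ X 0 (sec Γ X 1 w)) = 0 := by
    rw [map_sub, map_sub, eps_bd, eps_sec, hw, map_zsmul, eps_cls, RC.aug_one, one_smul, sub_self]
  -- up to a boundary, a multiple of a point with trivial coefficient leaves a reduced chain
  have ha := mem_redChains_of_eps_eq_zero h0
  obtain ⟨v, hv⟩ := D.retract_mem_range ha
  refine ⟨(m, v), sec Γ X 1 w +
    D.prism 0 (c - m • cls (pt x) (RC.one _) - bd Γ X 0 (sec Γ X 1 w)), ?_⟩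
  rw [bd_add, D.bd_prism_zero ha, zeroChains_apply, hv]
  abel

/-! ### The comparison in positive degrees -/

include D in
/-- `eps` is injective on homology in positive degrees. -/
theorem exists_eq_bd_of_eps_eq_d {n : ℕ} {c : BC Γ X (n + 1)} (hc : bd Γ X n c = 0)
    {w : (orbSing Γ X).Ch (n + 2)} (h : eps Γ X (n + 1) c = (orbSing Γ X).d w) :
    ∃ b, c = bd Γ X (n + 1) b := by
  have h0 : eps Γ X (n + 1) (c - bd Γ X (n + 1) (sec Γ X (n + 2) w)) = 0 := by
    rw [map_sub, eps_bd, eps_sec, h, sub_self]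
  obtain ⟨b, -, hb⟩ := D.exists_bd_eq (mem_redChains_of_eps_eq_zero h0)
    (by rw [bd_sub, bd_bd, hc, sub_zero])
  exact ⟨sec Γ X (n + 2) w + b, by rw [bd_add, hb, add_sub_cancel]⟩

include D in
/-- `eps` is surjective on cycles in positive degrees. -/
theorem exists_eps_eq {n : ℕ} {w : (orbSing Γ X).Ch (n + 1)} (hw : (orbSing Γ X).d w = 0) :
    ∃ c : BC Γ X (n + 1), bd Γ X n c = 0 ∧ eps Γ X (n + 1) c = w := by
  have h0 : eps Γ X n (bd Γ X n (sec Γ X (n + 1) w)) = 0 := by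
    rw [eps_bd, eps_sec, hw]
  have ha := mem_redChains_of_eps_eq_zero h0
  obtain ⟨b, hb, hb'⟩ : ∃ b ∈ redChains Γ (singSimplices Γ X (n + 1)),
      bd Γ X n b = bd Γ X n (sec Γ X (n + 1) w) := by
    cases n with
    | succ n => exact D.exists_bd_eq ha (bd_bd _)
    | zero =>
      -- in degree zero the reduced boundary is homologous to a chain on the discrete set that is again
      -- a boundary, and hence vanishes
      refine ⟨_, D.prism_mem ha, ?_⟩
      have h1 := D.bd_prism_zero ha
      obtain ⟨v, hv⟩ := D.retract_mem_range ha
      have h2 : D.incl v = bd Γ X 0 (sec Γ X 1 w - D.prism 0 (bd Γ X 0 (sec Γ X 1 w))) := by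
        rw [bd_sub, h1, hv, sub_sub_cancel]
      rw [h1, ← hv, D.eq_zero_of_incl_eq_bd h2, map_zero, sub_zero]
  refine ⟨sec Γ X (n + 1) w - b, by rw [bd_sub, hb', sub_self], ?_⟩
  rw [map_sub, eps_sec, eps_eq_zero_of_mem hb, sub_zero]

end DiscreteDeformation

end DegreeZero

/-! ### Homology groups in terms of elements -/

section Homology

variable {R : Type*} [Ring R] (K L : ChainComplex (ModuleCat.{u} R) ℕ) (q : ℕ)

/-- The group of cycles of degree `q`. -/
def cyclesOf : AddSubgroup (K.X q) where
  carrier := {z | ∀ j, (K.d q j).hom z = 0}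
  zero_mem' j := map_zero _
  add_mem' ha hb j := by rw [map_add, ha j, hb j, add_zero]
  neg_mem' ha j := by rw [map_neg, ha j, neg_zero]

/-- Homology is the quotient of the cycles by the boundaries, stated with a surjection from the
cycles whose kernel consists of the boundaries. -/
theorem exists_homology_proj : ∃ π : cyclesOf K q →+ K.homology q, Function.Surjective π ∧
    ∀ z, π z = 0 ↔ ∃ y, (K.d (q + 1) q).hom y = z := by
  let S := K.sc q
  let e : (LinearMap.ker S.g.hom ⧸ LinearMap.range S.moduleCatToCycles) ≃ₗ[R] K.homology q :=
    S.moduleCatHomologyIso.symm.toLinearEquiv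
  have hZ : ∀ z : K.X q, z ∈ cyclesOf K q ↔ S.g.hom z = 0 := by
    refine fun z => ⟨fun h => h _, fun h j => ?_⟩
    by_cases hj : (ComplexShape.down ℕ).Rel q j
    · obtain rfl := (ComplexShape.down ℕ).next_eq' hj
      exact h
    · rw [K.shape _ _ hj]
      rfl
  let i : cyclesOf K q →+ LinearMap.ker S.g.hom :=
    { toFun := fun z => ⟨z.1, (hZ _).1 z.2⟩
      map_zero' := rfl
      map_add' := fun _ _ => rfl }
  let π : cyclesOf K q →+ K.homology q :=
    (e.toLinearMap.toAddMonoidHom.comp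
      (LinearMap.range S.moduleCatToCycles).mkQ.toAddMonoidHom).comp i
  have hprev : ∀ p, p = q + 1 → ∀ z : K.X q,
      (∃ y, (K.d p q).hom y = z) ↔ ∃ y, (K.d (q + 1) q).hom y = z := by
    rintro _ rfl z
    rfl
  refine ⟨π, fun h => ?_, fun z => ?_⟩
  · obtain ⟨w, hw⟩ := (LinearMap.range S.moduleCatToCycles).mkQ_surjective (e.symm h)
    refine ⟨⟨w.1, (hZ _).2 w.2⟩, ?_⟩
    exact (congrArg e hw).trans (e.apply_symm_apply _)
  · rw [← hprev _ (ChainComplex.prev ℕ q)]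
    refine (LinearEquiv.map_eq_zero_iff e).trans ((Submodule.Quotient.mk_eq_zero _).trans ?_)
    exact exists_congr fun y => Subtype.ext_iff

theorem nonempty_addEquiv_of_surjective {Z Z' H H' : Type*} [AddCommGroup Z] [AddCommGroup Z']
    [AddCommGroup H] [AddCommGroup H'] {π : Z →+ H} {π' : Z' →+ H'}
    (hπ : Function.Surjective π) (θ : Z →+ Z') (hs : ∀ h, ∃ z, π' (θ z) = h)
    (hk : ∀ z, π z = 0 ↔ π' (θ z) = 0) : Nonempty (H ≃+ H') := by
  have hker : π.ker = (π'.comp θ).ker := AddSubgroup.ext hk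
  exact ⟨(QuotientAddGroup.quotientKerEquivOfSurjective π hπ).symm.trans
    ((QuotientAddGroup.quotientAddEquivOfEq hker).trans
      (QuotientAddGroup.quotientKerEquivOfSurjective (π'.comp θ) hs))⟩

variable {K L q}

/-- A chain map in degree `q` induces an isomorphism on homology if it does so on the level of
cycles modulo boundaries. -/
theorem nonempty_homology_equiv (θ : K.X q →+ L.X q)
    (hcyc : ∀ z ∈ cyclesOf K q, θ z ∈ cyclesOf L q)
    (hinj : ∀ z ∈ cyclesOf K q, (∃ y, (K.d (q + 1) q).hom y = z) ↔
      ∃ w, (L.d (q + 1) q).hom w = θ z)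
    (hsurj : ∀ z ∈ cyclesOf L q, ∃ z' ∈ cyclesOf K q, ∃ w, (L.d (q + 1) q).hom w = θ z' - z) :
    Nonempty (K.homology q ≃+ L.homology q) := by
  obtain ⟨π, hπ, hπ0⟩ := exists_homology_proj K q
  obtain ⟨π', hπ', hπ'0⟩ := exists_homology_proj L q
  let θ' : cyclesOf K q →+ cyclesOf L q :=
    (θ.comp (cyclesOf K q).subtype).codRestrict _ fun z => hcyc z z.2
  refine nonempty_addEquiv_of_surjective hπ (π' := π') θ' (fun h => ?_) fun z => ?_
  · obtain ⟨z, rfl⟩ := hπ' h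
    obtain ⟨z', hz', hw⟩ := hsurj z z.2
    refine ⟨⟨z', hz'⟩, ?_⟩
    rw [← sub_eq_zero, ← map_sub, hπ'0]
    exact hw
  · rw [hπ0, hπ'0]
    exact hinj z z.2

theorem nonempty_homology_zero_equiv {A : Type*} [AddCommGroup A] (θ : A →+ K.X 0)
    (hinj : ∀ a y, θ a = (K.d 1 0).hom y → a = 0)
    (hsurj : ∀ z, ∃ a y, z - θ a = (K.d 1 0).hom y) : Nonempty (A ≃+ K.homology 0) := by
  obtain ⟨π, hπ, hπ0⟩ := exists_homology_proj K 0
  have hcyc : ∀ z, z ∈ cyclesOf K 0 := fun z j => by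
    rw [K.shape]
    · rfl
    · simp
  refine nonempty_addEquiv_of_surjective (π := AddMonoidHom.id A) (π' := π)
    (fun a => ⟨a, rfl⟩) (θ.codRestrict _ fun a => hcyc _) (fun h => ?_) fun a => ?_
  · obtain ⟨z, rfl⟩ := hπ h
    obtain ⟨a, y, hy⟩ := hsurj z
    refine ⟨a, ?_⟩
    rw [eq_comm, ← sub_eq_zero, ← map_sub, hπ0]
    exact ⟨y, hy.symm⟩
  · rw [hπ0]
    constructor
    · rintro (rfl : a = 0)
      exact ⟨0, by simp⟩
    · rintro ⟨y, hy⟩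
      exact hinj a y hy.symm

end Homology

/-! ### The singular chain complex -/

section Singular

open SplxSet Opposite

variable (B : Type u) [TopologicalSpace B] (n : ℕ)

/-- The singular chain complex whose homology is `singularHomology B`. -/
noncomputable abbrev singComplex : ChainComplex (ModuleCat.{u} ℤ) ℕ :=
  (TopCat.toSSet.obj (TopCat.of B)).chainComplex (ModuleCat.of ℤ (ULift.{u} ℤ))

/-- The generator of the singular chain complex given by a singular simplex. -/
noncomputable def singGen (σ : C(Splx n, B)) : (singComplex B).X n :=
  ((TopCat.toSSet.obj (TopCat.of B)).ιChainComplex (R := ModuleCat.of ℤ (ULift.{u} ℤ))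
    (((TopCat.of B).toSSetObjEquiv (op (SimplexCategory.mk n))).symm σ)).hom ⟨1⟩

/-- The comparison of chains on singular simplices with the singular chain complex. -/
noncomputable def singIso : (sing B).Ch n →+ (singComplex B).X n :=
  Finsupp.liftAddHom fun σ => zmultiplesHom _ (singGen B n σ)

variable {B n}

theorem singIso_of (σ : C(Splx n, B)) : singIso B n (of (Q := sing B) σ) = singGen B n σ :=
  (Finsupp.liftAddHom_apply_single _ σ 1).trans (one_zsmul _)

theorem toSSet_δ (σ : C(Splx (n + 1), B)) (i : Fin (n + 2)) :
    (TopCat.toSSet.obj (TopCat.of B)).δ i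
      (((TopCat.of B).toSSetObjEquiv (op (SimplexCategory.mk (n + 1)))).symm σ) =
    ((TopCat.of B).toSSetObjEquiv (op (SimplexCategory.mk n))).symm (σ.comp (face i)) := by
  rw [Equiv.eq_symm_apply]
  ext1 t
  exact congrArg σ (map_eq_real (SimplexCategory.δ i) t)

theorem d_singGen (σ : C(Splx (n + 1), B)) : ((singComplex B).d (n + 1) n).hom (singGen B (n + 1) σ) =
    ∑ i : Fin (n + 2), (-1 : ℤ) ^ (i : ℕ) • singGen B n (σ.comp (face i)) := by
  let ev : (ModuleCat.of ℤ (ULift.{u} ℤ) ⟶ (singComplex B).X n) →+ (singComplex B).X n :=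
    { toFun := fun f => f.hom ⟨1⟩
      map_zero' := rfl
      map_add' := fun _ _ => rfl }
  have h := (TopCat.toSSet.obj (TopCat.of B)).ιChainComplex_d (ModuleCat.of ℤ (ULift.{u} ℤ))
    (((TopCat.of B).toSSetObjEquiv (op (SimplexCategory.mk (n + 1)))).symm σ)
  refine (congrArg ev h).trans ?_
  rw [map_sum]
  refine Finset.sum_congr rfl fun i _ => ?_
  rw [toSSet_δ, map_zsmul]
  rfl

theorem singIso_d (c : (sing B).Ch (n + 1)) :
    ((singComplex B).d (n + 1) n).hom (singIso B (n + 1) c) = singIso B n ((sing B).d c) := by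
  have : ((singComplex B).d (n + 1) n).hom.toAddMonoidHom.comp (singIso B (n + 1)) =
      (singIso B n).comp (sing B).d.toAddMonoidHom :=
    Finsupp.addHom_ext fun σ r => by
      have e : Finsupp.single σ r = r • of (Q := sing B) σ := by
        rw [of, Finsupp.smul_single, smul_eq_mul, mul_one]
      rw [e, map_zsmul, map_zsmul]
      congr 1
      change ((singComplex B).d (n + 1) n).hom (singIso B (n + 1) (of (Q := sing B) σ)) =
        singIso B n ((sing B).d (of (Q := sing B) σ))
      rw [singIso_of, d_singGen, d_of, map_sum]
      refine Finset.sum_congr rfl fun i _ => ?_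
      rw [map_zsmul]
      exact congrArg _ (singIso_of _).symm
  exact DFunLike.congr_fun this c

/-- Additive maps are linear over the integers, for arbitrary module structures. -/
def intLinear {A A' : Type*} [AddCommGroup A] [AddCommGroup A'] [Module ℤ A] [Module ℤ A']
    (f : A →+ A') : A →ₗ[ℤ] A' :=
  { f with map_smul' := fun z a => by simpa using map_intCast_smul f ℤ ℤ z a }

theorem singIso_bijective : Function.Bijective (singIso B n) := by
  let e := (TopCat.of B).toSSetObjEquiv (op (SimplexCategory.mk n))
  let T := TopCat.toSSet.obj (TopCat.of B)
  let ι := fun x => T.ιChainComplex (R := ModuleCat.of ℤ (ULift.{u} ℤ)) (n := n) x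
  let val : ∀ x, ModuleCat.of ℤ (ULift.{u} ℤ) ⟶ ModuleCat.of ℤ ((sing B).Ch n) := fun x =>
    ModuleCat.ofHom (intLinear ((zmultiplesHom ((sing B).Ch n) (of (Q := sing B) (e x))).comp
      (AddEquiv.ulift : ULift.{u} ℤ ≃+ ℤ).toAddMonoidHom))
  let J : (singComplex B).X n ⟶ ModuleCat.of ℤ ((sing B).Ch n) :=
    Limits.Cofan.IsColimit.desc (T.isColimitChainComplexXCofan (ModuleCat.of ℤ (ULift.{u} ℤ)) n) val
  have hJ : ∀ x, ι x ≫ J = val x := fun x => Limits.Cofan.IsColimit.fac _ _ x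
  have hJ' : ∀ x (k : ULift.{u} ℤ), J.hom ((ι x).hom k) = k.down • of (Q := sing B) (e x) :=
    fun x k => LinearMap.congr_fun (congrArg ModuleCat.Hom.hom (hJ x)) k
  have h1 : J.hom.toAddMonoidHom.comp (singIso B n) = AddMonoidHom.id _ :=
    Finsupp.addHom_ext fun σ r => by
      have hr : Finsupp.single σ r = r • of (Q := sing B) σ := by
        rw [of, Finsupp.smul_single, smul_eq_mul, mul_one]
      rw [hr, map_zsmul, map_zsmul]
      congr 1
      change J.hom (singIso B n (of (Q := sing B) σ)) = of (Q := sing B) σ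
      rw [singIso_of]
      refine (hJ' (e.symm σ) ⟨1⟩).trans ?_
      rw [Equiv.apply_symm_apply, one_smul]
  have h2 : J ≫ ModuleCat.ofHom (intLinear (singIso B n)) = 𝟙 _ := by
    refine SSet.chainComplex_hom_ext fun x => ModuleCat.hom_ext (LinearMap.ext fun k => ?_)
    change singIso B n (J.hom ((ι x).hom k)) = (ι x).hom k
    rw [hJ', map_zsmul, singIso_of]
    change k.down • (ι (e.symm (e x))).hom ⟨1⟩ = _
    rw [Equiv.symm_apply_apply, ← map_zsmul]
    congr 1
    exact ULift.ext _ _ (by simp)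
  exact ⟨Function.LeftInverse.injective (g := J.hom) fun c => DFunLike.congr_fun h1 c,
    Function.RightInverse.surjective (g := J.hom) fun c =>
      LinearMap.congr_fun (congrArg ModuleCat.Hom.hom h2) c⟩

end Singular

/-! ### The deformation of the singular part -/

section Main

variable {Γ : Type u} [Group Γ]

/-- A `Γ`-CW complex of dimension zero is discrete. -/
theorem discreteTopology_of_dim_eq_zero (S : Type u) [TopologicalSpace S] [MulAction Γ S] [T2Space S]
    [ContinuousConstSMul Γ S] [GammaCW Γ S] (h : GammaCW.dim Γ S = 0) : DiscreteTopology S := by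
  refine discreteTopology_iff_forall_isClosed.2 fun A => isClosed_of_cells (Γ := Γ) fun n e => ?_
  have hn : n = 0 := by
    have : (n : ℕ∞) ≤ GammaCW.dim Γ S :=
      le_iSup₂_of_le (f := fun (n : ℕ) (_ : Nonempty (Topology.RelCWComplex.cell (Set.univ : Set S) n))
        => (n : ℕ∞)) n ⟨e⟩ le_rfl
    rw [h] at this
    simpa using this
  subst hn
  refine Or.inr (Set.Finite.isClosed (Set.Finite.subset ?_ Set.inter_subset_right))
  exact (Set.subsingleton_of_subsingleton.image _).finite

variable {X : Type u} [TopologicalSpace X] [MulAction Γ X]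
  [IsClassifyingSpaceForProperActions Γ X]

omit [IsClassifyingSpaceForProperActions Γ X] in
/-- If the singular part is equivariantly homotopy equivalent to a discrete space, then it can be
deformed to a discrete set of points. -/
theorem nonempty_discreteDeformation_of_discreteTopology (S : Type u) [TopologicalSpace S]
    [MulAction Γ S] [DiscreteTopology S]
    (h : GammaHomotopyEquivalent Γ (X := singularPart Γ X) S) :
    Nonempty (DiscreteDeformation Γ X) := by
  classical
  obtain ⟨f, h, hf, hh, ⟨F, hF⟩, ⟨F', hF'⟩⟩ := h
  -- homotopic maps to a discrete space are equal
  have hfh : ∀ s, f (h s) = s := fun s => by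
    have hs : IsPreconnected (Set.range fun t : unitInterval => F' (t, s)) :=
      isPreconnected_range (by fun_prop)
    have := hs.subsingleton ⟨0, rfl⟩ ⟨1, rfl⟩
    simpa using this
  have hsmul : ∀ (g : Γ) {x : X}, x ∈ singularPart Γ X → g • x ∈ singularPart Γ X :=
    fun g _ hx => (singularPart Γ X).smul_mem g hx
  let D : unitInterval → X → X := fun t x =>
    if hx : x ∈ singularPart Γ X then (F (t, ⟨x, hx⟩) : X) else x
  have hD : ∀ t x (hx : x ∈ singularPart Γ X), D t x = F (t, ⟨x, hx⟩) := fun t x hx => dif_pos hx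
  have hD0 : ∀ x (hx : x ∈ singularPart Γ X), D 0 x = h (f ⟨x, hx⟩) := fun x hx => by
    rw [hD _ _ hx, F.apply_zero]
    rfl
  refine ⟨⟨D, fun t g x => ?_, ?_, fun x => ?_, fun A hA hc x hx y hy => ?_, fun x hx => ?_⟩⟩
  · by_cases hx : x ∈ singularPart Γ X
    · rw [hD _ _ hx, hD _ _ (hsmul g hx)]
      exact congrArg Subtype.val (hF g t ⟨x, hx⟩)
    · have hgx : g • x ∉ singularPart Γ X := fun h' => hx (by simpa using hsmul g⁻¹ h')
      simp only [D, dif_neg hx, dif_neg hgx]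
  · rw [continuousOn_iff_continuous_domRestrict]
    have : Continuous fun z : (Set.univ ×ˢ (singularPart Γ X : Set X) : Set (unitInterval × X)) =>
        (F (z.1.1, ⟨z.1.2, z.2.2⟩) : X) := by
      refine continuous_subtype_val.comp (F.continuous.comp ?_)
      exact (continuous_fst.comp continuous_subtype_val).prodMk
        ((continuous_snd.comp continuous_subtype_val).subtype_mk _)
    convert this with z
    exact hD _ _ z.2.2
  · by_cases hx : x ∈ singularPart Γ X
    · rw [hD _ _ hx, F.apply_one]
      rfl
    · exact dif_neg hx
  · rw [hD0 x (hA hx), hD0 y (hA hy)]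
    have hA' : IsPreconnected ((↑) ⁻¹' A : Set (singularPart Γ X)) := by
      have himg : (Subtype.val '' (Subtype.val ⁻¹' A : Set (singularPart Γ X)) : Set X) = A := by
        ext x
        exact ⟨by rintro ⟨y, hy, rfl⟩; exact hy, fun hx => ⟨⟨x, hA hx⟩, hx, rfl⟩⟩
      exact Topology.IsInducing.subtypeVal.isPreconnected_image.1 (himg.symm ▸ hc)
    have := (hA'.image f f.continuous.continuousOn).subsingleton
      ⟨⟨x, hA hx⟩, hx, rfl⟩ ⟨⟨y, hA hy⟩, hy, rfl⟩
    rw [this]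
  · rw [hD0 x hx, hD0 _ (h _).2]
    exact congrArg (fun s => (h s : X)) (hfh _)

omit [IsClassifyingSpaceForProperActions Γ X] in
/-- The infimum of a non-empty set of extended natural numbers is attained, so that the singular part
is equivariantly homotopy equivalent to a zero-dimensional complex. -/
theorem nonempty_discreteDeformation (hdim : singularDim Γ X = 0) :
    Nonempty (DiscreteDeformation Γ X) := by
  have key : ∀ s : Set ℕ∞, sInf s = 0 → 0 ∈ s := fun s hs => by
    rcases s.eq_empty_or_nonempty with rfl | h
    · exact absurd (sInf_empty.symm.trans hs) ENat.top_ne_zero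
    · exact hs ▸ csInf_mem h
  obtain ⟨S, _, _, _, _, _, hS, hd⟩ := key _ hdim
  have := discreteTopology_of_dim_eq_zero (Γ := Γ) S hd.symm
  exact nonempty_discreteDeformation_of_discreteTopology S hS

/-! ### Conjugacy classes of elements of finite order -/

namespace DiscreteDeformation

variable (D : DiscreteDeformation Γ X)

/-- The conjugacy classes of non-trivial elements of the stabilisers of the representatives of the
discrete set. -/
abbrev StabClasses : Type u :=
  Σ o : D.Orbits, {c : ConjClasses (stb Γ (pt (rep o))) // c ≠ ConjClasses.mk 1}

/-- The map from conjugacy classes in stabilisers to conjugacy classes in `Γ`; the additional point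
is mapped to the class of the identity. -/
noncomputable def toFC : Unit ⊕ D.StabClasses → FC Γ :=
  Sum.elim (fun _ => ⟨ConjClasses.mk 1, 1, IsOfFinOrder.one, rfl⟩) fun p =>
    ⟨ConjClasses.map (stb Γ (pt (rep p.1))).subtype p.2.1, by
      obtain ⟨o, c, hc⟩ := p
      induction c using Quotient.inductionOn with | _ k
      exact ⟨k, isOfFinOrder_stb k, rfl⟩⟩

theorem mk_ne_one_iff {G : Type*} [Group G] {g : G} :
    ConjClasses.mk g ≠ ConjClasses.mk 1 ↔ g ≠ 1 := by
  rw [Ne, ConjClasses.mk_eq_mk_iff_isConj, isConj_one_left]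

/-- Each non-trivial element of finite order fixes exactly one point of the discrete set, and this
point is equivariant under conjugation. -/
theorem toFC_bijective : Function.Bijective D.toFC := by
  have hne : ∀ p : D.StabClasses, (D.toFC (Sum.inr p)).1 ≠ ConjClasses.mk 1 := by
    rintro ⟨o, c, hc⟩
    induction c using Quotient.inductionOn with | _ k
    change ConjClasses.mk (k : Γ) ≠ _
    have hk : k ≠ 1 := mk_ne_one_iff.1 hc
    exact mk_ne_one_iff.2 fun e => hk (Subtype.ext e)
  constructor
  · rintro (⟨⟩ | p) (⟨⟩ | p') h
    · rfl
    · exact absurd (congrArg Subtype.val h).symm (hne p')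
    · exact absurd (congrArg Subtype.val h) (hne p)
    · obtain ⟨o, c, hc⟩ := p
      obtain ⟨o', c', hc'⟩ := p'
      induction c using Quotient.inductionOn with | _ k
      induction c' using Quotient.inductionOn with | _ k'
      have hk : k ≠ 1 := mk_ne_one_iff.1 hc
      have h' : ConjClasses.mk (k : Γ) = ConjClasses.mk (k' : Γ) := congrArg Subtype.val h
      obtain ⟨g, hg⟩ := isConj_iff.1 (ConjClasses.mk_eq_mk_iff_isConj.1 h')
      obtain ⟨rfl, hgs⟩ := eq_of_conj (fun e => hk (Subtype.ext e)) (mem_stb_pt.1 k.2)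
        (mem_stb_pt.1 k'.2) hg (isOfFinOrder_stb k')
      have : ConjClasses.mk k = ConjClasses.mk k' := ConjClasses.mk_eq_mk_iff_isConj.2
        (isConj_iff.2 ⟨⟨g, mem_stb_pt.2 hgs⟩, Subtype.ext hg⟩)
      exact congrArg Sum.inr (Sigma.ext rfl (heq_of_eq (Subtype.ext this)))
  · rintro ⟨_, g, hg, rfl⟩
    by_cases h1 : g = 1
    · exact ⟨Sum.inl (), Subtype.ext (congrArg ConjClasses.mk h1.symm)⟩
    · -- `g` fixes a point of the singular part, hence the point it is deformed to
      obtain ⟨x, hx⟩ := (isPathConnected_fixed (X := X) hg).nonempty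
      have hxs := mem_singularPart_of_smul_eq h1 hx
      obtain ⟨o, a, ha⟩ := exists_smul_rep (D := D) (D.mem 0 hxs) (D.idem _ hxs)
      have hfix : (a⁻¹ * g * a) • rep o = rep o := by
        rw [mul_smul, mul_smul, ha, D.smul_eq 0 hx, ← ha, inv_smul_smul]
      let k : stb Γ (pt (rep o)) := ⟨a⁻¹ * g * a, mem_stb_pt.2 hfix⟩
      have hk : ConjClasses.mk k ≠ ConjClasses.mk 1 := mk_ne_one_iff.2 fun e => h1 (by
        have : a⁻¹ * g * a⁻¹⁻¹ = 1 := by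
          rw [inv_inv]
          exact congrArg Subtype.val e
        rwa [conj_eq_one_iff] at this)
      refine ⟨Sum.inr ⟨o, ConjClasses.mk k, hk⟩, Subtype.ext ?_⟩
      exact ConjClasses.mk_eq_mk_iff_isConj.2 (isConj_iff.2 ⟨a, by
        change a * (a⁻¹ * g * a) * a⁻¹ = g
        group⟩)

/-- The reduced representation ring of a stabiliser has one generator for each of its non-trivial
conjugacy classes; the identity class accounts for the summand `ℤ`. -/
theorem nonempty_equiv_FC : Nonempty ((ℤ × D.Coeff) ≃+ (FC Γ →₀ ℤ)) := by
  classical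
  let e : ∀ o : D.Orbits, RC.reduced (stb Γ (pt (rep o))) ≃+
      ({c : ConjClasses (stb Γ (pt (rep o))) // c ≠ ConjClasses.mk 1} →₀ ℤ) :=
    fun o => RC.nonempty_reduced_equiv.some
  let e₁ : D.Coeff ≃+ (D.StabClasses →₀ ℤ) :=
    (DFinsupp.mapRange.addEquiv e).trans sigmaFinsuppAddEquivDFinsupp.symm
  let e₂ : ℤ ≃+ (Unit →₀ ℤ) := (Finsupp.uniqueLinearEquiv ℤ ℤ ()).symm.toAddEquiv
  exact ⟨(AddEquiv.prodCongr e₂ e₁).trans (Finsupp.sumFinsuppAddEquivProdFinsupp.symm.trans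
    (Finsupp.domCongr (Equiv.ofBijective _ D.toFC_bijective)))⟩

/-! ### The homology groups -/

include D in
theorem nonempty_homology_zero : Nonempty (homology Γ X 0 ≃+ (FC Γ →₀ ℤ)) := by
  obtain ⟨x⟩ := (pathConnectedSpace Γ X).nonempty
  obtain ⟨e⟩ := nonempty_homology_zero_equiv (K := chainComplex Γ X) (D.zeroChains x)
    (fun a y h => D.eq_zero_of_zeroChains_eq_bd x (h.trans (chainComplex_d_apply 0 y)))
    (fun z => by
      obtain ⟨a, b, h⟩ := D.exists_sub_zeroChains_eq_bd x z
      exact ⟨a, b, h.trans (chainComplex_d_apply 0 b).symm⟩)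
  obtain ⟨e'⟩ := D.nonempty_equiv_FC
  exact ⟨e.symm.trans e'⟩

end DiscreteDeformation

open SplxSet

variable (Γ X) in
/-- The map from Bredon chains to singular chains of the orbit space. -/
noncomputable def toSing (n : ℕ) : BC Γ X n →+ (singComplex (Orb Γ X)).X n :=
  (singIso (Orb Γ X) n).comp (((orbMap Γ X).ch n).toAddMonoidHom.comp (eps Γ X n))

theorem toSing_apply (n : ℕ) (c : BC Γ X n) :
    toSing Γ X n c = singIso (Orb Γ X) n ((orbMap Γ X).ch n (eps Γ X n c)) := rfl

theorem singIso_mem_cyclesOf {B : Type u} [TopologicalSpace B] {n : ℕ} {c : (sing B).Ch (n + 1)} :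
    singIso B (n + 1) c ∈ cyclesOf (singComplex B) (n + 1) ↔ (sing B).d c = 0 := by
  constructor
  · intro h
    have := h n
    rw [singIso_d] at this
    exact singIso_bijective.1 (this.trans (map_zero _).symm)
  · intro h j
    by_cases hj : j + 1 = n + 1
    · obtain rfl : j = n := by omega
      rw [singIso_d, h, map_zero]
    · rw [(singComplex B).shape _ _ hj]
      rfl

theorem mem_cyclesOf_chainComplex {n : ℕ} {c : BC Γ X (n + 1)} :
    c ∈ cyclesOf (chainComplex Γ X) (n + 1) ↔ bd Γ X n c = 0 := by
  constructor
  · intro h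
    exact (chainComplex_d_apply n c).symm.trans (h n)
  · intro h j
    by_cases hj : j + 1 = n + 1
    · obtain rfl : j = n := by omega
      exact (chainComplex_d_apply j c).trans h
    · rw [(chainComplex Γ X).shape _ _ hj]
      rfl

variable (Γ X) in
/-- Acyclicity over the whole orbit space, without the support conditions. -/
theorem exists_lift {n : ℕ} {a : (orbSing Γ X).Ch n} {b : (sing (Orb Γ X)).Ch (n + 1)}
    (ha : (orbSing Γ X).IsCycle a) (h : (orbMap Γ X).ch n a = (sing (Orb Γ X)).d b) :
    ∃ (a' : (orbSing Γ X).Ch (n + 1)) (b' : (sing (Orb Γ X)).Ch (n + 2)),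
      (orbSing Γ X).d a' = a ∧ (sing (Orb Γ X)).d b' = b - (orbMap Γ X).ch (n + 1) a' := by
  obtain ⟨hcw⟩ := IsClassifyingSpaceForProperActions.exists_gammaCW (Γ := Γ) (X := X)
  obtain ⟨a', -, b', -, h₁, h₂⟩ := acyclicOver_univ Γ X a b
    ⟨fun _ _ _ => trivial, fun _ _ _ => trivial, ha, h⟩
  exact ⟨a', b', h₁, h₂⟩

theorem toSing_bd {n : ℕ} (c : BC Γ X (n + 1)) :
    ((singComplex (Orb Γ X)).d (n + 1) n).hom (toSing Γ X (n + 1) c) =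
      toSing Γ X n (bd Γ X n c) := by
  rw [toSing_apply, singIso_d, ← Hom.ch_d, ← eps_bd, ← toSing_apply]

theorem toSing_mem_cyclesOf {n : ℕ} {c : BC Γ X (n + 1)} (hc : bd Γ X n c = 0) :
    toSing Γ X (n + 1) c ∈ cyclesOf (singComplex (Orb Γ X)) (n + 1) := by
  rw [toSing_apply, singIso_mem_cyclesOf, ← Hom.ch_d, ← eps_bd, hc, map_zero, map_zero]

/-- `toSing` is injective on homology in positive degrees. -/
theorem DiscreteDeformation.exists_bd_eq_of_toSing_eq (D : DiscreteDeformation Γ X) {n : ℕ}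
    {c : BC Γ X (n + 1)} (hc : bd Γ X n c = 0) {w : (singComplex (Orb Γ X)).X (n + 2)}
    (hw : ((singComplex (Orb Γ X)).d (n + 2) (n + 1)).hom w = toSing Γ X (n + 1) c) :
    ∃ y, bd Γ X (n + 1) y = c := by
  obtain ⟨b, rfl⟩ := singIso_bijective.2 w
  rw [singIso_d, toSing_apply] at hw
  have hw' := singIso_bijective.1 hw
  obtain ⟨a', -, ha', -⟩ := exists_lift Γ X (a := eps Γ X (n + 1) c) (b := b)
    (by rw [IsCycle, ← eps_bd, hc, map_zero]) hw'.symm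
  obtain ⟨y, hy⟩ := D.exists_eq_bd_of_eps_eq_d hc ha'.symm
  exact ⟨y, hy.symm⟩

/-- `toSing` is surjective on homology in positive degrees. -/
theorem DiscreteDeformation.exists_toSing_sub_eq (D : DiscreteDeformation Γ X) {n : ℕ}
    {z : (singComplex (Orb Γ X)).X (n + 1)} (hz : z ∈ cyclesOf (singComplex (Orb Γ X)) (n + 1)) :
    ∃ c : BC Γ X (n + 1), bd Γ X n c = 0 ∧ ∃ w,
      ((singComplex (Orb Γ X)).d (n + 2) (n + 1)).hom w = toSing Γ X (n + 1) c - z := by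
  obtain ⟨b, rfl⟩ := singIso_bijective.2 z
  rw [singIso_mem_cyclesOf] at hz
  obtain ⟨a', b', ha', hb'⟩ := exists_lift Γ X (n := n) (a := 0) (b := b)
    (by cases n <;> simp [IsCycle]) (by rw [hz, map_zero])
  obtain ⟨c, hc, rfl⟩ := D.exists_eps_eq ha'
  refine ⟨c, hc, -singIso (Orb Γ X) (n + 2) b', ?_⟩
  rw [map_neg, singIso_d, hb', map_sub, neg_sub, toSing_apply]

theorem DiscreteDeformation.nonempty_homology_succ (D : DiscreteDeformation Γ X) (n : ℕ) :
    Nonempty (homology Γ X (n + 1) ≃+ singularHomology (Orb Γ X) (n + 1)) := by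
  refine nonempty_homology_equiv (K := chainComplex Γ X) (L := singComplex (Orb Γ X))
    (toSing Γ X (n + 1)) (fun z hz => toSing_mem_cyclesOf (mem_cyclesOf_chainComplex.1 hz))
    (fun z hz => ⟨?_, ?_⟩) (fun z hz => ?_)
  · rintro ⟨y, rfl⟩
    exact ⟨toSing Γ X (n + 2) y, (toSing_bd (n := n + 1) y).trans
      (congrArg (toSing Γ X (n + 1)) (chainComplex_d_apply (n + 1) y).symm)⟩
  · rintro ⟨w, hw⟩
    obtain ⟨y, hy⟩ := D.exists_bd_eq_of_toSing_eq (mem_cyclesOf_chainComplex.1 hz) hw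
    exact ⟨y, (chainComplex_d_apply (n + 1) y).trans hy⟩
  · obtain ⟨c, hc, w, hw⟩ := D.exists_toSing_sub_eq hz
    exact ⟨c, mem_cyclesOf_chainComplex.2 hc, w, hw⟩

end Main

end Bredon

theorem mainTheorem6 (Γ : Type u) [Group Γ] (X : Type u) [TopologicalSpace X] [MulAction Γ X]
    [Bredon.IsClassifyingSpaceForProperActions Γ X]
    (hdim : Bredon.singularDim Γ X = 0) :
    (∀ q : ℕ, 0 < q →
      Nonempty (Bredon.homology Γ X q ≃+
        Bredon.singularHomology (MulAction.orbitRel.Quotient Γ X) q)) ∧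
    Nonempty (Bredon.homology Γ X 0 ≃+ (Bredon.FC Γ →₀ ℤ)) := by
  obtain ⟨D⟩ := Bredon.nonempty_discreteDeformation hdim
  refine ⟨fun q hq => ?_, D.nonempty_homology_zero⟩
  obtain ⟨n, rfl⟩ := Nat.exists_eq_add_one_of_ne_zero hq.ne'
  exact D.nonempty_homology_succ n
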